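/- Let $n=2j\ge 0$ be an integer. On $S^2\subset\mathbb R^3$ let $d\mathbf n$ be the surface measure of total mass $4\pi$, $\mathbf n_0=(0,0,1)$, and let $Poly_{\mathbb C}(S^2)_{\le n}$ be the restrictions to $S^2$ of complex polynomials in $x,y,z$ of degree $\le n$. $SU(2)$ acts on $S^2$ by $g(\mathbf n\cdot\sigma)g^{-1}=(g\mathbf n)\cdot\sigma$ ($\sigma$ the Pauli matrices) and on $M_{\mathbb C}(n+1)$ by $P^g=\varphi_j(g)P\varphi_j(g)^{-1}$, where $\varphi_j$ is the unitary irreducible representation on $\mathbb C^{n+1}$ (with $\Phi(z)=\big(\binom nk^{1/2}z_1^{n-k}z_2^k\big)_{0\le k\le n}$, it is given by $\Phi(gz)=\varphi_j(g)\Phi(z)$). The coupled standard basis of $M_{\mathbb C}(n+1)$ is $e^j(l,m)$, $0\le l\le n$, $-l\le m\le l$: $e^j(l,l)=\frac{(-1)^l}{\mu_l}J_+^l$, with $\mu_l$ the Hilbert–Schmidt norm of $J_+^l$, and $e^j(l,m-1)=[J_-,e^j(l,m)]/\sqrt{(l+m)(l-m+1)}$, where $J_+=J_-^T$ and $J_-$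 has entries $\sqrt{k(n-k+1)}$, $1\le k\le n$, just below the diagonal. For $m_1,m_2\in\{-j,\dots,j\}$ let $C^{j,j,l}_{m_1,m_2,m}$ be the Hilbert–Schmidt inner product of $e^j(l,m)$ with $(-1)^{j+m_2}\mathcal E_{j-m_1+1,\,j+m_2+1}$ ($\mathcal E_{p,q}$ the one-element matrices), put $$\mathcal M[j]^{l_1,l_2,l_3}_{m_1,m_2,m_3}=\sum_{\mu_1,\mu_2,\mu_3=-j}^{j}(-1)^{j+\mu_2}C^{j,j,l_1}_{\mu_1,\mu_2,m_1}C^{j,j,l_2}_{-\mu_2,\mu_3,m_2}C^{j,j,l_3}_{\mu_1,\mu_3,m_3},$$ and define the Wigner product symbol by $$\mathcal M[j]^{l_1,l_2,l_3}_{m_1,m_2,-m_3}=(-1)^{n-m_3}\begin{bmatrix}l_1&l_2&l_3\\m_1&m_2&m_3\end{bmatrix}\![j].$$ Let $P_l$ be the Legendre polynomials and $Y_l^m$ the spherical harmonics: for $0\le m\le l$, $$Y_l^m(x,y,z)=\sqrt{2l+1}\,\sqrt{\tfrac{(l-m)!}{(l+m)!}}\;(-1)^mP_l^{(m)}(z)\,(x+iy)^m,$$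 with $P_l^{(m)}$ the $m$-th derivative of $P_l$, and $Y_l^{-m}=(-1)^m\overline{Y_l^m}$. A symbol correspondence is an injective linear map $P\mapsto W_P$ from $M_{\mathbb C}(n+1)$ to $C^\infty_{\mathbb C}(S^2)$ with $W_{P^g}(g\mathbf n)=W_P(\mathbf n)$ for $g\in SU(2)$, $W_{P^*}=\overline{W_P}$ and $\frac1{4\pi}\int_{S^2}W_P\,d\mathbf n=\frac1{n+1}\mathrm{trace}(P)$. A string of characteristic numbers is $\vec c=(c_1,\dots,c_n)$ with all $c_l\in\mathbb R\setminus\{0\}$; put $c_0=1$ and $\frac1{\vec c}=(\frac1{c_1},\dots,\frac1{c_n})$. Its operator kernel is $$K_{\vec c}(g\mathbf n_0)=(K_{\vec c})^g,\qquad K_{\vec c}=\tfrac1{n+1}I+\sum_{l=1}^n c_l\sqrt{\tfrac{2l+1}{n+1}}\;e^j(l,0),$$ and $\widetilde K_{\vec c}=K_{1/\vec c}$, $W_{\vec c}(P)(\mathbf n)=\mathrm{trace}(P\,K_{\vec c}(\mathbf n))$. Let $f\star_{\vec c}g$ be the twisted product on $Poly_{\mathbb C}(S^2)_{\le n}$ given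 by $W_{\vec c}(P)\star_{\vec c}W_{\vec c}(Q)=W_{\vec c}(PQ)$. Theorem. The symbol correspondences are exactly the maps $W_{\vec c}$, so that every twisted product is one of the $\star_{\vec c}$, and for every string $\vec c$ of characteristic numbers: (1) For all $f,g\in Poly_{\mathbb C}(S^2)_{\le n}$ and all $\mathbf n\in S^2$, $$f\star_{\vec c}g(\mathbf n)=\iint_{S^2\times S^2}f(\mathbf n_1)g(\mathbf n_2)\,\mathbb L^j_{\vec c}(\mathbf n_1,\mathbf n_2,\mathbf n)\,d\mathbf n_1d\mathbf n_2,$$ $$\mathbb L^j_{\vec c}(\mathbf n_1,\mathbf n_2,\mathbf n_3)=\Big(\frac{2j+1}{4\pi}\Big)^2\mathrm{trace}\big(\widetilde K_{\vec c}(\mathbf n_1)\widetilde K_{\vec c}(\mathbf n_2)K_{\vec c}(\mathbf n_3)\big).$$ (2) For all $\mathbf n_1,\mathbf n_2,\mathbf n_3\in S^2$, $$\mathbb L^j_{\vec c}(\mathbf n_1,\mathbf n_2,\mathbf n_3)=\frac{(-1)^n\sqrt{n+1}}{(4\pi)^2}\sum_{l_i,m_i}\begin{bmatrix}l_1&l_2&l_3\\m_1&m_2&m_3\end{bmatrix}\![j]\,\frac{c_{l_3}}{c_{l_1}c_{l_2}}\,\overline{Y_{l_1}^{m_1}(\mathbf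 n_1)}\;\overline{Y_{l_2}^{m_2}(\mathbf n_2)}\;\overline{Y_{l_3}^{m_3}(\mathbf n_3)},$$ the sum being over $0\le l_1,l_2,l_3\le n$ with $|l_1-l_2|\le l_3\le l_1+l_2$ and $-l_i\le m_i\le l_i$ with $m_1+m_2+m_3=0$. (3) Let $b_l^n=\sqrt{\frac{n+1}{2l+1}}\,e^j(l,0)_{1,1}$, the characteristic numbers of the standard Berezin correspondence, whose operator kernel at $\mathbf n_0$ is the projection $\mathrm{diag}(1,0,\dots,0)$. Then for all $\mathbf n_1,\mathbf n_2,\mathbf n_3\in S^2$, $$\mathbb L^j_{\vec c}(\mathbf n_1,\mathbf n_2,\mathbf n_3)=\Big(\frac{n+1}{2^n4\pi}\Big)^2\sum_{l_1,l_2,l_3=0}^n\frac{c_{l_3}}{c_{l_1}c_{l_2}}\,\frac1{b^n_{l_1}b^n_{l_2}b^n_{l_3}}\,\mathcal I^n_{l_1,l_2,l_3}(\mathbf n_1,\mathbf n_2,\mathbf n_3)$$ $$=\frac{\sqrt{n+1}}{(n!)^34^n(4\pi)^2}\sum_{l_1,l_2,l_3=0}^n\frac{c_{l_3}}{c_{l_1}c_{l_2}}\prod_{k=1}^3\sqrt{(n+l_k+1)!\,(n-l_k)!}\;\;\mathcal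 I^n_{l_1,l_2,l_3}(\mathbf n_1,\mathbf n_2,\mathbf n_3),$$ where $$\mathcal I^n_{l_1,l_2,l_3}(\mathbf n_1,\mathbf n_2,\mathbf n_3)=\frac1{(4\pi)^3}\int_{(S^2)^3}\prod_{k=1}^3(2l_k+1)P_{l_k}(\mathbf n_k\cdot\mathbf n_k')\,\big(1+X(\mathbf n_1',\mathbf n_2',\mathbf n_3')+i[\mathbf n_1',\mathbf n_2',\mathbf n_3']\big)^n\,d\mathbf n_1'd\mathbf n_2'd\mathbf n_3',$$ with $X(\mathbf a,\mathbf b,\mathbf c)=\mathbf a\cdot\mathbf b+\mathbf b\cdot\mathbf c+\mathbf c\cdot\mathbf a$ and $[\mathbf a,\mathbf b,\mathbf c]$ the determinant. -/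

import Mathlib

open MeasureTheory
open scoped Manifold ContDiff ComplexConjugate

noncomputable section

namespace SpinTrikernel

/-! ### The two-sphere and the group `SU(2)` -/

/-- The unit sphere `S²` in Euclidean three-space. -/
abbrev S2 : Type := Metric.sphere (0 : EuclideanSpace ℝ (Fin 3)) 1

/-- The surface area measure `dn` on `S²` (of total mass `4π`). -/
def area : Measure S2 := (volume : Measure (EuclideanSpace ℝ (Fin 3))).toSphere

/-- Cartesian coordinates of a point of the sphere. -/
def coord (x : S2) (i : Fin 3) : ℝ := (x : EuclideanSpace ℝ (Fin 3)) i

/-- The Euclidean inner product `x · y`. -/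
def dot (x y : S2) : ℝ :=
  inner ℝ (x : EuclideanSpace ℝ (Fin 3)) (y : EuclideanSpace ℝ (Fin 3))

/-- The determinant `[x, y, z]`. -/
def det3 (x y z : S2) : ℝ := Matrix.det ![coord x, coord y, coord z]

/-- `X(x, y, z) = x · y + y · z + z · x`. -/
def bigX (x y z : S2) : ℝ := dot x y + dot y z + dot z x

/-- The north pole `n₀ = (0, 0, 1)`. -/
def northPole : S2 := ⟨EuclideanSpace.single 2 1, by simp⟩

/-- `Poly_ℂ(S²)_{≤ n}`: restrictions to `S²` of complex polynomials in `x, y, z` of degree at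
most `n`. -/
def PolySphere (n : ℕ) : Set (S2 → ℂ) :=
  {f | ∃ p : MvPolynomial (Fin 3) ℂ, p.totalDegree ≤ n ∧
    ∀ x, f x = MvPolynomial.eval (fun i => (coord x i : ℂ)) p}

/-- The group `SU(2)`. -/
abbrev SU2 : Type := Matrix.specialUnitaryGroup (Fin 2) ℂ

/-- `x · σ = x₁ σ₁ + x₂ σ₂ + x₃ σ₃` with the Pauli matrices `σᵢ`. -/
def pauli (x : S2) : Matrix (Fin 2) (Fin 2) ℂ :=
  !![(coord x 2 : ℂ), (coord x 0 : ℂ) - Complex.I * (coord x 1 : ℂ);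
     (coord x 0 : ℂ) + Complex.I * (coord x 1 : ℂ), -(coord x 2 : ℂ)]

/-- `Rotates g x y` says that `y = ψ(g) x`, where `ψ : SU(2) → SO(3)` is the covering
homomorphism, `g (x · σ) g⁻¹ = (ψ(g) x) · σ`. -/
def Rotates (g : SU2) (x y : S2) : Prop :=
  (g : Matrix (Fin 2) (Fin 2) ℂ) * pauli x * ((g⁻¹ : SU2) : Matrix (Fin 2) (Fin 2) ℂ) = pauli y

theorem coord_sq (x : S2) : coord x 0 ^ 2 + coord x 1 ^ 2 + coord x 2 ^ 2 = 1 := by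
  have h : ‖(x : EuclideanSpace ℝ (Fin 3))‖ = 1 := by simp
  have h2 := EuclideanSpace.real_norm_sq_eq (x : EuclideanSpace ℝ (Fin 3))
  rw [h, Fin.sum_univ_three] at h2
  simp only [coord]
  linarith

theorem coord_northPole : coord northPole 0 = 0 ∧ coord northPole 1 = 0 ∧
    coord northPole 2 = 1 := by
  simp [coord, northPole]

theorem exists_rotates (x : S2) : ∃ g : SU2, Rotates g northPole x := by
  obtain ⟨hn0, hn1, hn2⟩ := coord_northPole
  have hsq := coord_sq x
  have key : ∃ z w : ℂ, z * conj z + w * conj w = 1 ∧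
      z * conj z - w * conj w = (coord x 2 : ℂ) ∧
      2 * (w * conj z) = (coord x 0 : ℂ) + Complex.I * (coord x 1 : ℂ) := by
    by_cases h : coord x 2 = -1
    · rw [h] at hsq
      have h0 : coord x 0 = 0 := by nlinarith [sq_nonneg (coord x 0), sq_nonneg (coord x 1)]
      have h1 : coord x 1 = 0 := by nlinarith [sq_nonneg (coord x 0), sq_nonneg (coord x 1)]
      exact ⟨0, 1, by simp, by simp [h], by simp [h0, h1]⟩
    · have hge : -1 ≤ coord x 2 := by
        nlinarith [sq_nonneg (coord x 0), sq_nonneg (coord x 1)]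
      have hpos : 0 < (1 + coord x 2) / 2 := by
        have := lt_of_le_of_ne hge (Ne.symm h)
        linarith
      set r := Real.sqrt ((1 + coord x 2) / 2) with hr
      have hr0 : 0 < r := Real.sqrt_pos.2 hpos
      have hr2 : r * r = (1 + coord x 2) / 2 := Real.mul_self_sqrt hpos.le
      have hrc : (r : ℂ) ≠ 0 := by exact_mod_cast hr0.ne'
      have hw : (((coord x 0 : ℂ) + Complex.I * (coord x 1 : ℂ)) / (2 * r)) *
          conj (((coord x 0 : ℂ) + Complex.I * (coord x 1 : ℂ)) / (2 * r)) =
          (((1 - coord x 2) / 2 : ℝ) : ℂ) := by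
        have e : ((coord x 0 : ℂ) + Complex.I * (coord x 1 : ℂ)) *
            ((coord x 0 : ℂ) - Complex.I * (coord x 1 : ℂ)) =
            (((1 - coord x 2) / 2 * (4 * (r * r)) : ℝ) : ℂ) := by
          have : (1 - coord x 2) / 2 * (4 * (r * r)) = coord x 0 ^ 2 + coord x 1 ^ 2 := by
            rw [hr2]; linarith
          rw [this]
          push_cast
          linear_combination (-(coord x 1 : ℂ) ^ 2) * Complex.I_sq
        simp only [map_div₀, map_add, map_mul, Complex.conj_ofReal, Complex.conj_I, map_ofNat]
        rw [div_mul_div_comm, div_eq_iff (by simp [hrc])]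
        rw [neg_mul, ← sub_eq_add_neg, e]
        push_cast
        ring
      have hz : (r : ℂ) * conj (r : ℂ) = (((1 + coord x 2) / 2 : ℝ) : ℂ) := by
        rw [Complex.conj_ofReal, ← hr2]
        push_cast
        ring
      refine ⟨r, ((coord x 0 : ℂ) + Complex.I * (coord x 1 : ℂ)) / (2 * r), ?_, ?_, ?_⟩
      · rw [hw, hz]
        push_cast
        ring
      · rw [hw, hz]
        push_cast
        ring
      · rw [Complex.conj_ofReal]
        field_simp
  obtain ⟨z, w, h1, h2, h3⟩ := key
  have h3' := congrArg conj h3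
  simp only [map_mul, map_add, Complex.conj_conj, Complex.conj_ofReal, Complex.conj_I,
    map_ofNat] at h3'
  refine ⟨⟨!![z, -conj w; w, conj z], ?_⟩, ?_⟩
  · rw [Matrix.mem_specialUnitaryGroup_iff, Matrix.mem_unitaryGroup_iff]
    constructor
    · ext i j
      fin_cases i <;> fin_cases j <;>
        simp [Matrix.mul_apply, Fin.sum_univ_two, Matrix.star_apply] <;>
        first
          | linear_combination h1
          | ring1
    · rw [Matrix.det_fin_two_of]
      linear_combination h1
  · change !![z, -conj w; w, conj z] * pauli northPole * star !![z, -conj w; w, conj z] = pauli x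
    ext i j
    fin_cases i <;> fin_cases j <;>
      simp [Matrix.mul_apply, Fin.sum_univ_two, Matrix.star_apply, pauli, hn0, hn1, hn2] <;>
      first
        | linear_combination h2
        | linear_combination h3
        | linear_combination h3'
        | linear_combination -h2

/-! ### The spin-`j` representation, with `n = 2j` -/

/-- Operators on the spin-`j` space `ℂ^{n+1}`, `n = 2j`. The basis vector with index `k` is the
standard basis vector `u(j, j - k)`. -/
abbrev Op (n : ℕ) : Type := Matrix (Fin (n + 1)) (Fin (n + 1)) ℂ

/-- The irreducible unitary representation `φ_j` of `SU(2)` on `ℂ^{n+1}`, realised on binary forms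
of degree `n` in the orthonormal basis `√(n choose k) z₁^{n-k} z₂^k`: with
`Φ(z)_k = √(n choose k) z₁^{n-k} z₂^k` it is the matrix determined by `Φ(g z) = φ_j(g) Φ(z)`. -/
def spinRep (n : ℕ) (g : SU2) : Op n := fun k l =>
  ((Real.sqrt (n.choose k) / Real.sqrt (n.choose l) : ℝ) : ℂ) *
    ((Polynomial.C ((g : Matrix (Fin 2) (Fin 2) ℂ) 0 0) +
        Polynomial.C ((g : Matrix (Fin 2) (Fin 2) ℂ) 0 1) * Polynomial.X) ^ (n - (k : ℕ)) *
      (Polynomial.C ((g : Matrix (Fin 2) (Fin 2) ℂ) 1 0) +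
        Polynomial.C ((g : Matrix (Fin 2) (Fin 2) ℂ) 1 1) * Polynomial.X) ^ (k : ℕ)).coeff l

/-- The action `P ↦ P^g = φ_j(g) P φ_j(g)⁻¹` of `SU(2)` on operators. -/
def conjAct (n : ℕ) (g : SU2) (P : Op n) : Op n := spinRep n g * P * spinRep n g⁻¹

/-- The lowering matrix `J₋`. -/
def Jminus (n : ℕ) : Matrix (Fin (n + 1)) (Fin (n + 1)) ℝ := fun a b =>
  if (a : ℕ) = b + 1 then Real.sqrt (((n : ℝ) - b) * (b + 1)) else 0

/-- The raising matrix `J₊`, the transpose of `J₋`. -/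
def Jplus (n : ℕ) : Matrix (Fin (n + 1)) (Fin (n + 1)) ℝ := (Jminus n).transpose

/-- The Hilbert-Schmidt norm `μ_l^n` of `J₊^l`. -/
def mu (n l : ℕ) : ℝ := Real.sqrt (Matrix.trace (Jminus n ^ l * Jplus n ^ l))

/-- The coupled standard basis element `e^j(l, l - k)`:
`e(l, l) = (-1)^l J₊^l / μ_l` and `e(l, m - 1) = [J₋, e(l, m)] / β_{l,m}` with
`β_{l,m} = √((l + m)(l - m + 1))`, here at `m = l - k`. -/
def coupledAux (n l : ℕ) : ℕ → Matrix (Fin (n + 1)) (Fin (n + 1)) ℝ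
  | 0 => ((-1) ^ l / mu n l) • Jplus n ^ l
  | k + 1 => (Real.sqrt ((2 * (l : ℝ) - k) * (k + 1)))⁻¹ •
      (Jminus n * coupledAux n l k - coupledAux n l k * Jminus n)

/-- The coupled standard basis `e^j(l, m)`, `0 ≤ l ≤ n`, `-l ≤ m ≤ l`, of the operator space. -/
def coupled (n l : ℕ) (m : ℤ) : Matrix (Fin (n + 1)) (Fin (n + 1)) ℝ :=
  coupledAux n l ((l : ℤ) - m).toNat

/-- The Clebsch-Gordan coefficient `C^{j, j, l}_{m₁, m₂, m}` at `m₁ = j - a`, `m₂ = b - j`: the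
inner product of `e^j(l, m)` with the uncoupled standard basis vector
`|j m₁ j m₂⟩ = (-1)^{j + m₂} E_{a, b}`, where `E_{a, b}` is the one-element matrix. -/
def clebschGordan (n l : ℕ) (m : ℤ) (a b : Fin (n + 1)) : ℝ :=
  Matrix.trace ((coupled n l m).transpose * ((-1 : ℝ) ^ (b : ℕ) • Matrix.single a b 1))

/-- The product coefficient `M[j]^{l₁, l₂, l₃}_{m₁, m₂, m₃}`, that is
`∑_{μ₁, μ₂, μ₃} (-1)^{j + μ₂} C^{j,j,l₁}_{μ₁, μ₂, m₁} C^{j,j,l₂}_{-μ₂, μ₃, m₂}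
C^{j,j,l₃}_{μ₁, μ₃, m₃}` with `μ₁ = j - a`, `μ₂ = b - j`, `μ₃ = c - j`. It is the coefficient of
`e^j(l₃, m₃)` in the operator product `e^j(l₁, m₁) e^j(l₂, m₂)`. -/
def productCoeff (n l₁ l₂ l₃ : ℕ) (m₁ m₂ m₃ : ℤ) : ℝ :=
  ∑ a : Fin (n + 1), ∑ b : Fin (n + 1), ∑ c : Fin (n + 1),
    (-1) ^ (b : ℕ) * clebschGordan n l₁ m₁ a b * clebschGordan n l₂ m₂ b c *
      clebschGordan n l₃ m₃ a c

/-- The Wigner product symbol `[l₁ l₂ l₃; m₁ m₂ m₃][j]`, defined by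
`M[j]^{l₁, l₂, l₃}_{m₁, m₂, -m₃} = (-1)^{2j - m₃} [l₁ l₂ l₃; m₁ m₂ m₃][j]`. -/
def wignerProduct (n l₁ l₂ l₃ : ℕ) (m₁ m₂ m₃ : ℤ) : ℝ :=
  (-1) ^ ((n : ℤ) - m₃) * productCoeff n l₁ l₂ l₃ m₁ m₂ (-m₃)

/-! ### Legendre polynomials and spherical harmonics -/

/-- The Legendre polynomial `P_l`, by Rodrigues' formula. -/
def legendre (l : ℕ) : Polynomial ℝ :=
  Polynomial.C (1 / (2 ^ l * (l.factorial : ℝ))) *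
    Polynomial.derivative^[l] ((Polynomial.X ^ 2 - 1) ^ l)

/-- The spherical harmonic `Y_l^m` for `0 ≤ m ≤ l`,
`√(2l+1) √((l-m)!/(l+m)!) P_l^m(cos φ) e^{imθ}` with the associated Legendre function
`P_l^m(z) = (-1)^m (1 - z²)^{m/2} (d/dz)^m P_l(z)`, so that
`(1 - z²)^{m/2} e^{imθ} = (x + iy)^m`. -/
def sphHarmAux (l m : ℕ) (x : S2) : ℂ :=
  ((Real.sqrt (2 * l + 1) * Real.sqrt (((l - m).factorial : ℝ) / ((l + m).factorial : ℝ)) *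
      ((-1) ^ m * (Polynomial.derivative^[m] (legendre l)).eval (coord x 2)) : ℝ) : ℂ) *
    ((coord x 0 : ℂ) + Complex.I * (coord x 1 : ℂ)) ^ m

/-- The spherical harmonics `Y_l^m`, `-l ≤ m ≤ l`, with `Y_l^{-m} = (-1)^m conj Y_l^m`. -/
def sphHarm (l : ℕ) (m : ℤ) (x : S2) : ℂ :=
  if 0 ≤ m then sphHarmAux l m.toNat x
  else (-1) ^ (-m).toNat * conj (sphHarmAux l (-m).toNat x)

/-! ### Symbol correspondences and twisted products -/

/-- A symbol correspondence for the spin-`j` system, `n = 2j`: a linear injective map from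
operators to smooth functions on the sphere which is `SO(3)`-equivariant, real and normalized. -/
structure IsSymbolCorrespondence (n : ℕ) (W : Op n →ₗ[ℂ] (S2 → ℂ)) : Prop where
  smooth : ∀ P, ContMDiff (𝓡 2) 𝓘(ℝ, ℂ) ∞ (W P)
  injective : Function.Injective W
  equivariant : ∀ (g : SU2) (x y : S2), Rotates g x y → ∀ P, W (conjAct n g P) y = W P x
  real : ∀ P x, W P.conjTranspose x = conj (W P x)
  normalized : ∀ P, (1 / (4 * Real.pi) : ℂ) * ∫ x, W P x ∂area = 1 / (n + 1) * Matrix.trace P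

/-- The twisted product of symbols induced by `W`: `W_P ⋆ W_Q = W_{PQ}`. It is meaningful for `f`
and `g` in the range of `W`. -/
def twistedProduct {n : ℕ} (W : Op n →ₗ[ℂ] (S2 → ℂ)) (f g : S2 → ℂ) : S2 → ℂ :=
  W (Function.invFun W f * Function.invFun W g)

/-- A string of characteristic numbers `c_1, …, c_n`: nonzero real numbers, completed by
`c_0 = 1`. -/
def IsCharString (n : ℕ) (c : ℕ → ℝ) : Prop := c 0 = 1 ∧ ∀ l, 1 ≤ l → l ≤ n → c l ≠ 0

/-- The operator kernel at the north pole,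
`K = (1/(n+1)) I + ∑_{l=1}^n c_l √((2l+1)/(n+1)) e^j(l, 0)`. -/
def kernelAtPole (n : ℕ) (c : ℕ → ℝ) : Op n :=
  ((1 / (n + 1 : ℂ)) • (1 : Op n)) +
    ∑ l ∈ Finset.Icc 1 n, ((c l * Real.sqrt ((2 * l + 1) / (n + 1)) : ℝ) : ℂ) •
      (coupled n l 0).map Complex.ofReal

/-- The operator kernel `K(x) = K^g` for `x = g n₀`. Since `K` is diagonal this does not depend on
the choice of `g`. -/
def opKernel (n : ℕ) (c : ℕ → ℝ) (x : S2) : Op n :=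
  conjAct n (exists_rotates x).choose (kernelAtPole n c)

/-- The symbol map `W_c` with characteristic numbers `c`: `W_c(P)(x) = trace(P K_c(x))`. -/
def symbolMap (n : ℕ) (c : ℕ → ℝ) : Op n →ₗ[ℂ] (S2 → ℂ) :=
  LinearMap.pi fun x =>
    Matrix.traceLinearMap (Fin (n + 1)) ℂ ℂ ∘ₗ LinearMap.mulRight ℂ (opKernel n c x)

/-- The characteristic numbers `b_l^n` of the standard Berezin correspondence, whose operator
kernel is the projection `diag(1, 0, …, 0)`: `b_l = √((n+1)/(2l+1)) e^j(l, 0)_{1,1}`. -/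
def berezin (n l : ℕ) : ℝ := Real.sqrt ((n + 1) / (2 * l + 1)) * coupled n l 0 0 0

/-! ### Trikernels -/

/-- The integral trikernel
`L(x₁, x₂, x₃) = ((2j+1)/4π)² trace(K̃_c(x₁) K̃_c(x₂) K_c(x₃))`, where `K̃_c` is the operator
kernel with the inverse characteristic numbers. -/
def trikernel (n : ℕ) (c : ℕ → ℝ) (x₁ x₂ x₃ : S2) : ℂ :=
  ((((n : ℝ) + 1) / (4 * Real.pi) : ℝ) : ℂ) ^ 2 *
    Matrix.trace (opKernel n (fun l => (c l)⁻¹) x₁ * opKernel n (fun l => (c l)⁻¹) x₂ *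
      opKernel n c x₃)

/-- Wildberger's function `(1 + X(x₁, x₂, x₃) + i [x₁, x₂, x₃])^n`. -/
def wildberger (n : ℕ) (x₁ x₂ x₃ : S2) : ℂ :=
  (1 + (bigX x₁ x₂ x₃ : ℂ) + Complex.I * (det3 x₁ x₂ x₃ : ℂ)) ^ n

/-- The triple integrals `I^n_{l₁, l₂, l₃}(x₁, x₂, x₃)` of Legendre polynomials against
Wildberger's function. -/
def wildInt (n l₁ l₂ l₃ : ℕ) (x₁ x₂ x₃ : S2) : ℂ :=
  1 / (4 * Real.pi : ℂ) ^ 3 *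
    ∫ y₁, ∫ y₂, ∫ y₃,
      (((2 * l₁ + 1) * (legendre l₁).eval (dot x₁ y₁) *
        ((2 * l₂ + 1) * (legendre l₂).eval (dot x₂ y₂)) *
        ((2 * l₃ + 1) * (legendre l₃).eval (dot x₃ y₃)) : ℝ) : ℂ) *
      wildberger n y₁ y₂ y₃ ∂area ∂area ∂area

end SpinTrikernel

end

open SpinTrikernel

noncomputable section

namespace SpinTrikernel

/-! Everything rests on the operator-valued functions F_l(x) = ∑_m conj(Y_l^m(x)) e^j(l,m)
(`harmOp`) and their equivariance F_l(gx) = F_l(x)^g (`harmOp_of_rotates`). Along a meridian both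
sides solve the same linear ODE: the θ-derivative of Y_l^m mixes the orders m ± 1 with exactly the
coefficients by which ad(J₋ − J₊) acts on the coupled basis. Rotations about the third axis only
contribute matching phases. At the pole only Y_l^0 survives, whence K_c(x) = (n+1)^{-1/2} ∑_l c_l
F_l(x) (`opKernel_eq`).

That the e^j(l,m) form an orthonormal basis is sl₂ theory: ad J₋ and ad J₊ are adjoint for the
Hilbert–Schmidt product, and (n+1)² orthonormal elements span (`hsInner_coupledAux`,
`eq_sum_basisOp`). Invariance then replaces identities of special functions. The invariance of
tr(F_l(x) F_l(y)) is the addition theorem. The invariance of ∫ tr(F_l(x) P) tr(F_{l'}(x) Q) dx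
forces the orthogonality of the Y_l^m (`gram_eq`). Together they give the duality ∫ W_c(P)
W_{1/c}(Q) = 4π/(n+1) tr(PQ) (`integral_symbolMap_mul_symbolMap`).

Classification: evaluation at the pole is P ↦ tr(PK) for some K. Equivariance makes K commute with
the torus, hence a combination of the e^j(l,0); reality makes the coefficients real, normalization
gives c_0 = 1, and injectivity excludes c_l = 0.

Integral formula: polynomials are symbols, because coordinates are quadratic in a spinor and its
conjugate and because the range of W_c does not depend on c. The double integral is then the duality
applied twice.

Harmonic expansion: the trace of three F_l expands into the numbers tr(e^j(l₁,m₁) e^j(l₂,m₂)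
e^j(l₃,m₃)), which are the product symbols up to (-1)^n by transposition symmetry
(`wignerProduct_eq`) and vanish outside the triangle and weight conditions (`trace_triple_eq_zero`).

Wildberger form: the Berezin kernel is the rank one projection onto a coherent state, so the trace
of three of them is a cyclic product of spinor overlaps, equal to 4^{-n}(1 + X + i[·,·,·])^n
(`wildberger_eq`). Integration against (2l+1)P_l extracts the degree l component, turning each
Berezin kernel into a multiple of F_l (`wildInt_eq`). The explicit coefficients come from the closed
form of the corner entry of e^j(l,0) (`coupledAux_corner`). -/

/-! ### The ladder operators -/

/-- The matrix `2 J₃ = [J₊, J₋]`. -/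
def Jthree (n : ℕ) : Matrix (Fin (n + 1)) (Fin (n + 1)) ℝ :=
  Matrix.diagonal fun a => (n : ℝ) - 2 * (a : ℕ)

/-- The factor in `[J₋, e(l, l - k)] = step l k • e(l, l - k - 1)`. -/
def step (l k : ℕ) : ℝ := Real.sqrt ((2 * (l : ℝ) - k) * (k + 1))

theorem step_pos {l k : ℕ} (h : k < 2 * l) : 0 < step l k := by
  have : (k : ℝ) + 1 ≤ 2 * l := by exact_mod_cast h
  exact Real.sqrt_pos.2 (mul_pos (by linarith) (by positivity))

/-- The radicand is nonpositive and `Real.sqrt` vanishes there. This is what lets the ladder stop at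
`k = 2 * l` and makes boundary terms disappear throughout. -/
theorem step_eq_zero {l k : ℕ} (h : 2 * l ≤ k) : step l k = 0 := by
  have : (2 : ℝ) * l ≤ k := by exact_mod_cast h
  exact Real.sqrt_eq_zero'.2 (mul_nonpos_of_nonpos_of_nonneg (by linarith) (by positivity))

theorem step_sq {l k : ℕ} (h : k ≤ 2 * l) : step l k * step l k = (2 * (l : ℝ) - k) * (k + 1) := by
  have : (k : ℝ) ≤ 2 * l := by exact_mod_cast h
  exact Real.mul_self_sqrt (mul_nonneg (by linarith) (by positivity))

theorem sum_fin_ite_val_eq {R : Type*} [AddCommMonoid R] (N k : ℕ) (f : Fin N → R) (h : k < N) :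
    (∑ c : Fin N, if (c : ℕ) = k then f c else 0) = f ⟨k, h⟩ := by
  rw [Finset.sum_eq_single ⟨k, h⟩]
  · simp
  · intro b _ hb
    rw [if_neg]
    exact fun e => hb (Fin.ext e)
  · simp

variable {n : ℕ}

theorem Jplus_apply (a b : Fin (n + 1)) :
    Jplus n a b = if (b : ℕ) = a + 1 then Real.sqrt (((n : ℝ) - a) * (a + 1)) else 0 := rfl

theorem Jplus_mul_Jminus_sub :
    Jplus n * Jminus n - Jminus n * Jplus n = Jthree n := by
  ext a b
  have ha := a.2
  have hb := b.2
  have han : (a : ℝ) ≤ n := by exact_mod_cast Nat.lt_succ_iff.1 ha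
  have key1 : (Jplus n * Jminus n) a b = if a = b then ((n : ℝ) - a) * (a + 1) else 0 := by
    rw [Matrix.mul_apply]
    simp only [Jplus_apply, ite_mul, zero_mul]
    by_cases h : (a : ℕ) + 1 < n + 1
    · rw [sum_fin_ite_val_eq _ _ _ h]
      by_cases hab : a = b
      · subst hab
        simp only [Jminus, if_true]
        exact Real.mul_self_sqrt (mul_nonneg (by linarith) (by positivity))
      · rw [if_neg hab, Jminus, if_neg, mul_zero]
        intro e
        exact hab (Fin.ext (by simpa using e))
    · rw [Finset.sum_eq_zero]
      · have : (a : ℝ) = n := by exact_mod_cast (by omega : (a : ℕ) = n)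
        simp [this]
      · intro c _
        rw [if_neg (by have := c.2; omega)]
  have key2 : (Jminus n * Jplus n) a b = if a = b then ((n : ℝ) - a + 1) * a else 0 := by
    rw [Matrix.mul_apply]
    by_cases h : (a : ℕ) = 0
    · rw [Finset.sum_eq_zero]
      · simp [h]
      · intro c _
        rw [Jminus, if_neg (by omega), zero_mul]
    · have e : ∀ c : Fin (n + 1), Jminus n a c * Jplus n c b =
          if (c : ℕ) = a - 1 then Real.sqrt (((n : ℝ) - c) * (c + 1)) * Jplus n c b else 0 := by
        intro c
        by_cases hc : (c : ℕ) = a - 1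
        · rw [if_pos hc, Jminus, if_pos (by omega)]
        · rw [if_neg hc, Jminus, if_neg (by omega), zero_mul]
      rw [Finset.sum_congr rfl fun c _ => e c, sum_fin_ite_val_eq _ _ _ (by omega)]
      have hc : (((a : ℕ) - 1 : ℕ) : ℝ) = a - 1 := by
        rw [Nat.cast_sub (by omega)]; simp
      by_cases hab : a = b
      · subst hab
        rw [if_pos rfl, Jplus_apply, if_pos (by simp; omega)]
        simp only [hc]
        rw [Real.mul_self_sqrt]
        · ring
        · exact mul_nonneg (by linarith) (by simp)
      · rw [if_neg hab, Jplus_apply, if_neg, mul_zero]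
        intro e
        apply hab
        apply Fin.ext
        simp only at e
        omega
  rw [Matrix.sub_apply, key1, key2, Jthree, Matrix.diagonal_apply]
  split_ifs <;> ring

/-! ### Powers of `J₊` and their Hilbert–Schmidt norms -/

theorem Jplus_pow_apply (l : ℕ) (a b : Fin (n + 1)) :
    (Jplus n ^ l) a b = if (b : ℕ) = a + l then
      Real.sqrt (∏ i ∈ Finset.range l, (((n : ℝ) - a - i) * (a + i + 1))) else 0 := by
  induction l generalizing b with
  | zero => simp [Matrix.one_apply, Fin.ext_iff, eq_comm]
  | succ l ih =>
    rw [pow_succ, Matrix.mul_apply]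
    simp only [ih, ite_mul, zero_mul]
    have hb := b.2
    by_cases h : (b : ℕ) = a + (l + 1)
    · have hnn : 0 ≤ ∏ i ∈ Finset.range l, (((n : ℝ) - a - i) * (a + i + 1)) := by
        refine Finset.prod_nonneg fun i hi => ?_
        have hi := Finset.mem_range.1 hi
        have : (a : ℝ) + i ≤ n := by exact_mod_cast (by omega : (a : ℕ) + i ≤ n)
        exact mul_nonneg (by linarith) (by positivity)
      rw [sum_fin_ite_val_eq _ _ _ (by omega), if_pos h, Jplus_apply, if_pos (by simp; omega),
        Finset.prod_range_succ, Real.sqrt_mul hnn]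
      simp only
      push_cast
      rw [sub_sub]
    · rw [if_neg h, Finset.sum_eq_zero]
      intro c _
      split_ifs with hc
      · rw [Jplus_apply, if_neg (by omega), mul_zero]
      · rfl

theorem prod_weights {a l : ℕ} (h : a + l ≤ n) :
    ∏ i ∈ Finset.range l, (((n : ℝ) - a - i) * (a + i + 1)) =
      (l.factorial : ℝ) ^ 2 * ((a + l).choose l * (n - a).choose l) := by
  have h1 : ∏ i ∈ Finset.range l, ((n : ℝ) - a - i) = ((n - a).descFactorial l : ℕ) := by
    rw [Nat.descFactorial_eq_prod_range, Nat.cast_prod]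
    refine Finset.prod_congr rfl fun i hi => ?_
    have hi := Finset.mem_range.1 hi
    rw [Nat.cast_sub (by omega), Nat.cast_sub (by omega)]
  have h2 : ∏ i ∈ Finset.range l, ((a : ℝ) + i + 1) = ((a + 1).ascFactorial l : ℕ) := by
    rw [Nat.ascFactorial_eq_prod_range, Nat.cast_prod]
    refine Finset.prod_congr rfl fun i hi => ?_
    push_cast
    ring
  rw [Finset.prod_mul_distrib, h1, h2, Nat.descFactorial_eq_factorial_mul_choose,
    Nat.ascFactorial_eq_factorial_mul_choose]
  push_cast
  ring

/-- Compare coefficients of X^{n-l} in (1-X)^{-(l+1)} (1-X)^{-(l+1)} = (1-X)^{-(2l+2)}. -/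
theorem sum_choose_mul_choose {l : ℕ} (h : l ≤ n) :
    ∑ a ∈ Finset.range (n + 1 - l), (a + l).choose l * (n - a).choose l =
      (n + l + 1).choose (2 * l + 1) := by
  have e := congrArg (PowerSeries.coeff (R := ℚ) (n - l))
    (congrArg Units.val (PowerSeries.invOneSubPow_add (S := ℚ) (l + 1) (l + 1)))
  rw [Units.val_mul, PowerSeries.coeff_mul, show l + 1 + (l + 1) = (2 * l + 1) + 1 by ring] at e
  simp only [PowerSeries.invOneSubPow_val_succ_eq_mk_add_choose, PowerSeries.coeff_mk] at e
  rw [Finset.Nat.sum_antidiagonal_eq_sum_range_succ_mk,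
    show 2 * l + 1 + (n - l) = n + l + 1 by omega, show (n - l).succ = n + 1 - l by omega] at e
  have e' : (((n + l + 1).choose (2 * l + 1) : ℕ) : ℚ) =
      ((∑ a ∈ Finset.range (n + 1 - l), (a + l).choose l * (n - a).choose l : ℕ) : ℚ) := by
    rw [e, Nat.cast_sum]
    refine Finset.sum_congr rfl fun a ha => ?_
    have := Finset.mem_range.1 ha
    rw [Nat.cast_mul, add_comm a l, show l + (n - l - a) = n - a by omega]
  exact_mod_cast e'.symm

theorem transpose_Jplus_pow (l : ℕ) : (Jplus n ^ l).transpose = Jminus n ^ l := by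
  rw [Matrix.transpose_pow, Jplus, Matrix.transpose_transpose]

/-- The trace is the sum of the squared entries of `J₊^l`, which sit on one superdiagonal and are
products of two binomial coefficients; `sum_choose_mul_choose` adds them up. -/
theorem mu_sq {l : ℕ} (h : l ≤ n) :
    mu n l ^ 2 = (l.factorial : ℝ) ^ 2 * (n + l + 1).choose (2 * l + 1) := by
  have e : Matrix.trace (Jminus n ^ l * Jplus n ^ l) =
      (l.factorial : ℝ) ^ 2 * (n + l + 1).choose (2 * l + 1) := by
    rw [Matrix.trace_mul_comm, ← transpose_Jplus_pow, Matrix.trace]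
    simp only [Matrix.diag_apply, Matrix.mul_apply, Matrix.transpose_apply, Jplus_pow_apply,
      mul_ite, mul_zero, ite_mul, zero_mul]
    rw [← sum_choose_mul_choose h, Nat.cast_sum, Finset.mul_sum]
    have hsub : ∀ a : Fin (n + 1), (∑ b : Fin (n + 1), if (b : ℕ) = a + l then
        if (b : ℕ) = a + l then
        Real.sqrt (∏ i ∈ Finset.range l, (((n : ℝ) - a - i) * (a + i + 1))) *
        Real.sqrt (∏ i ∈ Finset.range l, (((n : ℝ) - a - i) * (a + i + 1))) else 0 else 0) =
        (fun a : ℕ => if a < n + 1 - l then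
          (l.factorial : ℝ) ^ 2 * (((a + l).choose l * (n - a).choose l : ℕ) : ℝ) else 0) a := by
      intro a
      by_cases ha : (a : ℕ) + l < n + 1
      · rw [sum_fin_ite_val_eq _ _ _ ha]
        simp only [if_true]
        rw [if_pos (by omega), Real.mul_self_sqrt, prod_weights (by omega)]
        · push_cast; ring
        · rw [prod_weights (by omega)]; positivity
      · beta_reduce
        rw [if_neg (by omega), Finset.sum_eq_zero]
        intro b _
        rw [if_neg (by omega)]
    rw [Finset.sum_congr rfl fun a _ => hsub a, Fin.sum_univ_eq_sum_range
      (fun a : ℕ => if a < n + 1 - l then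
          (l.factorial : ℝ) ^ 2 * (((a + l).choose l * (n - a).choose l : ℕ) : ℝ) else 0) (n + 1),
      ← Finset.sum_filter]
    refine Finset.sum_congr ?_ fun _ _ => rfl
    ext a
    simp
    omega
  rw [mu, Real.sq_sqrt]
  · exact e
  · rw [e]; positivity

theorem mu_pos {l : ℕ} (h : l ≤ n) : 0 < mu n l := by
  refine lt_of_le_of_ne (Real.sqrt_nonneg _) fun e => ?_
  have h2 := mu_sq h
  rw [← e] at h2
  have : 0 < (n + l + 1).choose (2 * l + 1) := Nat.choose_pos (by omega)
  have h3 : (0 : ℝ) < (l.factorial : ℝ) ^ 2 * (n + l + 1).choose (2 * l + 1) := by positivity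
  rw [← h2] at h3
  simp at h3

/-! ### The coupled standard basis -/

theorem coupledAux_succ (l k : ℕ) : coupledAux n l (k + 1) = (step l k)⁻¹ •
    (Jminus n * coupledAux n l k - coupledAux n l k * Jminus n) := rfl

/-- A consequence of conventions only: the scalar used to pass below `k = 2 * l` is `0⁻¹ = 0`. That
the commutator itself vanishes at the bottom is a genuine fact, proved in `Jminus_commutator`. -/
theorem coupledAux_eq_zero {l k : ℕ} (h : 2 * l < k) : coupledAux n l k = 0 := by
  obtain ⟨k, rfl⟩ : ∃ j, k = j + 1 := ⟨k - 1, by omega⟩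
  rw [coupledAux_succ, step_eq_zero (by omega), inv_zero, zero_smul]

theorem coupledAux_support {l k : ℕ} {a b : Fin (n + 1)} (h : coupledAux n l k a b ≠ 0) :
    (b : ℤ) = a + l - k := by
  induction k generalizing a b with
  | zero =>
    rw [coupledAux, Matrix.smul_apply, Jplus_pow_apply] at h
    by_cases e : (b : ℕ) = a + l
    · push_cast; omega
    · rw [if_neg e] at h; simp at h
  | succ k ih =>
    by_contra hab
    apply h
    rw [coupledAux_succ, Matrix.smul_apply, Matrix.sub_apply, Matrix.mul_apply, Matrix.mul_apply,
      Finset.sum_eq_zero, Finset.sum_eq_zero]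
    · simp
    · intro c _
      by_contra hc
      have h1 := ih (left_ne_zero_of_mul hc)
      have h2 := right_ne_zero_of_mul hc
      rw [Jminus] at h2
      by_cases e : (c : ℕ) = b + 1
      · push_cast at hab; omega
      · rw [if_neg e] at h2; exact h2 rfl
    · intro c _
      by_contra hc
      have h1 := ih (right_ne_zero_of_mul hc)
      have h2 := left_ne_zero_of_mul hc
      rw [Jminus] at h2
      by_cases e : (a : ℕ) = c + 1
      · push_cast at hab; omega
      · rw [if_neg e] at h2; exact h2 rfl

theorem coupledAux_apply_of_ne {l k : ℕ} {a b : Fin (n + 1)} (h : (b : ℤ) ≠ a + l - k) :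
    coupledAux n l k a b = 0 := by
  by_contra e
  exact h (coupledAux_support e)

theorem Jthree_commutator (l k : ℕ) :
    Jthree n * coupledAux n l k - coupledAux n l k * Jthree n =
      (2 * ((l : ℝ) - k)) • coupledAux n l k := by
  ext a b
  rw [Jthree, Matrix.sub_apply, Matrix.diagonal_mul, Matrix.mul_diagonal, Matrix.smul_apply,
    smul_eq_mul]
  by_cases h : coupledAux n l k a b = 0
  · simp [h]
  · have e : ((b : ℕ) : ℝ) = a + l - k := by exact_mod_cast coupledAux_support h
    rw [e]
    ring

theorem Jplus_commutator_zero (l : ℕ) :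
    Jplus n * coupledAux n l 0 - coupledAux n l 0 * Jplus n = 0 := by
  rw [coupledAux, Matrix.mul_smul, Matrix.smul_mul, ← pow_succ, ← pow_succ', sub_self]

/-- By the Jacobi identity, [J₊,[J₋,X]] = [[J₊,J₋],X] + [J₋,[J₊,X]]. Induction on `k` then reduces
the claim to step(k+1)² = 2(l-k-1) + step(k)²; past the bottom of the ladder both sides are zero. -/
theorem Jplus_commutator_succ (l k : ℕ) :
    Jplus n * coupledAux n l (k + 1) - coupledAux n l (k + 1) * Jplus n =
      step l k • coupledAux n l k := by
  have main : ∀ X : Matrix (Fin (n + 1)) (Fin (n + 1)) ℝ,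
      Jplus n * (Jminus n * X - X * Jminus n) - (Jminus n * X - X * Jminus n) * Jplus n =
      (Jthree n * X - X * Jthree n) + (Jminus n * (Jplus n * X - X * Jplus n) -
        (Jplus n * X - X * Jplus n) * Jminus n) := by
    intro X
    rw [← Jplus_mul_Jminus_sub]
    noncomm_ring
  induction k with
  | zero =>
    by_cases hl : l = 0
    · subst hl
      simp [coupledAux_eq_zero, step_eq_zero]
    · have hs := step_pos (l := l) (k := 0) (by omega)
      have hs2 := step_sq (l := l) (k := 0) (by omega)
      rw [coupledAux_succ, Matrix.mul_smul, Matrix.smul_mul, ← smul_sub, main,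
        Jplus_commutator_zero, Jthree_commutator]
      simp only [mul_zero, zero_mul, sub_zero, add_zero, smul_smul]
      congr 1
      rw [inv_mul_eq_iff_eq_mul₀ hs.ne', hs2]
      simp
  | succ k ih =>
    by_cases hk : 2 * l ≤ k + 1
    · rw [coupledAux_eq_zero (k := k + 1 + 1) (by omega), step_eq_zero hk]
      simp
    · have hs := step_pos (l := l) (k := k + 1) (by omega)
      have hs0 := step_pos (l := l) (k := k) (by omega)
      have hs2 := step_sq (l := l) (k := k + 1) (by omega)
      have hs3 := step_sq (l := l) (k := k) (by omega)
      have e : Jminus n * coupledAux n l k - coupledAux n l k * Jminus n =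
          step l k • coupledAux n l (k + 1) := by
        rw [coupledAux_succ, smul_smul, mul_inv_cancel₀ hs0.ne', one_smul]
      rw [coupledAux_succ (k := k + 1), Matrix.mul_smul, Matrix.smul_mul, ← smul_sub, main,
        ih, Jthree_commutator, Matrix.mul_smul, Matrix.smul_mul, ← smul_sub, e, smul_smul,
        ← add_smul, smul_smul]
      congr 1
      rw [inv_mul_eq_iff_eq_mul₀ hs.ne', hs2, hs3]
      push_cast
      ring

/-- The Hilbert-Schmidt inner product of real matrices. -/
def hsInner (A B : Matrix (Fin (n + 1)) (Fin (n + 1)) ℝ) : ℝ := Matrix.trace (A.transpose * B)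

theorem hsInner_comm (A B : Matrix (Fin (n + 1)) (Fin (n + 1)) ℝ) :
    hsInner A B = hsInner B A := by
  rw [hsInner, ← Matrix.trace_transpose, Matrix.transpose_mul, Matrix.transpose_transpose, hsInner]

theorem hsInner_smul_right (r : ℝ) (A B : Matrix (Fin (n + 1)) (Fin (n + 1)) ℝ) :
    hsInner A (r • B) = r * hsInner A B := by
  simp [hsInner]

theorem hsInner_smul_left (r : ℝ) (A B : Matrix (Fin (n + 1)) (Fin (n + 1)) ℝ) :
    hsInner (r • A) B = r * hsInner A B := by
  simp [hsInner]

theorem hsInner_self_eq_zero {A : Matrix (Fin (n + 1)) (Fin (n + 1)) ℝ} (h : hsInner A A = 0) :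
    A = 0 := by
  simp only [hsInner, Matrix.trace, Matrix.diag_apply, Matrix.mul_apply,
    Matrix.transpose_apply] at h
  ext a b
  have h1 := (Finset.sum_eq_zero_iff_of_nonneg
    (fun i _ => Finset.sum_nonneg fun j _ => mul_self_nonneg (A j i))).1 h b (Finset.mem_univ _)
  have h2 := (Finset.sum_eq_zero_iff_of_nonneg
    (fun j _ => mul_self_nonneg (A j b))).1 h1 a (Finset.mem_univ _)
  simpa using h2

theorem hsInner_commutator (A B : Matrix (Fin (n + 1)) (Fin (n + 1)) ℝ) :
    hsInner (Jminus n * A - A * Jminus n) B = hsInner A (Jplus n * B - B * Jplus n) := by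
  have e : (Jminus n * A - A * Jminus n).transpose =
      A.transpose * Jplus n - Jplus n * A.transpose := by
    rw [Matrix.transpose_sub, Matrix.transpose_mul, Matrix.transpose_mul, Jplus]
  rw [hsInner, e, hsInner, sub_mul, mul_sub, Matrix.trace_sub, Matrix.trace_sub, mul_assoc,
    mul_assoc, Matrix.trace_mul_comm (Jplus n), mul_assoc]

/-- Only `k = 2 * l` is not formal. There v = [J₋, e(l,-l)] satisfies [J₊, v] = 0, since the weight
term -2l cancels the squared step 2l, and adjointness gives ⟨v, v⟩ = ⟨e(l,-l), [J₊, v]⟩ = 0. -/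
theorem Jminus_commutator (l k : ℕ) :
    Jminus n * coupledAux n l k - coupledAux n l k * Jminus n =
      step l k • coupledAux n l (k + 1) := by
  rcases lt_trichotomy k (2 * l) with h | h | h
  · rw [coupledAux_succ, smul_smul, mul_inv_cancel₀ (step_pos h).ne', one_smul]
  · subst h
    rw [step_eq_zero le_rfl, zero_smul]
    set v := Jminus n * coupledAux n l (2 * l) - coupledAux n l (2 * l) * Jminus n with hv
    apply hsInner_self_eq_zero
    nth_rewrite 1 [hv]
    have main : Jplus n * v - v * Jplus n =
        (Jthree n * coupledAux n l (2 * l) - coupledAux n l (2 * l) * Jthree n) +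
        (Jminus n * (Jplus n * coupledAux n l (2 * l) - coupledAux n l (2 * l) * Jplus n) -
        (Jplus n * coupledAux n l (2 * l) - coupledAux n l (2 * l) * Jplus n) * Jminus n) := by
      rw [← Jplus_mul_Jminus_sub, hv]
      noncomm_ring
    have hzero : Jplus n * v - v * Jplus n = 0 := by
      rw [main, Jthree_commutator]
      rcases Nat.eq_zero_or_pos l with h0 | h0
      · subst h0
        rw [mul_zero, Jplus_commutator_zero]
        simp
      · obtain ⟨k, hk⟩ : ∃ k, 2 * l = k + 1 := ⟨2 * l - 1, by omega⟩
        rw [hk, Jplus_commutator_succ, Matrix.mul_smul, Matrix.smul_mul, ← smul_sub]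
        have hs0 := step_pos (l := l) (k := k) (by omega)
        have e : Jminus n * coupledAux n l k - coupledAux n l k * Jminus n =
            step l k • coupledAux n l (k + 1) := by
          rw [coupledAux_succ, smul_smul, mul_inv_cancel₀ hs0.ne', one_smul]
        rw [e, smul_smul, step_sq (by omega), ← add_smul]
        have hl : (2 : ℝ) * l = k + 1 := by exact_mod_cast hk
        convert zero_smul ℝ _
        push_cast
        linear_combination (k + 2 : ℝ) * hl
    rw [hsInner_commutator, hzero]
    simp [hsInner]
  · rw [coupledAux_eq_zero h, step_eq_zero h.le]
    simp

theorem hsInner_of_weight_ne {l l' k k' : ℕ} (h : (l : ℤ) - k ≠ l' - k') :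
    hsInner (coupledAux n l k) (coupledAux n l' k') = 0 := by
  simp only [hsInner, Matrix.trace, Matrix.diag_apply, Matrix.mul_apply, Matrix.transpose_apply]
  refine Finset.sum_eq_zero fun b _ => Finset.sum_eq_zero fun a _ => ?_
  by_contra e
  have h1 := coupledAux_support (left_ne_zero_of_mul e)
  have h2 := coupledAux_support (right_ne_zero_of_mul e)
  omega

/-- Adjointness of ad J₋ and ad J₊: inner products along two ladders determine each other step by
step. -/
theorem hsInner_shift (l l' k k' : ℕ) :
    step l k * hsInner (coupledAux n l (k + 1)) (coupledAux n l' (k' + 1)) =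
      step l' k' * hsInner (coupledAux n l k) (coupledAux n l' k') := by
  rw [← hsInner_smul_left, ← Jminus_commutator, hsInner_commutator, Jplus_commutator_succ,
    hsInner_smul_right]

theorem hsInner_top {l : ℕ} (h : l ≤ n) :
    hsInner (coupledAux n l 0) (coupledAux n l 0) = 1 := by
  have hm := mu_pos h
  have e : Matrix.trace (Jminus n ^ l * Jplus n ^ l) = mu n l ^ 2 := by
    rw [mu, Real.sq_sqrt]
    by_contra hneg
    rw [mu, Real.sqrt_eq_zero'.2 (not_le.1 hneg).le] at hm
    exact lt_irrefl _ hm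
  rw [coupledAux, hsInner_smul_left, hsInner_smul_right, hsInner, transpose_Jplus_pow, e]
  have h1 : ((-1 : ℝ) ^ l) * (-1) ^ l = 1 := by rw [← mul_pow]; simp
  field_simp
  linear_combination h1

theorem hsInner_same {l k : ℕ} (h : l ≤ n) (hk : k ≤ 2 * l) :
    hsInner (coupledAux n l k) (coupledAux n l k) = 1 := by
  induction k with
  | zero => exact hsInner_top h
  | succ k ih =>
    have := hsInner_shift (n := n) l l k k
    rw [ih (by omega)] at this
    exact mul_left_cancel₀ (step_pos (by omega)).ne' this

/-- Different weights have disjoint supports, so equal weights remain. If `k = 0`, the second vector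
lies in the image of ad J₋ while the first is killed by the adjoint ad J₊; `hsInner_shift`
propagates this down the ladder. -/
theorem hsInner_of_lt {l l' k k' : ℕ} (h : l < l') (hk : k ≤ 2 * l) :
    hsInner (coupledAux n l k) (coupledAux n l' k') = 0 := by
  by_cases hw : (l : ℤ) - k = l' - k'
  · obtain ⟨d, rfl⟩ : ∃ d, l' = l + (d + 1) := ⟨l' - l - 1, by omega⟩
    obtain rfl : k' = k + (d + 1) := by push_cast at hw; omega
    clear hw
    induction k with
    | zero =>
      rw [zero_add]
      have e := Jminus_commutator (n := n) (l + (d + 1)) d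
      have hs := step_pos (l := l + (d + 1)) (k := d) (by omega)
      refine mul_left_cancel₀ hs.ne' ?_
      rw [← hsInner_smul_right, ← e, hsInner_comm, hsInner_commutator, Jplus_commutator_zero]
      simp [hsInner]
    | succ k ih =>
      have e := hsInner_shift (n := n) l (l + (d + 1)) k (k + (d + 1))
      rw [ih (by omega), mul_zero] at e
      have hs := step_pos (l := l) (k := k) (by omega)
      rw [show k + 1 + (d + 1) = k + (d + 1) + 1 by ring]
      exact (mul_eq_zero.1 e).resolve_left hs.ne'
  · exact hsInner_of_weight_ne hw

theorem hsInner_coupledAux {l l' k k' : ℕ} (h : l ≤ n) (hk : k ≤ 2 * l) (hk' : k' ≤ 2 * l') :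
    hsInner (coupledAux n l k) (coupledAux n l' k') = if l = l' ∧ k = k' then 1 else 0 := by
  split_ifs with e
  · obtain ⟨rfl, rfl⟩ := e
    exact hsInner_same h hk
  · rcases lt_trichotomy l l' with hl | hl | hl
    · exact hsInner_of_lt hl hk
    · subst hl
      exact hsInner_of_weight_ne (by omega)
    · rw [hsInner_comm]
      exact hsInner_of_lt hl hk'

/-! ### Completeness of the coupled basis -/

/-- Orthonormality for the bilinear form tr(AᵀB) gives independence, and the count gives spanning.
No conjugation is involved, so the same statement serves real and complex matrices. -/
theorem eq_sum_trace_smul {K m ι : Type*} [Field K] [Fintype m] [DecidableEq m] [Fintype ι]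
    [DecidableEq ι] (e : ι → Matrix m m K)
    (h : ∀ i j, Matrix.trace ((e i).transpose * e j) = if i = j then 1 else 0)
    (hcard : Fintype.card ι = Fintype.card m * Fintype.card m) (P : Matrix m m K) :
    P = ∑ i, Matrix.trace ((e i).transpose * P) • e i := by
  have hcoef : ∀ (a : ι → K) (j : ι), Matrix.trace ((e j).transpose * ∑ i, a i • e i) = a j := by
    intro a j
    rw [Matrix.mul_sum, Matrix.trace_sum]
    simp [h]
  have hli : LinearIndependent K e := by
    rw [Fintype.linearIndependent_iff]
    intro a ha j
    rw [← hcoef a j, ha]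
    simp
  rcases isEmpty_or_nonempty ι with hι | hι
  · have : Fintype.card m = 0 := by
      have h0 : Fintype.card ι = 0 := Fintype.card_eq_zero
      rw [h0] at hcard
      exact mul_self_eq_zero.1 hcard.symm
    have := Fintype.card_eq_zero_iff.1 this
    exact Subsingleton.elim _ _
  · have hb := hli.span_eq_top_of_card_eq_finrank (by rw [hcard, Module.finrank_matrix]; simp)
    have hP : P ∈ Submodule.span K (Set.range e) := by rw [hb]; trivial
    obtain ⟨a, rfl⟩ := (Submodule.mem_span_range_iff_exists_fun K).1 hP
    simp only [hcoef]

theorem card_sigma_odd (n : ℕ) :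
    Fintype.card (Σ l : Fin (n + 1), Fin (2 * (l : ℕ) + 1)) = (n + 1) * (n + 1) := by
  rw [Fintype.card_sigma]
  simp only [Fintype.card_fin]
  rw [Fin.sum_univ_eq_sum_range (fun l => 2 * l + 1)]
  induction n with
  | zero => simp
  | succ n ih => rw [Finset.sum_range_succ, ih]; ring

theorem sum_sigma_odd {M : Type*} [AddCommMonoid M] (n : ℕ) (f : ℕ → ℕ → M) :
    ∑ i : (Σ l : Fin (n + 1), Fin (2 * (l : ℕ) + 1)), f i.1 i.2 =
      ∑ l ∈ Finset.range (n + 1), ∑ k ∈ Finset.range (2 * l + 1), f l k := by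
  rw [Fintype.sum_sigma, ← Fin.sum_univ_eq_sum_range
    (fun l => ∑ k ∈ Finset.range (2 * l + 1), f l k)]
  exact Finset.sum_congr rfl fun l _ => Fin.sum_univ_eq_sum_range (f l) _

theorem eq_sum_coupledAux (P : Matrix (Fin (n + 1)) (Fin (n + 1)) ℝ) :
    P = ∑ l ∈ Finset.range (n + 1), ∑ k ∈ Finset.range (2 * l + 1),
      hsInner (coupledAux n l k) P • coupledAux n l k := by
  rw [← sum_sigma_odd n fun l k => hsInner (coupledAux n l k) P • coupledAux n l k]
  refine eq_sum_trace_smul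
    (fun i : (Σ l : Fin (n + 1), Fin (2 * (l : ℕ) + 1)) => coupledAux n i.1 i.2) ?_ ?_ P
  · rintro ⟨l, k⟩ ⟨l', k'⟩
    have := hsInner_coupledAux (n := n) (l := l) (l' := l') (k := k) (k' := k')
      (by omega) (by omega) (by omega)
    rw [hsInner] at this
    rw [this]
    congr 1
    rw [Sigma.mk.injEq, eq_iff_iff]
    constructor
    · rintro ⟨h1, h2⟩
      obtain rfl := Fin.ext h1
      exact ⟨rfl, heq_of_eq (Fin.ext h2)⟩
    · rintro ⟨rfl, h2⟩
      exact ⟨rfl, by rw [eq_of_heq h2]⟩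
  · rw [card_sigma_odd]; simp

/-- The coupled standard basis `e^j(l, l - k)` as complex matrices. -/
def basisOp (n l k : ℕ) : Op n := (coupledAux n l k).map Complex.ofReal

theorem basisOp_apply (l k : ℕ) (a b : Fin (n + 1)) :
    basisOp n l k a b = (coupledAux n l k a b : ℂ) := rfl

theorem map_ofReal_mul (A B : Matrix (Fin (n + 1)) (Fin (n + 1)) ℝ) :
    (A * B).map Complex.ofReal = A.map Complex.ofReal * B.map Complex.ofReal :=
  Matrix.map_mul (f := Complex.ofRealHom)

theorem trace_map_ofReal (A : Matrix (Fin (n + 1)) (Fin (n + 1)) ℝ) :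
    Matrix.trace (A.map Complex.ofReal) = ((Matrix.trace A : ℝ) : ℂ) := by
  simp [Matrix.trace]

theorem trace_basisOp_transpose_mul {l l' k k' : ℕ} (h : l ≤ n) (hk : k ≤ 2 * l)
    (hk' : k' ≤ 2 * l') : Matrix.trace ((basisOp n l k).transpose * basisOp n l' k') =
      if l = l' ∧ k = k' then 1 else 0 := by
  rw [basisOp, basisOp, ← Matrix.transpose_map, ← map_ofReal_mul, trace_map_ofReal]
  have := hsInner_coupledAux h hk hk'
  rw [hsInner] at this
  rw [this]
  split_ifs <;> simp

theorem eq_sum_basisOp (P : Op n) :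
    P = ∑ l ∈ Finset.range (n + 1), ∑ k ∈ Finset.range (2 * l + 1),
      Matrix.trace ((basisOp n l k).transpose * P) • basisOp n l k := by
  rw [← sum_sigma_odd n fun l k =>
    Matrix.trace ((basisOp n l k).transpose * P) • basisOp n l k]
  refine eq_sum_trace_smul
    (fun i : (Σ l : Fin (n + 1), Fin (2 * (l : ℕ) + 1)) => basisOp n i.1 i.2) ?_ ?_ P
  · rintro ⟨l, k⟩ ⟨l', k'⟩
    rw [trace_basisOp_transpose_mul (by omega) (by omega) (by omega)]
    congr 1
    rw [Sigma.mk.injEq, eq_iff_iff]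
    constructor
    · rintro ⟨h1, h2⟩
      obtain rfl := Fin.ext h1
      exact ⟨rfl, heq_of_eq (Fin.ext h2)⟩
    · rintro ⟨rfl, h2⟩
      exact ⟨rfl, by rw [eq_of_heq h2]⟩
  · rw [card_sigma_odd]; simp

/-! ### Transposition symmetry -/

/-- Transposing [J₋, e(l,-l)] = 0 shows that the transpose commutes with J₊. It is therefore
orthogonal to every image of ad J₋, that is, to all basis elements except the tops of ladders, and
its weight singles out the ladder `l`. -/
theorem transpose_coupledAux_isTop {l : ℕ} (hl : l ≤ n) :
    (coupledAux n l (2 * l)).transpose =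
      hsInner (coupledAux n l 0) (coupledAux n l (2 * l)).transpose • coupledAux n l 0 := by
  set X := (coupledAux n l (2 * l)).transpose with hX
  have hcomm : Jplus n * X - X * Jplus n = 0 := by
    have e := congrArg Matrix.transpose (Jminus_commutator (n := n) l (2 * l))
    rw [step_eq_zero le_rfl, zero_smul, Matrix.transpose_sub, Matrix.transpose_mul,
      Matrix.transpose_mul, Matrix.transpose_zero] at e
    rw [← neg_sub, neg_eq_zero]
    exact e
  have hzero : ∀ l' ∈ Finset.range (n + 1), ∀ k' ∈ Finset.range (2 * l' + 1),
      ¬ (l' = l ∧ k' = 0) → hsInner (coupledAux n l' k') X = 0 := by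
    intro l' hl' k' hk' hne
    rcases Nat.eq_zero_or_pos k' with h0 | h0
    · subst h0
      have hne : l' ≠ l := fun e => hne ⟨e, rfl⟩
      simp only [hsInner, Matrix.trace, Matrix.diag_apply, Matrix.mul_apply,
        Matrix.transpose_apply, hX]
      refine Finset.sum_eq_zero fun b _ => Finset.sum_eq_zero fun a _ => ?_
      by_contra e
      have h1 := coupledAux_support (left_ne_zero_of_mul e)
      have h2 := coupledAux_support (right_ne_zero_of_mul e)
      push_cast at h1 h2
      omega
    · obtain ⟨k, rfl⟩ : ∃ k, k' = k + 1 := ⟨k' - 1, by omega⟩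
      have := Finset.mem_range.1 hk'
      refine mul_left_cancel₀ (step_pos (l := l') (k := k) (by omega)).ne' ?_
      rw [← hsInner_smul_left, ← Jminus_commutator, hsInner_commutator, hcomm]
      simp [hsInner]
  conv_lhs => rw [eq_sum_coupledAux X]
  rw [Finset.sum_eq_single l]
  · rw [Finset.sum_eq_single 0]
    · intro k hk hk0
      rw [hzero l (by simpa using by omega) k hk (fun e => hk0 e.2), zero_smul]
    · simp
  · intro l' hl' hne
    refine Finset.sum_eq_zero fun k hk => ?_
    rw [hzero l' hl' k hk (fun e => hne e.1), zero_smul]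
  · intro h
    exact absurd (Finset.mem_range.2 (by omega)) h

/-- Transposition interchanges ad J₊ and ad J₋ up to sign, and the step factors read the same from
either end of the ladder, so one constant κ with alternating signs describes the whole ladder. -/
theorem transpose_coupledAux {l k : ℕ} (hl : l ≤ n) (hk : k ≤ 2 * l) :
    (coupledAux n l (2 * l - k)).transpose = ((-1 : ℝ) ^ l * (-1) ^ k) • coupledAux n l k := by
  set κ := hsInner (coupledAux n l 0) (coupledAux n l (2 * l)).transpose with hκ
  have main : ∀ k, k ≤ 2 * l →
      (coupledAux n l (2 * l - k)).transpose = (κ * (-1) ^ k) • coupledAux n l k := by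
    intro k hk
    induction k with
    | zero => simpa using transpose_coupledAux_isTop hl
    | succ k ih =>
      obtain ⟨j, hj⟩ : ∃ j, 2 * l = k + 1 + j := ⟨2 * l - (k + 1), by omega⟩
      have e := congrArg Matrix.transpose (Jplus_commutator_succ (n := n) l j)
      have ih := ih (by omega)
      rw [show 2 * l - k = j + 1 by omega] at ih
      rw [show 2 * l - (k + 1) = j by omega]
      rw [Matrix.transpose_sub, Matrix.transpose_mul, Matrix.transpose_mul, ih,
        show (Jplus n).transpose = Jminus n from rfl, Matrix.smul_mul, Matrix.mul_smul,
        ← smul_sub, ← neg_sub, Jminus_commutator, Matrix.transpose_smul] at e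
      have hs : step l j = step l k := by
        have hj' : (2 : ℝ) * l = k + 1 + j := by exact_mod_cast hj
        rw [step, step]
        congr 1
        rw [hj']
        ring
      have hs0 := step_pos (l := l) (k := k) (by omega)
      rw [hs] at e
      have e2 := congrArg (fun Y => (step l k)⁻¹ • Y) e
      simp only [smul_smul, inv_mul_cancel₀ hs0.ne', one_smul] at e2
      rw [← e2, smul_neg, smul_smul, ← neg_smul]
      congr 1
      field_simp
      ring
  have hmid := main l (by omega)
  -- The middle element e(l,0) is diagonal, hence symmetric, and it has norm one; this forces
  -- κ(-1)^l = 1.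
  have hsym : (coupledAux n l l).transpose = coupledAux n l l := by
    ext a b
    rw [Matrix.transpose_apply]
    by_cases hab : a = b
    · rw [hab]
    · have h1 : (a : ℕ) ≠ b := fun e => hab (Fin.ext e)
      rw [coupledAux_apply_of_ne (by omega), coupledAux_apply_of_ne (by omega)]
  rw [show 2 * l - l = l by omega, hsym] at hmid
  have h1 := hsInner_same (n := n) (k := l) hl (by omega)
  have h2 := congrArg (hsInner (coupledAux n l l)) hmid
  rw [hsInner_smul_right, h1, mul_one] at h2
  have h3 : ((-1 : ℝ) ^ l) * (-1) ^ l = 1 := by rw [← mul_pow]; simp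
  have hκ1 : κ = (-1) ^ l := by linear_combination -κ * h3 - (-1) ^ l * h2
  rw [main k hk, hκ1]

/-! ### Selection rules for triple traces -/

theorem trace_triple_of_weight {l₁ l₂ l₃ k₁ k₂ k₃ : ℕ}
    (h : (l₁ : ℤ) - k₁ + (l₂ - k₂) + (l₃ - k₃) ≠ 0) :
    Matrix.trace (coupledAux n l₁ k₁ * coupledAux n l₂ k₂ * coupledAux n l₃ k₃) = 0 := by
  simp only [Matrix.trace, Matrix.diag_apply, Matrix.mul_apply, Finset.sum_mul]
  refine Finset.sum_eq_zero fun a _ => Finset.sum_eq_zero fun c _ => Finset.sum_eq_zero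
    fun b _ => ?_
  by_contra e
  have h1 := coupledAux_support (left_ne_zero_of_mul (left_ne_zero_of_mul e))
  have h2 := coupledAux_support (right_ne_zero_of_mul (left_ne_zero_of_mul e))
  have h3 := coupledAux_support (right_ne_zero_of_mul e)
  omega

/-- Since the trace of a commutator is zero, a lowering step on the third factor can be moved to the
first two. This reduces to the top weight l₃ in the third slot, which the other weights cannot
cancel, being at least -l₁ and -l₂. -/
theorem trace_triple_of_add_lt {l₁ l₂ l₃ : ℕ} (h : l₁ + l₂ < l₃) (k₁ k₂ k₃ : ℕ) :
    Matrix.trace (coupledAux n l₁ k₁ * coupledAux n l₂ k₂ * coupledAux n l₃ k₃) = 0 := by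
  induction k₃ generalizing k₁ k₂ with
  | zero =>
    by_cases h1 : 2 * l₁ < k₁
    · simp [coupledAux_eq_zero h1]
    by_cases h2 : 2 * l₂ < k₂
    · simp [coupledAux_eq_zero h2]
    exact trace_triple_of_weight (by push_cast; omega)
  | succ k ih =>
    by_cases hk : 2 * l₃ ≤ k
    · rw [coupledAux_eq_zero (l := l₃) (by omega)]
      simp
    refine mul_left_cancel₀ (step_pos (l := l₃) (k := k) (by omega)).ne' ?_
    have main : ∀ A B C J : Matrix (Fin (n + 1)) (Fin (n + 1)) ℝ,
        Matrix.trace (A * B * (J * C - C * J)) =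
          -Matrix.trace ((J * A - A * J) * B * C) - Matrix.trace (A * (J * B - B * J) * C) := by
      intro A B C J
      have e : Matrix.trace (A * B * C * J) = Matrix.trace (J * A * B * C) := by
        rw [Matrix.trace_mul_comm]; simp only [mul_assoc]
      simp only [mul_sub, sub_mul, Matrix.trace_sub, ← mul_assoc]
      rw [e]
      ring
    have e : step l₃ k * Matrix.trace
        (coupledAux n l₁ k₁ * coupledAux n l₂ k₂ * coupledAux n l₃ (k + 1)) =
        Matrix.trace (coupledAux n l₁ k₁ * coupledAux n l₂ k₂ *
          (step l₃ k • coupledAux n l₃ (k + 1))) := by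
      rw [Matrix.mul_smul, Matrix.trace_smul, smul_eq_mul]
    rw [e, ← Jminus_commutator, main, Jminus_commutator, Jminus_commutator, Matrix.smul_mul,
      Matrix.smul_mul, Matrix.mul_smul, Matrix.smul_mul, Matrix.trace_smul, Matrix.trace_smul,
      ih, ih]
    simp

theorem trace_triple_of_not_triangle {l₁ l₂ l₃ : ℕ}
    (h : ¬ (|(l₁ : ℤ) - l₂| ≤ l₃ ∧ (l₃ : ℤ) ≤ l₁ + l₂)) (k₁ k₂ k₃ : ℕ) :
    Matrix.trace (coupledAux n l₁ k₁ * coupledAux n l₂ k₂ * coupledAux n l₃ k₃) = 0 := by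
  rw [abs_le] at h
  rcases lt_or_ge (l₁ + l₂) l₃ with h1 | h1
  · exact trace_triple_of_add_lt h1 _ _ _
  rcases lt_or_ge (l₂ + l₃) l₁ with h2 | h2
  · rw [mul_assoc, Matrix.trace_mul_comm]
    exact trace_triple_of_add_lt h2 _ _ _
  rcases lt_or_ge (l₃ + l₁) l₂ with h3 | h3
  · rw [mul_assoc, Matrix.trace_mul_comm, mul_assoc, Matrix.trace_mul_comm]
    exact trace_triple_of_add_lt h3 _ _ _
  omega

theorem trace_triple_eq_zero {l₁ l₂ l₃ k₁ k₂ k₃ : ℕ}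
    (h : ¬ (|(l₁ : ℤ) - l₂| ≤ l₃ ∧ (l₃ : ℤ) ≤ l₁ + l₂ ∧
      (l₁ : ℤ) - k₁ + (l₂ - k₂) + (l₃ - k₃) = 0)) :
    Matrix.trace (coupledAux n l₁ k₁ * coupledAux n l₂ k₂ * coupledAux n l₃ k₃) = 0 := by
  by_cases hw : (l₁ : ℤ) - k₁ + (l₂ - k₂) + (l₃ - k₃) = 0
  · exact trace_triple_of_not_triangle (fun h' => h ⟨h'.1, h'.2, hw⟩) _ _ _
  · exact trace_triple_of_weight hw

/-! ### Clebsch–Gordan coefficients and product symbols as traces -/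

theorem coupled_sub (l k : ℕ) : coupled n l ((l : ℤ) - k) = coupledAux n l k := by
  rw [coupled]
  congr 1
  omega

theorem clebschGordan_eq (l : ℕ) (m : ℤ) (a b : Fin (n + 1)) :
    clebschGordan n l m a b = (-1) ^ (b : ℕ) * coupled n l m a b := by
  rw [clebschGordan, Matrix.mul_smul, Matrix.trace_smul, Matrix.trace_mul_single]
  simp

/-- A Clebsch–Gordan coefficient is a matrix entry times the sign of its column. Each of the signs
(-1)^b and (-1)^c occurs twice in the sum and cancels. -/
theorem productCoeff_eq (l₁ l₂ l₃ : ℕ) (m₁ m₂ m₃ : ℤ) : productCoeff n l₁ l₂ l₃ m₁ m₂ m₃ =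
    Matrix.trace (coupled n l₁ m₁ * coupled n l₂ m₂ * (coupled n l₃ m₃).transpose) := by
  simp only [productCoeff, clebschGordan_eq, Matrix.trace, Matrix.diag_apply, Matrix.mul_apply,
    Finset.sum_mul, Matrix.transpose_apply]
  refine Finset.sum_congr rfl fun a _ => ?_
  rw [Finset.sum_comm]
  refine Finset.sum_congr rfl fun c _ => Finset.sum_congr rfl fun b _ => ?_
  have h1 : ((-1 : ℝ) ^ (b : ℕ)) * (-1) ^ (b : ℕ) = 1 := by rw [← mul_pow]; simp
  have h2 : ((-1 : ℝ) ^ (c : ℕ)) * (-1) ^ (c : ℕ) = 1 := by rw [← mul_pow]; simp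
  linear_combination (coupled n l₁ m₁ a b * coupled n l₂ m₂ b c * coupled n l₃ m₃ a c) *
    ((-1 : ℝ) ^ (c : ℕ) * (-1) ^ (c : ℕ) * h1 + h2)

/-- The transpose of e(l₃,-m₃) is (-1)^{m₃} e(l₃,m₃), and this sign cancels the one in the
definition of the symbol up to (-1)^n. The result is cyclically symmetric in the three columns. -/
theorem wignerProduct_eq {l₁ l₂ l₃ k₁ k₂ k₃ : ℕ} (hl : l₃ ≤ n) (hk : k₃ ≤ 2 * l₃) :
    wignerProduct n l₁ l₂ l₃ (l₁ - k₁) (l₂ - k₂) (l₃ - k₃) =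
    (-1) ^ n * Matrix.trace (coupledAux n l₁ k₁ * coupledAux n l₂ k₂ * coupledAux n l₃ k₃) := by
  rw [wignerProduct, productCoeff_eq, coupled_sub, coupled_sub,
    show -((l₃ : ℤ) - k₃) = (l₃ : ℤ) - ((2 * l₃ - k₃ : ℕ) : ℤ) by
      rw [Nat.cast_sub hk]; push_cast; ring,
    coupled_sub, transpose_coupledAux hl hk, Matrix.mul_smul, Matrix.trace_smul, smul_eq_mul,
    ← mul_assoc]
  congr 1
  have h1 : ((-1 : ℝ)) ^ ((n : ℤ) - (l₃ - k₃)) = (-1) ^ n * (-1) ^ l₃ * (-1) ^ k₃ := by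
    rw [show (n : ℤ) - (l₃ - k₃) = ((n + k₃ : ℕ) : ℤ) - (l₃ : ℕ) by push_cast; ring,
      zpow_sub₀ (by norm_num), zpow_natCast, zpow_natCast, pow_add]
    rcases neg_one_pow_eq_or ℝ l₃ with h | h <;> rw [h] <;> ring
  rw [h1]
  have h2 : ((-1 : ℝ) ^ l₃) * (-1) ^ l₃ = 1 := by rw [← mul_pow]; simp
  have h3 : ((-1 : ℝ) ^ k₃) * (-1) ^ k₃ = 1 := by rw [← mul_pow]; simp
  linear_combination ((-1 : ℝ) ^ n) * ((-1 : ℝ) ^ k₃ * (-1) ^ k₃ * h2 + h3)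

/-! ### The Berezin characteristic numbers -/

/-- The first row of `J₋` is zero, so in that row the commutator with `J₋` is just right
multiplication by `-J₋`. -/
theorem coupledAux_zero_row (l k : ℕ) (b : Fin (n + 1)) : coupledAux n l k 0 b =
    (-1) ^ k * (∏ i ∈ Finset.range k, step l i)⁻¹ * (coupledAux n l 0 * Jminus n ^ k) 0 b := by
  induction k generalizing b with
  | zero => simp
  | succ k ih =>
    have h0 : (Jminus n * coupledAux n l k) 0 b = 0 := by
      rw [Matrix.mul_apply]
      refine Finset.sum_eq_zero fun c _ => ?_
      rw [Jminus, if_neg (by simp), zero_mul]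
    rw [coupledAux_succ, Matrix.smul_apply, Matrix.sub_apply, h0, Matrix.mul_apply]
    simp only [ih]
    rw [pow_succ (Jminus n), ← mul_assoc (coupledAux n l 0), Matrix.mul_apply,
      Finset.prod_range_succ, mul_inv, Finset.mul_sum, zero_sub, ← Finset.sum_neg_distrib,
      Finset.smul_sum]
    refine Finset.sum_congr rfl fun c _ => ?_
    rw [smul_eq_mul]
    ring

theorem prod_step_sq (l : ℕ) : (∏ i ∈ Finset.range l, step l i) ^ 2 = ((2 * l).factorial : ℝ) := by
  -- The partial products need the extra factor (2l-k)! to give an identity that telescopes; at `k =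
  -- l` both sides carry l!, which cancels.
  have key : ∀ k ≤ l, (∏ i ∈ Finset.range k, step l i) ^ 2 * ((2 * l - k).factorial : ℝ) =
      (2 * l).factorial * k.factorial := by
    intro k hk
    induction k with
    | zero => simp
    | succ k ih =>
      have ih := ih (by omega)
      rw [show 2 * l - k = (2 * l - (k + 1)) + 1 by omega, Nat.factorial_succ] at ih
      rw [Finset.prod_range_succ, mul_pow, Nat.factorial_succ, sq (step l k),
        step_sq (by omega)]
      have : (((2 * l - (k + 1) + 1 : ℕ)) : ℝ) = 2 * l - k := by
        rw [show 2 * l - (k + 1) + 1 = 2 * l - k by omega, Nat.cast_sub (by omega)]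
        push_cast; ring
      rw [Nat.cast_mul, this] at ih
      push_cast
      linear_combination (k + 1 : ℝ) * ih
  have := key l le_rfl
  rw [show 2 * l - l = l by omega] at this
  exact mul_right_cancel₀ (by positivity) this

theorem coupledAux_corner {l : ℕ} (hl : l ≤ n) : coupledAux n l l 0 0 =
    n.factorial * Real.sqrt (2 * l + 1) /
      Real.sqrt ((n + l + 1).factorial * (n - l).factorial) := by
  have hpos : 0 < ∏ i ∈ Finset.range l, step l i :=
    Finset.prod_pos fun i hi => step_pos (by have := Finset.mem_range.1 hi; omega)
  have hm := mu_pos hl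
  have hcor : (Jplus n ^ l * Jminus n ^ l) 0 0 =
      (l.factorial : ℝ) ^ 2 * n.choose l := by
    rw [← transpose_Jplus_pow, Matrix.mul_apply]
    simp only [Matrix.transpose_apply, Jplus_pow_apply, Fin.val_zero, zero_add, ite_mul, zero_mul]
    rw [sum_fin_ite_val_eq _ _ _ (by omega), if_pos rfl, Real.mul_self_sqrt]
    · have := prod_weights (n := n) (a := 0) (l := l) (by omega)
      simpa using this
    · have := prod_weights (n := n) (a := 0) (l := l) (by omega)
      simp only [Nat.cast_zero, zero_add] at this
      rw [Nat.cast_zero]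
      simp only [zero_add]
      rw [this]
      positivity
  have hval : coupledAux n l l 0 0 = (∏ i ∈ Finset.range l, step l i)⁻¹ * (mu n l)⁻¹ *
      ((l.factorial : ℝ) ^ 2 * n.choose l) := by
    rw [coupledAux_zero_row, coupledAux, Matrix.smul_mul, Matrix.smul_apply, hcor, smul_eq_mul]
    have h1 : ((-1 : ℝ) ^ l) * (-1) ^ l = 1 := by rw [← mul_pow]; simp
    linear_combination ((∏ i ∈ Finset.range l, step l i)⁻¹ * (mu n l)⁻¹ *
      ((l.factorial : ℝ) ^ 2 * n.choose l)) * h1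
  -- Both sides are nonnegative, so the square roots are removed by squaring; what remains is an
  -- identity of factorials.
  rw [← sq_eq_sq₀ (by rw [hval]; positivity) (by positivity), hval, div_pow, mul_pow, mul_pow, mul_pow,
    mul_pow, inv_pow, inv_pow, prod_step_sq, mu_sq hl, Real.sq_sqrt (by positivity),
    Real.sq_sqrt (by positivity), Nat.cast_choose ℝ hl, Nat.cast_choose ℝ (by omega),
    show n + l + 1 - (2 * l + 1) = n - l by omega, Nat.factorial_succ (2 * l)]
  push_cast
  field_simp

theorem berezin_eq {l : ℕ} (hl : l ≤ n) : berezin n l =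
    n.factorial * Real.sqrt (n + 1) /
      Real.sqrt ((n + l + 1).factorial * (n - l).factorial) := by
  have h : coupled n l 0 = coupledAux n l l := by
    rw [← coupled_sub, sub_self]
  rw [berezin, h, coupledAux_corner hl, Real.sqrt_div (by positivity)]
  field_simp

theorem berezin_ne_zero {l : ℕ} (hl : l ≤ n) : berezin n l ≠ 0 := by
  rw [berezin_eq hl]
  positivity

/-! ### The spin representation is a homomorphism -/

-- Read a polynomial of degree at most n as a binary form of degree n evaluated at (U, V).
-- Multiplying the polynomial by a + bX multiplies the form by aU + bV.
open Polynomial in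
theorem sum_coeff_linear_mul (a b : ℂ) (p U V : ℂ[X]) (n : ℕ) (hp : p.natDegree ≤ n) :
    ∑ l ∈ Finset.range (n + 2), C (((C a + C b * X) * p).coeff l) * U ^ (n + 1 - l) * V ^ l =
      (C a * U + C b * V) *
        ∑ l ∈ Finset.range (n + 1), C (p.coeff l) * U ^ (n - l) * V ^ l := by
  have hc : ∀ l, ((C a + C b * X) * p).coeff l = a * p.coeff l + b * (X * p).coeff l := by
    intro l
    rw [add_mul, coeff_add, coeff_C_mul, mul_assoc, coeff_C_mul]
  have h1 : ∑ l ∈ Finset.range (n + 2), C (p.coeff l) * U ^ (n + 1 - l) * V ^ l =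
      U * ∑ l ∈ Finset.range (n + 1), C (p.coeff l) * U ^ (n - l) * V ^ l := by
    rw [Finset.sum_range_succ, coeff_eq_zero_of_natDegree_lt (by omega), Finset.mul_sum]
    simp only [map_zero, zero_mul, add_zero]
    refine Finset.sum_congr rfl fun l hl => ?_
    have := Finset.mem_range.1 hl
    rw [show n + 1 - l = (n - l) + 1 by omega, pow_succ]
    ring
  have h2 : ∑ l ∈ Finset.range (n + 2), C ((X * p).coeff l) * U ^ (n + 1 - l) * V ^ l =
      V * ∑ l ∈ Finset.range (n + 1), C (p.coeff l) * U ^ (n - l) * V ^ l := by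
    rw [Finset.sum_range_succ', Finset.mul_sum]
    simp only [coeff_X_mul_zero, map_zero, zero_mul, add_zero, coeff_X_mul]
    refine Finset.sum_congr rfl fun l hl => ?_
    rw [show n + 1 - (l + 1) = n - l by omega, pow_succ]
    ring
  simp only [hc]
  simp only [map_add, map_mul, add_mul, Finset.sum_add_distrib]
  rw [mul_assoc (C a) U, mul_assoc (C b) V, ← h1, ← h2, Finset.mul_sum, Finset.mul_sum]
  simp only [mul_assoc]

open Polynomial in
theorem natDegree_linear_pow_mul_le (a b c d : ℂ) (i j : ℕ) :
    ((C a + C b * X) ^ i * (C c + C d * X) ^ j).natDegree ≤ i + j := by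
  have h : ∀ a b : ℂ, (C a + C b * X).natDegree ≤ 1 := fun a b => by
    rw [add_comm]; exact natDegree_linear_le
  refine natDegree_mul_le.trans (add_le_add ?_ ?_)
  · exact natDegree_pow_le.trans (by simpa using Nat.mul_le_mul_left i (h a b))
  · exact natDegree_pow_le.trans (by simpa using Nat.mul_le_mul_left j (h c d))

open Polynomial in
theorem sum_coeff_homogenize (a b c d : ℂ) (U V : ℂ[X]) (i j : ℕ) :
    ∑ l ∈ Finset.range (i + j + 1),
      C (((C a + C b * X) ^ i * (C c + C d * X) ^ j).coeff l) * U ^ (i + j - l) * V ^ l =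
      (C a * U + C b * V) ^ i * (C c * U + C d * V) ^ j := by
  induction i with
  | zero =>
    induction j with
    | zero => simp
    | succ j ih =>
      have hd := natDegree_linear_pow_mul_le a b c d 0 j
      rw [zero_add] at ih hd ⊢
      rw [pow_zero, one_mul] at ih hd ⊢
      rw [pow_zero, one_mul] at ih ⊢
      rw [pow_succ', sum_coeff_linear_mul _ _ _ _ _ _ hd, ih, pow_succ']
  | succ i ih =>
    have hd := natDegree_linear_pow_mul_le a b c d i j
    rw [show i + 1 + j = i + j + 1 by ring, pow_succ', mul_assoc,
      sum_coeff_linear_mul _ _ _ _ _ _ hd, ih]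
    ring

theorem sqrt_choose_pos (l : Fin (n + 1)) : 0 < Real.sqrt (n.choose l) :=
  Real.sqrt_pos.2 (by exact_mod_cast Nat.choose_pos (by omega))

-- Row k of the representing matrix lists the coefficients of a product of linear forms.
-- Substituting the linear forms of h for the variables (`sum_coeff_homogenize`) gives the row for
-- gh and, expanded, the matrix product; the binomial normalizations telescope.
open Polynomial in
theorem spinRep_mul (g h : SU2) : spinRep n (g * h) = spinRep n g * spinRep n h := by
  ext k m
  have hk : n - (k : ℕ) + k = n := by omega
  rw [Matrix.mul_apply]
  simp only [spinRep]
  set a := (g : Matrix (Fin 2) (Fin 2) ℂ) 0 0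
  set b := (g : Matrix (Fin 2) (Fin 2) ℂ) 0 1
  set c := (g : Matrix (Fin 2) (Fin 2) ℂ) 1 0
  set d := (g : Matrix (Fin 2) (Fin 2) ℂ) 1 1
  set U := C ((h : Matrix (Fin 2) (Fin 2) ℂ) 0 0) + C ((h : Matrix (Fin 2) (Fin 2) ℂ) 0 1) * X
    with hU
  set V := C ((h : Matrix (Fin 2) (Fin 2) ℂ) 1 0) + C ((h : Matrix (Fin 2) (Fin 2) ℂ) 1 1) * X
    with hV
  have e := sum_coeff_homogenize a b c d U V (n - k) k
  rw [hk] at e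
  have e1 : C (((g * h : SU2) : Matrix (Fin 2) (Fin 2) ℂ) 0 0) +
      C (((g * h : SU2) : Matrix (Fin 2) (Fin 2) ℂ) 0 1) * X = C a * U + C b * V := by
    rw [Submonoid.coe_mul, Matrix.mul_apply, Matrix.mul_apply, Fin.sum_univ_two,
      Fin.sum_univ_two, hU, hV]
    simp only [map_add, map_mul]
    ring
  have e2 : C (((g * h : SU2) : Matrix (Fin 2) (Fin 2) ℂ) 1 0) +
      C (((g * h : SU2) : Matrix (Fin 2) (Fin 2) ℂ) 1 1) * X = C c * U + C d * V := by
    rw [Submonoid.coe_mul, Matrix.mul_apply, Matrix.mul_apply, Fin.sum_univ_two,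
      Fin.sum_univ_two, hU, hV]
    simp only [map_add, map_mul]
    ring
  rw [e1, e2, ← e, Finset.sum_range, finsetSum_coeff, Finset.mul_sum]
  refine Finset.sum_congr rfl fun l _ => ?_
  rw [mul_assoc, coeff_C_mul]
  have h1 : ((Real.sqrt (n.choose k) / Real.sqrt (n.choose m) : ℝ) : ℂ) =
      ((Real.sqrt (n.choose k) / Real.sqrt (n.choose l) : ℝ) : ℂ) *
        ((Real.sqrt (n.choose l) / Real.sqrt (n.choose m) : ℝ) : ℂ) := by
    rw [← Complex.ofReal_mul]
    congr 1
    have := sqrt_choose_pos l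
    field_simp
  rw [h1]
  ring

open Polynomial in
theorem spinRep_of_diagonal {g : SU2} (h1 : (g : Matrix (Fin 2) (Fin 2) ℂ) 0 1 = 0)
    (h2 : (g : Matrix (Fin 2) (Fin 2) ℂ) 1 0 = 0) :
    spinRep n g = Matrix.diagonal fun k : Fin (n + 1) =>
      (g : Matrix (Fin 2) (Fin 2) ℂ) 0 0 ^ (n - (k : ℕ)) *
        (g : Matrix (Fin 2) (Fin 2) ℂ) 1 1 ^ (k : ℕ) := by
  ext k l
  rw [spinRep, h1, h2, map_zero, zero_mul, add_zero, zero_add, mul_pow, ← C_pow, ← C_pow,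
    coeff_C_mul, coeff_C_mul, coeff_X_pow, Matrix.diagonal_apply]
  by_cases h : k = l
  · subst h
    have := sqrt_choose_pos k
    rw [div_self this.ne']
    simp
  · rw [if_neg h, if_neg (fun e => h (Fin.ext e.symm))]
    simp

theorem spinRep_one : spinRep n 1 = 1 := by
  rw [spinRep_of_diagonal (by simp) (by simp)]
  simp

open Polynomial in
theorem coeff_linear_pow (a b : ℂ) (l : ℕ) :
    ((C a + C b * X) ^ n).coeff l = n.choose l * (a ^ (n - l) * b ^ l) := by
  rw [add_comm, add_pow, finsetSum_coeff, Finset.sum_eq_single l]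
  · rw [mul_pow, ← C_pow, ← C_pow, ← C_eq_natCast, mul_assoc, mul_assoc, coeff_C_mul,
      ← C_mul, X_pow_mul, coeff_C_mul, coeff_X_pow]
    simp
    ring
  · intro m _ hm
    rw [mul_pow, ← C_pow, ← C_pow, ← C_eq_natCast, mul_assoc, mul_assoc, coeff_C_mul,
      ← C_mul, X_pow_mul, coeff_C_mul, coeff_X_pow, if_neg (Ne.symm hm)]
    simp
  · intro hl
    rw [Nat.choose_eq_zero_of_lt (by simpa using hl)]
    simp

open Polynomial in
theorem spinRep_col_zero (g : SU2) (k : Fin (n + 1)) : spinRep n g k 0 =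
    (Real.sqrt (n.choose k) : ℂ) * ((g : Matrix (Fin 2) (Fin 2) ℂ) 0 0 ^ (n - (k : ℕ)) *
      (g : Matrix (Fin 2) (Fin 2) ℂ) 1 0 ^ (k : ℕ)) := by
  rw [spinRep, Fin.val_zero, coeff_zero_eq_eval_zero]
  simp

open Polynomial in
theorem spinRep_row_zero (g : SU2) (l : Fin (n + 1)) : spinRep n g 0 l =
    (Real.sqrt (n.choose l) : ℂ) * ((g : Matrix (Fin 2) (Fin 2) ℂ) 0 0 ^ (n - (l : ℕ)) *
      (g : Matrix (Fin 2) (Fin 2) ℂ) 0 1 ^ (l : ℕ)) := by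
  rw [spinRep, Fin.val_zero, Nat.sub_zero, pow_zero, mul_one, coeff_linear_pow]
  have h := sqrt_choose_pos l
  have h2 : ((n.choose l : ℕ) : ℝ) = Real.sqrt (n.choose l) * Real.sqrt (n.choose l) :=
    (Real.mul_self_sqrt (by positivity)).symm
  have h3 : ((n.choose l : ℕ) : ℂ) = (Real.sqrt (n.choose l) : ℂ) * Real.sqrt (n.choose l) := by
    exact_mod_cast congrArg Complex.ofReal h2
  have h4 : (Real.sqrt (n.choose l) : ℂ) ≠ 0 := by exact_mod_cast h.ne'
  rw [h3]
  simp only [Nat.choose_zero_right, Nat.cast_one, Real.sqrt_one]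
  push_cast
  field_simp

/-! ### The conjugation action -/

theorem spinRep_mul_inv (g : SU2) : spinRep n g * spinRep n g⁻¹ = 1 := by
  rw [← spinRep_mul, mul_inv_cancel, spinRep_one]

theorem spinRep_inv_mul (g : SU2) : spinRep n g⁻¹ * spinRep n g = 1 := by
  rw [← spinRep_mul, inv_mul_cancel, spinRep_one]

theorem conjAct_mul (g h : SU2) (P : Op n) :
    conjAct n (g * h) P = conjAct n g (conjAct n h P) := by
  simp only [conjAct, spinRep_mul, mul_inv_rev, mul_assoc]

theorem conjAct_one (P : Op n) : conjAct n 1 P = P := by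
  simp [conjAct, spinRep_one]

theorem conjAct_one_right (g : SU2) : conjAct n g 1 = 1 := by
  rw [conjAct, mul_one, spinRep_mul_inv]

theorem conjAct_conjAct_inv (g : SU2) (P : Op n) : conjAct n g (conjAct n g⁻¹ P) = P := by
  rw [← conjAct_mul, mul_inv_cancel, conjAct_one]

theorem conjAct_mul_right (g : SU2) (P Q : Op n) :
    conjAct n g (P * Q) = conjAct n g P * conjAct n g Q := by
  have e : spinRep n g * P * spinRep n g⁻¹ * (spinRep n g * Q * spinRep n g⁻¹) =
      spinRep n g * P * (spinRep n g⁻¹ * spinRep n g) * Q * spinRep n g⁻¹ := by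
    simp only [mul_assoc]
  rw [conjAct, conjAct, conjAct, e, spinRep_inv_mul, mul_one]
  simp only [mul_assoc]

theorem conjAct_smul (g : SU2) (r : ℂ) (P : Op n) : conjAct n g (r • P) = r • conjAct n g P := by
  simp [conjAct]

theorem conjAct_sum {ι : Type*} (s : Finset ι) (g : SU2) (P : ι → Op n) :
    conjAct n g (∑ i ∈ s, P i) = ∑ i ∈ s, conjAct n g (P i) := by
  simp only [conjAct, Matrix.mul_sum, Matrix.sum_mul]

theorem trace_conjAct (g : SU2) (P : Op n) : Matrix.trace (conjAct n g P) = Matrix.trace P := by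
  rw [conjAct, Matrix.trace_mul_comm, ← mul_assoc, spinRep_inv_mul, one_mul]

theorem trace_mul_conjAct (g : SU2) (P Q : Op n) :
    Matrix.trace (P * conjAct n g Q) = Matrix.trace (conjAct n g⁻¹ P * Q) := by
  rw [← trace_conjAct g (conjAct n g⁻¹ P * Q), conjAct_mul_right, conjAct_conjAct_inv]

theorem conjAct_of_diagonal {g : SU2} (h1 : (g : Matrix (Fin 2) (Fin 2) ℂ) 0 1 = 0)
    (h2 : (g : Matrix (Fin 2) (Fin 2) ℂ) 1 0 = 0) (v : Fin (n + 1) → ℂ) :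
    conjAct n g (Matrix.diagonal v) = Matrix.diagonal v := by
  have hcomm : spinRep n g * Matrix.diagonal v = Matrix.diagonal v * spinRep n g := by
    rw [spinRep_of_diagonal h1 h2, Matrix.diagonal_mul_diagonal, Matrix.diagonal_mul_diagonal]
    simp only [mul_comm]
  rw [conjAct, hcomm, mul_assoc, spinRep_mul_inv, mul_one]

/-! ### Rotations of the sphere -/

theorem coe_inv_SU2 (g : SU2) : ((g⁻¹ : SU2) : Matrix (Fin 2) (Fin 2) ℂ) =
    star (g : Matrix (Fin 2) (Fin 2) ℂ) := rfl

theorem coe_mul_coe_inv (g : SU2) :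
    (g : Matrix (Fin 2) (Fin 2) ℂ) * ((g⁻¹ : SU2) : Matrix (Fin 2) (Fin 2) ℂ) = 1 := by
  rw [← Submonoid.coe_mul, mul_inv_cancel]; rfl

theorem coe_inv_mul_coe (g : SU2) :
    ((g⁻¹ : SU2) : Matrix (Fin 2) (Fin 2) ℂ) * (g : Matrix (Fin 2) (Fin 2) ℂ) = 1 := by
  rw [← Submonoid.coe_mul, inv_mul_cancel]; rfl

theorem rotates_iff (g : SU2) (x y : S2) : Rotates g x y ↔
    (g : Matrix (Fin 2) (Fin 2) ℂ) * pauli x = pauli y * (g : Matrix (Fin 2) (Fin 2) ℂ) := by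
  constructor
  · intro h
    rw [← show _ = pauli y from h, mul_assoc, mul_assoc, coe_inv_mul_coe, mul_one]
  · intro h
    rw [Rotates, h, mul_assoc, coe_mul_coe_inv, mul_one]

theorem Rotates.mul {g h : SU2} {x y z : S2} (h1 : Rotates g x y) (h2 : Rotates h y z) :
    Rotates (h * g) x z := by
  rw [rotates_iff] at *
  rw [Submonoid.coe_mul, mul_assoc, h1, ← mul_assoc, h2, mul_assoc]

theorem Rotates.inv {g : SU2} {x y : S2} (h : Rotates g x y) : Rotates g⁻¹ y x := by
  rw [rotates_iff] at *
  have e : ((g⁻¹ : SU2) : Matrix (Fin 2) (Fin 2) ℂ) * (g * pauli x) * (g⁻¹ : SU2) =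
      (g⁻¹ : SU2) * (pauli y * g) * (g⁻¹ : SU2) := by rw [h]
  rw [← mul_assoc, coe_inv_mul_coe, one_mul] at e
  rw [e, mul_assoc, mul_assoc, coe_mul_coe_inv, mul_one]

theorem pauli_injective {x y : S2} (h : pauli x = pauli y) : x = y := by
  have h00 := congrFun (congrFun h 0) 0
  have h10 := congrFun (congrFun h 1) 0
  simp only [pauli, Matrix.of_apply, Matrix.cons_val', Matrix.cons_val_zero, Matrix.cons_val_one,
    Matrix.cons_val_fin_one] at h00 h10
  have h2 : coord x 2 = coord y 2 := by exact_mod_cast h00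
  have h0 : coord x 0 = coord y 0 := by simpa using congrArg Complex.re h10
  have h1 : coord x 1 = coord y 1 := by simpa using congrArg Complex.im h10
  apply Subtype.ext
  ext i
  fin_cases i
  · exact h0
  · exact h1
  · exact h2

theorem Rotates.unique {g : SU2} {x y z : S2} (h1 : Rotates g x y) (h2 : Rotates g x z) :
    y = z := pauli_injective (h1.symm.trans h2)

theorem stabilizer_northPole {g : SU2} (h : Rotates g northPole northPole) :
    (g : Matrix (Fin 2) (Fin 2) ℂ) 0 1 = 0 ∧ (g : Matrix (Fin 2) (Fin 2) ℂ) 1 0 = 0 := by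
  rw [rotates_iff] at h
  obtain ⟨c0, c1, c2⟩ := coord_northPole
  have h01 := congrFun (congrFun h 0) 1
  have h10 := congrFun (congrFun h 1) 0
  simp only [Matrix.mul_apply, Fin.sum_univ_two, pauli, c0, c1, c2, Matrix.of_apply,
    Matrix.cons_val', Matrix.cons_val_zero, Matrix.cons_val_one, Matrix.cons_val_fin_one] at h01 h10
  push_cast at h01 h10
  constructor
  · linear_combination (-1 / 2 : ℂ) * h01
  · linear_combination (1 / 2 : ℂ) * h10

/-- If `g` and `h` both move the north pole to `x`, they conjugate diagonal operators alike. -/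
theorem conjAct_diagonal_eq {g h : SU2} {x : S2} (hg : Rotates g northPole x)
    (hh : Rotates h northPole x) (v : Fin (n + 1) → ℂ) :
    conjAct n g (Matrix.diagonal v) = conjAct n h (Matrix.diagonal v) := by
  obtain ⟨e1, e2⟩ := stabilizer_northPole (hg.mul hh.inv)
  have e := conjAct_of_diagonal (n := n) e1 e2 v
  rw [conjAct_mul] at e
  rw [← conjAct_conjAct_inv h (conjAct n g (Matrix.diagonal v)), e]

/-! ### One-parameter subgroups -/

/-- The subgroup of rotations about the second axis. -/
def rotY (t : ℝ) : SU2 :=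
  ⟨!![(Real.cos t : ℂ), -(Real.sin t : ℂ); (Real.sin t : ℂ), (Real.cos t : ℂ)], by
    have h : (Real.cos t : ℂ) * Real.cos t + Real.sin t * Real.sin t = 1 := by
      exact_mod_cast (by nlinarith [Real.sin_sq_add_cos_sq t] :
        Real.cos t * Real.cos t + Real.sin t * Real.sin t = 1)
    rw [Matrix.mem_specialUnitaryGroup_iff, Matrix.mem_unitaryGroup_iff]
    constructor
    · ext i j
      fin_cases i <;> fin_cases j <;>
        simp [Matrix.mul_apply, Fin.sum_univ_two, Matrix.star_apply, -Complex.ofReal_cos,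
          -Complex.ofReal_sin] <;>
        first
          | linear_combination h
          | ring1
    · rw [Matrix.det_fin_two_of]
      linear_combination h⟩

/-- The subgroup of rotations about the third axis. -/
def rotZ (t : ℝ) : SU2 :=
  ⟨!![Complex.exp (-(t * Complex.I)), 0; 0, Complex.exp (t * Complex.I)], by
    rw [Matrix.mem_specialUnitaryGroup_iff, Matrix.mem_unitaryGroup_iff]
    constructor
    · ext i j
      fin_cases i <;> fin_cases j <;>
        simp [Matrix.mul_apply, Fin.sum_univ_two, Matrix.star_apply, ← Complex.exp_conj,
          ← Complex.exp_add]
    · rw [Matrix.det_fin_two_of]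
      simp [← Complex.exp_add]⟩

theorem rotY_mul (s t : ℝ) : rotY s * rotY t = rotY (s + t) := by
  apply Subtype.ext
  rw [Submonoid.coe_mul]
  ext i j
  fin_cases i <;> fin_cases j <;>
    simp [rotY, Matrix.mul_apply, Fin.sum_univ_two, Complex.cos_add, Complex.sin_add] <;> ring

theorem rotY_zero : rotY 0 = 1 := by
  apply Subtype.ext
  ext i j
  fin_cases i <;> fin_cases j <;> simp [rotY]

theorem rotY_inv (t : ℝ) : (rotY t)⁻¹ = rotY (-t) := by
  rw [inv_eq_iff_mul_eq_one, rotY_mul, add_neg_cancel, rotY_zero]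

/-- Coefficientwise differentiability of a family of polynomials. -/
def HasCoeffDerivAt (p : ℝ → Polynomial ℂ) (p' : Polynomial ℂ) (t : ℝ) : Prop :=
  ∀ l, HasDerivAt (fun s => (p s).coeff l) (p'.coeff l) t

theorem HasCoeffDerivAt.mul {p q : ℝ → Polynomial ℂ} {p' q' : Polynomial ℂ} {t : ℝ}
    (hp : HasCoeffDerivAt p p' t) (hq : HasCoeffDerivAt q q' t) :
    HasCoeffDerivAt (fun s => p s * q s) (p' * q t + p t * q') t := by
  intro l
  simp only [Polynomial.coeff_mul, Polynomial.coeff_add]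
  rw [← Finset.sum_add_distrib]
  exact HasDerivAt.fun_sum fun i _ => (hp i.1).mul (hq i.2)

theorem HasCoeffDerivAt.pow {p : ℝ → Polynomial ℂ} {p' : Polynomial ℂ} {t : ℝ}
    (hp : HasCoeffDerivAt p p' t) (i : ℕ) :
    HasCoeffDerivAt (fun s => p s ^ i) ((i : Polynomial ℂ) * p t ^ (i - 1) * p') t := by
  induction i with
  | zero =>
    intro l
    simpa using hasDerivAt_const t _
  | succ i ih =>
    have e := ih.mul hp
    simp only [← pow_succ] at e
    convert e using 1
    rcases Nat.eq_zero_or_pos i with h | h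
    · subst h; simp
    · obtain ⟨j, rfl⟩ : ∃ j, i = j + 1 := ⟨i - 1, by omega⟩
      simp only [Nat.add_sub_cancel]
      push_cast
      ring

theorem hasCoeffDerivAt_linear {a b : ℝ → ℂ} {a' b' : ℂ} {t : ℝ} (ha : HasDerivAt a a' t)
    (hb : HasDerivAt b b' t) : HasCoeffDerivAt
      (fun s => Polynomial.C (a s) + Polynomial.C (b s) * Polynomial.X)
      (Polynomial.C a' + Polynomial.C b' * Polynomial.X) t := by
  intro l
  simp only [Polynomial.coeff_add, Polynomial.coeff_C_mul, Polynomial.coeff_C,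
    Polynomial.coeff_X]
  refine HasDerivAt.add ?_ (hb.mul_const _)
  split_ifs
  · exact ha
  · exact hasDerivAt_const t _

theorem sqrt_choose_succ {i : ℕ} (h : i + 1 ≤ n) :
    Real.sqrt (n.choose (i + 1)) * Real.sqrt (i + 1) =
      Real.sqrt (n.choose i) * Real.sqrt (n - i) := by
  rw [← Real.sqrt_mul (by positivity), ← Real.sqrt_mul (by positivity)]
  congr 1
  have e := Nat.choose_succ_right_eq n i
  have : ((n - i : ℕ) : ℝ) = n - i := Nat.cast_sub (by omega)
  rw [← this]
  exact_mod_cast e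

-- At t = 0 the derivative of (cos t - sin t X)^{n-k} (sin t + cos t X)^k is -(n-k)X^{k+1} +
-- kX^{k-1}. The binomial normalization turns these coefficients into the entries of J₋ - J₊.
open Polynomial in
theorem hasDerivAt_spinRep_rotY_zero (k l : Fin (n + 1)) :
    HasDerivAt (fun t => spinRep n (rotY t) k l)
      (((Jminus n - Jplus n).map Complex.ofReal) k l) 0 := by
  have hcos : HasDerivAt (fun t : ℝ => (Real.cos t : ℂ)) 0 0 := by
    simpa using (Real.hasDerivAt_cos 0).ofReal_comp
  have hsin : HasDerivAt (fun t : ℝ => (Real.sin t : ℂ)) 1 0 := by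
    simpa using (Real.hasDerivAt_sin 0).ofReal_comp
  have h1 := (hasCoeffDerivAt_linear hcos hsin.neg).pow (n - (k : ℕ))
  have h2 := (hasCoeffDerivAt_linear hsin hcos).pow (k : ℕ)
  have h3 := ((h1.mul h2) l).const_mul
    ((Real.sqrt (n.choose k) / Real.sqrt (n.choose l) : ℝ) : ℂ)
  have key : (((Jminus n - Jplus n).map Complex.ofReal) k l) =
      ((Real.sqrt (n.choose k) / Real.sqrt (n.choose l) : ℝ) : ℂ) *
      (((-((n - k : ℕ) : ℝ) * (if (l : ℕ) = k + 1 then 1 else 0) +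
        (k : ℕ) * (if (k : ℕ) = l + 1 then 1 else 0) : ℝ)) : ℂ) := by
    rw [Matrix.map_apply, ← Complex.ofReal_mul]
    congr 1
    have hl := sqrt_choose_pos l
    have hk := sqrt_choose_pos k
    have hk1 : (k : ℕ) ≤ n := by omega
    have hl1 : (l : ℕ) ≤ n := by omega
    rw [Matrix.sub_apply, Jplus_apply, Jminus, Nat.cast_sub hk1]
    rw [div_mul_eq_mul_div, eq_div_iff hl.ne']
    by_cases c1 : (l : ℕ) = k + 1
    · rw [if_neg (by omega), if_pos c1, if_pos c1, if_neg (by omega)]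
      have e := sqrt_choose_succ (n := n) (i := k) (by omega)
      have h0 : (0 : ℝ) ≤ n - k := by
        rw [sub_nonneg]; exact_mod_cast hk1
      have e2 := Real.mul_self_sqrt h0
      rw [c1, Real.sqrt_mul h0]
      linear_combination -Real.sqrt (n - k : ℝ) * e - Real.sqrt (n.choose k) * e2
    · rw [if_neg c1, if_neg c1]
      by_cases c2 : (k : ℕ) = l + 1
      · rw [if_pos c2, if_pos c2]
        have e := sqrt_choose_succ (n := n) (i := l) (by omega)
        have h0 : (0 : ℝ) ≤ n - l := by
          rw [sub_nonneg]; exact_mod_cast hl1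
        have e2 := Real.mul_self_sqrt (by positivity : (0 : ℝ) ≤ (l : ℕ) + 1)
        rw [c2, Real.sqrt_mul h0]
        push_cast
        linear_combination -Real.sqrt ((l : ℕ) + 1 : ℝ) * e +
          Real.sqrt (n.choose ((l : ℕ) + 1)) * e2
      · rw [if_neg c2, if_neg c2]
        ring
  rw [key]
  refine HasDerivAt.congr_deriv
    (show HasDerivAt (fun t => spinRep n (rotY t) k l) _ 0 from h3) ?_
  congr 1
  simp only [Pi.neg_apply, Real.cos_zero, Real.sin_zero, Complex.ofReal_one, Complex.ofReal_zero, map_zero,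
    map_one, neg_zero, zero_mul, add_zero, one_pow, mul_one, zero_add, one_mul, map_neg]
  rw [coeff_add, ← C_eq_natCast, ← C_eq_natCast, mul_assoc, coeff_C_mul, coeff_C_mul, neg_mul, one_mul, neg_mul,
    coeff_neg, ← pow_succ', coeff_X_pow, coeff_X_pow]
  push_cast
  rcases Nat.eq_zero_or_pos (k : ℕ) with hk | hk
  · rw [hk]
    split_ifs <;> simp
  · have e1 : ((k : ℕ) = l + 1) ↔ ((l : ℕ) = k - 1) := by omega
    simp only [e1]
    split_ifs <;> simp

/-- Entrywise differentiability of a family of operators. -/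
def HasMatDerivAt (M : ℝ → Op n) (M' : Op n) (t : ℝ) : Prop :=
  ∀ a b, HasDerivAt (fun s => M s a b) (M' a b) t

theorem HasMatDerivAt.mul {M N : ℝ → Op n} {M' N' : Op n} {t : ℝ} (hM : HasMatDerivAt M M' t)
    (hN : HasMatDerivAt N N' t) : HasMatDerivAt (fun s => M s * N s) (M' * N t + M t * N') t := by
  intro a b
  simp only [Matrix.mul_apply, Matrix.add_apply]
  rw [← Finset.sum_add_distrib]
  exact HasDerivAt.fun_sum fun c _ => (hM a c).mul (hN c b)

theorem hasMatDerivAt_const (M : Op n) (t : ℝ) : HasMatDerivAt (fun _ => M) 0 t :=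
  fun a b => hasDerivAt_const t (M a b)

/-- The derivative at the identity of the representation along `rotY`. -/
def genY (n : ℕ) : Op n := (Jminus n - Jplus n).map Complex.ofReal

/-- The derivative at the identity suffices, because rotY s = rotY (s - t) · rotY t and the
representation is multiplicative. -/
theorem hasMatDerivAt_spinRep_rotY (t : ℝ) :
    HasMatDerivAt (fun s => spinRep n (rotY s)) (genY n * spinRep n (rotY t)) t := by
  have h0 : HasMatDerivAt (fun s => spinRep n (rotY (s - t))) (genY n) t := by
    intro a b
    refine HasDerivAt.comp_sub_const (f := fun s => spinRep n (rotY s) a b) t t ?_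
    rw [sub_self]
    exact hasDerivAt_spinRep_rotY_zero a b
  have h1 := h0.mul (hasMatDerivAt_const (spinRep n (rotY t)) t)
  simpa only [← spinRep_mul, rotY_mul, sub_add_cancel, mul_zero, add_zero] using h1

theorem hasMatDerivAt_spinRep_rotY_inv (t : ℝ) :
    HasMatDerivAt (fun s => spinRep n (rotY s)⁻¹) (spinRep n (rotY t)⁻¹ * -genY n) t := by
  have h0 : HasMatDerivAt (fun s => spinRep n (rotY (t - s))) (-genY n) t := by
    intro a b
    have := HasDerivAt.comp_const_sub (f := fun s => spinRep n (rotY s) a b) t t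
      (f' := genY n a b) (by rw [sub_self]; exact hasDerivAt_spinRep_rotY_zero a b)
    exact this
  have h1 := (hasMatDerivAt_const (spinRep n (rotY t)⁻¹) t).mul h0
  have e : ∀ s, -t + (t - s) = -s := fun s => by ring
  simpa only [rotY_inv, ← spinRep_mul, rotY_mul, e, zero_mul, zero_add] using h1

theorem conjAct_rotZ_basisOp (t : ℝ) (l k : ℕ) : conjAct n (rotZ t) (basisOp n l k) =
    Complex.exp (-((2 * ((l : ℂ) - k) * t) * Complex.I)) • basisOp n l k := by
  have hd : ∀ s : ℝ, spinRep n (rotZ s) = Matrix.diagonal fun k : Fin (n + 1) =>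
      Complex.exp (((2 * (k : ℕ) - n : ℂ) * s) * Complex.I) := by
    intro s
    rw [spinRep_of_diagonal (by simp [rotZ]) (by simp [rotZ])]
    congr 1
    funext k
    have hk : (k : ℕ) ≤ n := by omega
    simp only [rotZ, Matrix.of_apply, Matrix.cons_val', Matrix.cons_val_zero, Matrix.cons_val_one,
      Matrix.cons_val_fin_one]
    rw [← Complex.exp_nat_mul, ← Complex.exp_nat_mul, ← Complex.exp_add, Nat.cast_sub hk]
    congr 1
    ring
  have hinv : (rotZ t)⁻¹ = rotZ (-t) := by
    rw [inv_eq_iff_mul_eq_one]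
    apply Subtype.ext
    rw [Submonoid.coe_mul]
    ext i j
    fin_cases i <;> fin_cases j <;>
      simp [rotZ, Matrix.mul_apply, Fin.sum_univ_two, ← Complex.exp_add]
  ext a b
  rw [conjAct, hinv, hd, hd, Matrix.mul_diagonal, Matrix.diagonal_mul, Matrix.smul_apply,
    smul_eq_mul]
  by_cases h : coupledAux n l k a b = 0
  · simp [basisOp_apply, h]
  · have e : (((b : ℕ) : ℤ) : ℂ) = (((a : ℕ) : ℤ) + l - k : ℤ) :=
      congrArg _ (coupledAux_support h)
    push_cast at e
    rw [mul_right_comm, ← Complex.exp_add, e]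
    congr 2
    push_cast
    ring

/-! ### Legendre polynomials -/

-- The polynomial y = (X² - 1)^l satisfies (X² - 1)y' = 2lXy; differentiate this k + 1 times.
open Polynomial in
theorem rodrigues_ode (l k : ℕ) :
    (X ^ 2 - 1 : ℝ[X]) * derivative^[k + 2] ((X ^ 2 - 1) ^ l) +
      C (2 * ((k : ℝ) + 1 - l)) * X * derivative^[k + 1] ((X ^ 2 - 1) ^ l) +
      C (((k : ℝ) + 1) * (k - 2 * l)) * derivative^[k] ((X ^ 2 - 1) ^ l) = 0 := by
  have h0 : (X ^ 2 - 1 : ℝ[X]) * derivative ((X ^ 2 - 1) ^ l) =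
      C (2 * (l : ℝ)) * X * (X ^ 2 - 1) ^ l := by
    rcases Nat.eq_zero_or_pos l with h | h
    · subst h; simp
    · obtain ⟨j, rfl⟩ : ∃ j, l = j + 1 := ⟨l - 1, by omega⟩
      rw [derivative_pow]
      simp only [Nat.add_sub_cancel, derivative_sub, derivative_X_pow, derivative_one, map_mul,
        map_natCast, map_ofNat]
      push_cast
      ring
  induction k with
  | zero =>
    have h1 := congrArg derivative h0
    simp only [derivative_mul, derivative_sub, derivative_X_pow, derivative_one, derivative_C,
      derivative_X] at h1
    simp only [zero_add, Function.iterate_succ_apply', Function.iterate_zero_apply]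
    simp only [map_mul, map_add, map_sub, map_natCast, map_ofNat, map_one, Nat.cast_zero,
      map_zero, Nat.cast_ofNat] at h1 ⊢
    linear_combination h1
  | succ k ih =>
    have h1 := congrArg derivative ih
    simp only [derivative_mul, derivative_sub, derivative_X_pow, derivative_one, derivative_C,
      derivative_X, derivative_add, ← Function.iterate_succ_apply' derivative,
      derivative_zero] at h1
    simp only [map_mul, map_add, map_sub, map_natCast, map_ofNat, map_one,
      Nat.cast_ofNat, Nat.cast_add, Nat.cast_one] at h1 ⊢
    linear_combination h1

/-- The value of the `m`-th derivative of the Legendre polynomial `P_l`. -/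
def legendreD (l m : ℕ) (z : ℝ) : ℝ := (Polynomial.derivative^[m] (legendre l)).eval z

open Polynomial in
theorem iterate_derivative_legendre (l m : ℕ) : derivative^[m] (legendre l) =
    C (1 / (2 ^ l * (l.factorial : ℝ))) * derivative^[m + l] ((X ^ 2 - 1) ^ l) := by
  rw [legendre, iterate_derivative_C_mul, Function.iterate_add_apply]

open Polynomial in
theorem legendreD_ode (l m : ℕ) (z : ℝ) :
    (z ^ 2 - 1) * legendreD l (m + 2) z + 2 * (m + 1) * z * legendreD l (m + 1) z =
      ((l : ℝ) + m + 1) * (l - m) * legendreD l m z := by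
  have h := congrArg (eval z) (rodrigues_ode l (m + l))
  simp only [legendreD, iterate_derivative_legendre]
  simp only [eval_add, eval_mul, eval_sub, eval_pow, eval_X, eval_one, eval_C,
    eval_zero] at h ⊢
  rw [show m + 2 + l = m + l + 2 by ring, show m + 1 + l = m + l + 1 by ring]
  push_cast at h
  linear_combination (1 / (2 ^ l * (l.factorial : ℝ))) * h

open Polynomial in
theorem natDegree_rodrigues_le (l : ℕ) : ((X ^ 2 - 1 : ℝ[X]) ^ l).natDegree ≤ 2 * l := by
  refine natDegree_pow_le.trans ?_
  rw [mul_comm]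
  refine Nat.mul_le_mul_right l ?_
  refine (natDegree_sub_le _ _).trans ?_
  simp

open Polynomial in
theorem legendreD_of_lt {l m : ℕ} (h : l < m) (z : ℝ) : legendreD l m z = 0 := by
  rw [legendreD, iterate_derivative_legendre, iterate_derivative_eq_zero]
  · simp
  · have := natDegree_rodrigues_le l
    omega

theorem hasDerivAt_legendreD (l m : ℕ) (z : ℝ) :
    HasDerivAt (legendreD l m) (legendreD l (m + 1) z) z := by
  have := (Polynomial.derivative^[m] (legendre l)).hasDerivAt z
  rwa [← Function.iterate_succ_apply' Polynomial.derivative] at this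

-- Apply Leibniz to (X - 1)^l (X + 1)^l: at 1 only the term with all l derivatives on the first
-- factor survives, and it contributes l! 2^l.
open Polynomial in
theorem legendreD_zero_one (l : ℕ) : legendreD l 0 1 = 1 := by
  rw [legendreD, iterate_derivative_legendre, zero_add]
  have e : (X ^ 2 - 1 : ℝ[X]) ^ l = (X - C 1) ^ l * (X + 1) ^ l := by
    rw [← mul_pow, C_1]; ring
  rw [e, iterate_derivative_mul, eval_mul, eval_C, eval_finsetSum, Finset.sum_eq_single 0]
  · rw [Nat.sub_zero, iterate_derivative_X_sub_pow, Nat.sub_self, Nat.descFactorial_self]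
    simp
    norm_num
    field_simp
  · intro k hk hk0
    have := Finset.mem_range.1 hk
    rw [iterate_derivative_X_sub_pow, show l - (l - k) = k by omega]
    simp [hk0]
  · simp

/-! ### Spherical harmonics along a meridian -/

/-- The normalization of the spherical harmonics. -/
def harmNorm (l m : ℕ) : ℝ :=
  Real.sqrt (2 * l + 1) * Real.sqrt (((l - m).factorial : ℝ) / ((l + m).factorial : ℝ))

theorem harmNorm_succ {l m : ℕ} (h : m < l) :
    harmNorm l m = harmNorm l (m + 1) * Real.sqrt (((l : ℝ) - m) * (l + m + 1)) := by
  have e : Real.sqrt (((l - m).factorial : ℝ) / ((l + m).factorial : ℝ)) =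
      Real.sqrt (((l - (m + 1)).factorial : ℝ) / ((l + (m + 1)).factorial : ℝ)) *
        Real.sqrt (((l : ℝ) - m) * (l + m + 1)) := by
    rw [← Real.sqrt_mul (by positivity)]
    congr 1
    obtain ⟨j, rfl⟩ : ∃ j, l = m + 1 + j := ⟨l - (m + 1), by omega⟩
    rw [show m + 1 + j - m = j + 1 by omega, show m + 1 + j - (m + 1) = j by omega,
      show m + 1 + j + (m + 1) = (m + 1 + j + m) + 1 by ring, Nat.factorial_succ,
      Nat.factorial_succ]
    push_cast
    field_simp
    ring
  rw [harmNorm, harmNorm, e, mul_assoc]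

/-- The value of `Y_l^m` at the point `(sin θ, 0, cos θ)`, for `0 ≤ m`. -/
def harmAuxMeridian (l m : ℕ) (θ : ℝ) : ℝ :=
  harmNorm l m * ((-1) ^ m * legendreD l m (Real.cos θ)) * Real.sin θ ^ m

/-- The value of `Y_l^m` at the point `(sin θ, 0, cos θ)`. -/
def harmMeridian (l : ℕ) (m : ℤ) (θ : ℝ) : ℝ :=
  if 0 ≤ m then harmAuxMeridian l m.toNat θ
  else (-1) ^ (-m).toNat * harmAuxMeridian l (-m).toNat θ

theorem harmMeridian_natCast (l m : ℕ) (θ : ℝ) :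
    harmMeridian l m θ = harmAuxMeridian l m θ := by
  simp [harmMeridian]

theorem harmMeridian_neg (l m : ℕ) (θ : ℝ) :
    harmMeridian l (-(m : ℤ)) θ = (-1) ^ m * harmAuxMeridian l m θ := by
  rcases Nat.eq_zero_or_pos m with h | h
  · subst h; simp [harmMeridian]
  · rw [harmMeridian, if_neg (by omega)]
    simp

theorem hasDerivAt_harmAuxMeridian_zero (l : ℕ) (θ : ℝ) :
    HasDerivAt (harmAuxMeridian l 0)
      (Real.sqrt ((l : ℝ) * (l + 1)) * harmAuxMeridian l 1 θ) θ := by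
  have h1 := ((hasDerivAt_legendreD l 0 (Real.cos θ)).comp θ
    (Real.hasDerivAt_cos θ)).const_mul (harmNorm l 0)
  have e : harmAuxMeridian l 0 = fun t => harmNorm l 0 * (legendreD l 0 ∘ Real.cos) t := by
    funext t
    simp [harmAuxMeridian]
  rw [e]
  refine h1.congr_deriv ?_
  rcases Nat.eq_zero_or_pos l with h | h
  · subst h
    rw [legendreD_of_lt (by norm_num)]
    simp
  · rw [harmNorm_succ h, harmAuxMeridian]
    simp only [Nat.cast_zero, sub_zero, add_zero, zero_add, pow_one]
    ring

/-- Differentiation produces the order m + 2 and a cosine term with the order m + 1. The Legendre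
equation trades half of it for the order m, which gives the symmetric form needed to match a
commutator with J₋ - J₊. -/
theorem hasDerivAt_harmAuxMeridian_succ {l m : ℕ} (h : m + 1 ≤ l) (θ : ℝ) :
    HasDerivAt (harmAuxMeridian l (m + 1))
      ((Real.sqrt (((l : ℝ) - (m + 1)) * (l + (m + 1) + 1)) * harmAuxMeridian l (m + 2) θ -
        Real.sqrt (((l : ℝ) - m) * (l + m + 1)) * harmAuxMeridian l m θ) / 2) θ := by
  have h1 := (((hasDerivAt_legendreD l (m + 1) (Real.cos θ)).comp θ
    (Real.hasDerivAt_cos θ)).const_mul ((-1) ^ (m + 1))).const_mul (harmNorm l (m + 1))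
  have h2 := h1.mul ((Real.hasDerivAt_sin θ).pow (m + 1))
  refine HasDerivAt.congr_deriv (f := harmAuxMeridian l (m + 1)) h2 ?_
  have ode := legendreD_ode l m (Real.cos θ)
  have hsc := Real.sin_sq_add_cos_sq θ
  have hml : (m : ℝ) + 1 ≤ l := by exact_mod_cast h
  have hdown : harmNorm l m * Real.sqrt (((l : ℝ) - m) * (l + m + 1)) =
      harmNorm l (m + 1) * (((l : ℝ) - m) * (l + m + 1)) := by
    rw [harmNorm_succ (by omega), mul_assoc, Real.mul_self_sqrt]
    exact mul_nonneg (by linarith) (by positivity)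
  -- For `m + 1 = l` the normalization of order `m + 2` rests on truncated subtraction and means
  -- nothing, but the derivative of P_l that it multiplies is zero.
  have hup : harmNorm l (m + 2) * Real.sqrt (((l : ℝ) - (m + 1)) * (l + (m + 1) + 1)) *
      legendreD l (m + 2) (Real.cos θ) =
      harmNorm l (m + 1) * legendreD l (m + 2) (Real.cos θ) := by
    by_cases hl : m + 1 < l
    · rw [harmNorm_succ hl]
      push_cast
      ring
    · rw [legendreD_of_lt (by omega)]
      simp
  simp only [harmAuxMeridian, Function.comp_apply, Nat.add_sub_cancel, Pi.pow_apply]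
  push_cast
  set s := Real.sin θ
  set c := Real.cos θ
  set N := harmNorm l (m + 1)
  rw [show m + 1 + 1 = m + 2 by ring]
  linear_combination (-(-1 : ℝ) ^ m * s ^ (m + 2) / 2) * hup +
    ((-1 : ℝ) ^ m * s ^ m * legendreD l m c / 2) * hdown -
    (N * (-1 : ℝ) ^ m * s ^ m / 2) * ode +
    (N * (-1 : ℝ) ^ m * s ^ m / 2 * legendreD l (m + 2) c) * hsc

theorem hasDerivAt_harmMeridian {l : ℕ} {m : ℤ} (h : |m| ≤ l) (θ : ℝ) :
    HasDerivAt (harmMeridian l m)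
      ((Real.sqrt (((l : ℝ) - m) * (l + m + 1)) * harmMeridian l (m + 1) θ -
        Real.sqrt (((l : ℝ) + m) * (l - m + 1)) * harmMeridian l (m - 1) θ) / 2) θ := by
  rw [abs_le] at h
  have hpos : ∀ j : ℕ, harmMeridian l (j : ℤ) = harmAuxMeridian l j :=
    fun j => funext fun t => harmMeridian_natCast l j t
  have hneg : ∀ j : ℕ, harmMeridian l (-(j : ℤ)) = fun t => (-1) ^ j * harmAuxMeridian l j t :=
    fun j => funext fun t => harmMeridian_neg l j t
  rcases lt_trichotomy m 0 with hm | hm | hm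
  · obtain ⟨j, rfl⟩ : ∃ j : ℕ, m = -((j + 1 : ℕ) : ℤ) := ⟨(-m - 1).toNat, by omega⟩
    rw [show -((j + 1 : ℕ) : ℤ) + 1 = -(j : ℤ) by push_cast; ring,
      show -((j + 1 : ℕ) : ℤ) - 1 = -((j + 2 : ℕ) : ℤ) by push_cast; ring, hneg, hneg, hneg]
    refine HasDerivAt.congr_deriv
      ((hasDerivAt_harmAuxMeridian_succ (l := l) (m := j) (by omega) θ).const_mul _) ?_
    push_cast
    rw [show (l : ℝ) - -(j + 1) = l + j + 1 by ring,
      show (l : ℝ) + -(j + 1) + 1 = l - j by ring, show (l : ℝ) + -(j + 1) = l - (j + 1) by ring,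
      show (l : ℝ) + j + 1 + 1 = l + (j + 1) + 1 by ring,
      mul_comm (l + j + 1 : ℝ)]
    ring
  · subst hm
    rw [show (0 : ℤ) + 1 = ((1 : ℕ) : ℤ) by simp, show (0 : ℤ) - 1 = -((1 : ℕ) : ℤ) by simp,
      hneg, hpos, show (0 : ℤ) = ((0 : ℕ) : ℤ) by simp, hpos]
    refine HasDerivAt.congr_deriv (hasDerivAt_harmAuxMeridian_zero l θ) ?_
    simp
  · obtain ⟨j, rfl⟩ : ∃ j : ℕ, m = ((j + 1 : ℕ) : ℤ) := ⟨(m - 1).toNat, by omega⟩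
    rw [show ((j + 1 : ℕ) : ℤ) + 1 = ((j + 2 : ℕ) : ℤ) by push_cast; ring,
      show ((j + 1 : ℕ) : ℤ) - 1 = (j : ℤ) by push_cast; ring, hpos, hpos, hpos]
    refine HasDerivAt.congr_deriv
      (hasDerivAt_harmAuxMeridian_succ (l := l) (m := j) (by omega) θ) ?_
    push_cast
    rw [show (l : ℝ) - (j + 1) + 1 = l - j by ring, mul_comm (l + (j + 1) : ℝ) (l - j),
      show (l : ℝ) + (j + 1) = l + j + 1 by ring]

/-! ### Points of the sphere -/

/-- The point of the sphere with given Cartesian coordinates. -/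
def spherePoint (a b c : ℝ) (h : a ^ 2 + b ^ 2 + c ^ 2 = 1) : S2 :=
  ⟨!₂[a, b, c], by
    rw [mem_sphere_zero_iff_norm, EuclideanSpace.norm_eq, Real.sqrt_eq_one,
      Fin.sum_univ_three]
    simpa using h⟩

theorem coord_spherePoint (a b c : ℝ) (h : a ^ 2 + b ^ 2 + c ^ 2 = 1) :
    coord (spherePoint a b c h) 0 = a ∧ coord (spherePoint a b c h) 1 = b ∧
      coord (spherePoint a b c h) 2 = c := by
  simp [coord, spherePoint]

/-- The point with polar angle `θ` and azimuth `φ`. -/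
def polarPoint (θ φ : ℝ) : S2 :=
  spherePoint (Real.sin θ * Real.cos φ) (Real.sin θ * Real.sin φ) (Real.cos θ) (by
    nlinarith [Real.sin_sq_add_cos_sq θ, Real.sin_sq_add_cos_sq φ])

theorem coord_polarPoint (θ φ : ℝ) : coord (polarPoint θ φ) 0 = Real.sin θ * Real.cos φ ∧
    coord (polarPoint θ φ) 1 = Real.sin θ * Real.sin φ ∧
      coord (polarPoint θ φ) 2 = Real.cos θ := coord_spherePoint _ _ _ _

theorem S2.ext_coord {x y : S2} (h0 : coord x 0 = coord y 0) (h1 : coord x 1 = coord y 1)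
    (h2 : coord x 2 = coord y 2) : x = y := by
  apply Subtype.ext
  ext i
  fin_cases i
  · exact h0
  · exact h1
  · exact h2

theorem exists_polarPoint (x : S2) : ∃ θ φ, x = polarPoint θ φ := by
  have hsq := coord_sq x
  have h1 : -1 ≤ coord x 2 := by nlinarith [sq_nonneg (coord x 0), sq_nonneg (coord x 1)]
  have h2 : coord x 2 ≤ 1 := by nlinarith [sq_nonneg (coord x 0), sq_nonneg (coord x 1)]
  set w : ℂ := ⟨coord x 0, coord x 1⟩ with hw
  have hn : ‖w‖ = Real.sqrt (1 - coord x 2 ^ 2) := by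
    rw [Complex.norm_eq_sqrt_sq_add_sq]
    congr 1
    simp only [hw]
    linarith
  obtain ⟨c0, c1, c2⟩ := coord_polarPoint (Real.arccos (coord x 2)) w.arg
  refine ⟨Real.arccos (coord x 2), w.arg, S2.ext_coord ?_ ?_ ?_⟩
  · rw [c0, Real.sin_arccos, ← hn, Complex.norm_mul_cos_arg]
  · rw [c1, Real.sin_arccos, ← hn, Complex.norm_mul_sin_arg]
  · rw [c2, Real.cos_arccos h1 h2]

theorem rotates_rotY (t : ℝ) : Rotates (rotY t) northPole (polarPoint (2 * t) 0) := by
  rw [rotates_iff]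
  obtain ⟨a0, a1, a2⟩ := coord_northPole
  obtain ⟨c0, c1, c2⟩ := coord_polarPoint (2 * t) 0
  have hsc : (Real.cos t : ℂ) ^ 2 + (Real.sin t : ℂ) ^ 2 = 1 := by
    exact_mod_cast Real.cos_sq_add_sin_sq t
  have hc : (Real.cos (2 * t) : ℂ) = Real.cos t ^ 2 - (Real.sin t : ℂ) ^ 2 := by
    exact_mod_cast Real.cos_two_mul' t
  have hs : (Real.sin (2 * t) : ℂ) = 2 * Real.sin t * (Real.cos t : ℂ) := by
    exact_mod_cast Real.sin_two_mul t
  ext i j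
  fin_cases i <;> fin_cases j <;>
    simp only [Matrix.mul_apply, Fin.sum_univ_two, pauli, rotY, a0, a1, a2, c0, c1, c2,
      Matrix.of_apply, Matrix.cons_val', Matrix.cons_val_zero, Matrix.cons_val_one,
      Matrix.cons_val_fin_one, Fin.zero_eta, Fin.mk_one, Real.cos_zero, Real.sin_zero,
      mul_one, mul_zero, hc, hs, Complex.ofReal_zero, Complex.ofReal_one, sub_zero, add_zero,
      zero_add] <;>
    first
      | linear_combination (-(Real.cos t : ℂ)) * hsc
      | linear_combination ((Real.cos t : ℂ)) * hsc
      | linear_combination ((Real.sin t : ℂ)) * hsc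
      | linear_combination (-(Real.sin t : ℂ)) * hsc

theorem rotates_rotZ (t θ φ : ℝ) :
    Rotates (rotZ t) (polarPoint θ φ) (polarPoint θ (φ + 2 * t)) := by
  rw [rotates_iff]
  obtain ⟨a0, a1, a2⟩ := coord_polarPoint θ φ
  obtain ⟨c0, c1, c2⟩ := coord_polarPoint θ (φ + 2 * t)
  have e1 : ∀ ψ : ℝ, ((Real.sin θ * Real.cos ψ : ℝ) : ℂ) +
      Complex.I * ((Real.sin θ * Real.sin ψ : ℝ) : ℂ) =
      Real.sin θ * Complex.exp (ψ * Complex.I) := by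
    intro ψ
    rw [Complex.exp_mul_I]
    push_cast
    ring
  have e2 : ∀ ψ : ℝ, ((Real.sin θ * Real.cos ψ : ℝ) : ℂ) -
      Complex.I * ((Real.sin θ * Real.sin ψ : ℝ) : ℂ) =
      Real.sin θ * Complex.exp (-(ψ * Complex.I)) := by
    intro ψ
    rw [← neg_mul, Complex.exp_mul_I, Complex.cos_neg, Complex.sin_neg]
    push_cast
    ring
  have hm : ∀ a b : ℂ, (Real.sin θ : ℂ) * Complex.exp a * Complex.exp b =
      Real.sin θ * Complex.exp (a + b) := fun a b => by rw [Complex.exp_add]; ring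
  have hm' : ∀ a b : ℂ, Complex.exp b * ((Real.sin θ : ℂ) * Complex.exp a) =
      Real.sin θ * Complex.exp (a + b) := fun a b => by rw [Complex.exp_add]; ring
  ext i j
  fin_cases i <;> fin_cases j <;>
    simp only [Matrix.mul_apply, Fin.sum_univ_two, pauli, rotZ, a0, a1, a2, c0, c1, c2,
      Matrix.of_apply, Matrix.cons_val', Matrix.cons_val_zero, Matrix.cons_val_one,
      Matrix.cons_val_fin_one, Fin.zero_eta, Fin.mk_one, e1, e2, mul_zero, zero_mul, add_zero,
      zero_add, hm, hm']
  · ring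
  · congr 2; push_cast; ring
  · congr 2; push_cast; ring
  · ring

theorem sphHarm_polarPoint (l : ℕ) (m : ℤ) (θ φ : ℝ) : sphHarm l m (polarPoint θ φ) =
    (harmMeridian l m θ : ℂ) * Complex.exp (m * φ * Complex.I) := by
  obtain ⟨c0, c1, c2⟩ := coord_polarPoint θ φ
  have haux : ∀ j : ℕ, sphHarmAux l j (polarPoint θ φ) =
      (harmAuxMeridian l j θ : ℂ) * Complex.exp (j * φ * Complex.I) := by
    intro j
    have e1 : ((Real.sin θ * Real.cos φ : ℝ) : ℂ) +
        Complex.I * ((Real.sin θ * Real.sin φ : ℝ) : ℂ) =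
        Real.sin θ * Complex.exp (φ * Complex.I) := by
      rw [Complex.exp_mul_I]
      push_cast
      ring
    rw [sphHarmAux, c0, c1, c2, e1, mul_pow, ← Complex.exp_nat_mul, harmAuxMeridian, harmNorm,
      legendreD]
    push_cast
    rw [show (j : ℂ) * (φ * Complex.I) = j * φ * Complex.I by ring]
    ring
  rcases le_or_gt 0 m with hm | hm
  · obtain ⟨j, rfl⟩ := Int.eq_ofNat_of_zero_le hm
    rw [sphHarm, if_pos hm, harmMeridian_natCast, Int.toNat_natCast, haux]
    push_cast
    rfl
  · obtain ⟨j, rfl⟩ : ∃ j : ℕ, m = -(j : ℤ) := ⟨(-m).toNat, by omega⟩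
    rw [sphHarm, if_neg (by omega), harmMeridian_neg, neg_neg, Int.toNat_natCast, haux, map_mul,
      ← Complex.exp_conj, Complex.conj_ofReal]
    simp only [map_mul, Complex.conj_ofReal, Complex.conj_I, Complex.conj_natCast]
    push_cast
    rw [show -(j : ℂ) * φ * Complex.I = j * φ * -Complex.I by ring]
    ring

/-! ### The operator-valued spherical harmonics -/

theorem sphHarm_neg (l : ℕ) (m : ℤ) (x : S2) :
    conj (sphHarm l (-m) x) = (-1) ^ m.natAbs * sphHarm l m x := by
  rcases lt_trichotomy m 0 with h | h | h
  · rw [sphHarm, if_pos (by omega), sphHarm, if_neg (by omega), ← mul_assoc,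
      show (-m).toNat = m.natAbs by omega, ← mul_pow]
    simp
  · subst h
    simp [sphHarm, sphHarmAux]
  · rw [sphHarm, if_neg (by omega), sphHarm, if_pos (by omega), neg_neg,
      show m.toNat = m.natAbs by omega]
    simp

theorem sphHarm_northPole (l : ℕ) (m : ℤ) :
    sphHarm l m northPole = if m = 0 then (Real.sqrt (2 * l + 1) : ℂ) else 0 := by
  obtain ⟨c0, c1, c2⟩ := coord_northPole
  have haux : ∀ j : ℕ, sphHarmAux l j northPole =
      if j = 0 then (Real.sqrt (2 * l + 1) : ℂ) else 0 := by
    intro j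
    rw [sphHarmAux, c0, c1]
    split_ifs with h
    · subst h
      have := legendreD_zero_one l
      rw [legendreD] at this
      rw [c2, this]
      have hf : (l.factorial : ℝ) ≠ 0 := by positivity
      simp [div_self hf]
    · simp [h]
  rw [sphHarm]
  split_ifs with h1 h2 h2
  · rw [h2, haux]; simp
  · rw [haux, if_neg (by omega)]
  · omega
  · rw [haux, if_neg (by omega)]; simp

theorem sphHarm_zero_right (l : ℕ) (x : S2) : sphHarm l 0 x =
    ((Real.sqrt (2 * l + 1) * (legendre l).eval (coord x 2) : ℝ) : ℂ) := by
  have hf : (l.factorial : ℝ) ≠ 0 := by positivity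
  simp [sphHarm, sphHarmAux, div_self hf]

/-- The operator `∑ₘ conj (Y_l^m(x)) e^j(l, m)`. -/
def harmOp (n l : ℕ) (x : S2) : Op n :=
  ∑ k ∈ Finset.range (2 * l + 1), conj (sphHarm l ((l : ℤ) - k) x) • basisOp n l k

theorem harmOp_northPole (l : ℕ) :
    harmOp n l northPole = (Real.sqrt (2 * l + 1) : ℂ) • basisOp n l l := by
  rw [harmOp, Finset.sum_eq_single l]
  · rw [sub_self, sphHarm_northPole, if_pos rfl, Complex.conj_ofReal]
  · intro k _ hk
    rw [sphHarm_northPole, if_neg (by omega)]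
    simp
  · intro h
    exact absurd (Finset.mem_range.2 (by omega)) h

/-- The restriction of `harmOp` to a meridian, as a real matrix. -/
def harmOpMeridian (n l : ℕ) (θ : ℝ) : Matrix (Fin (n + 1)) (Fin (n + 1)) ℝ :=
  ∑ k ∈ Finset.range (2 * l + 1), harmMeridian l ((l : ℤ) - k) θ • coupledAux n l k

theorem harmOp_polarPoint_zero (l : ℕ) (θ : ℝ) :
    harmOp n l (polarPoint θ 0) = (harmOpMeridian n l θ).map Complex.ofReal := by
  ext a b
  rw [harmOp, harmOpMeridian, Matrix.map_apply, Matrix.sum_apply, Matrix.sum_apply,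
    Complex.ofReal_sum]
  refine Finset.sum_congr rfl fun k _ => ?_
  rw [sphHarm_polarPoint]
  simp [basisOp_apply]

theorem harmOp_polarPoint (l : ℕ) (θ φ : ℝ) :
    harmOp n l (polarPoint θ φ) = conjAct n (rotZ (φ / 2)) (harmOp n l (polarPoint θ 0)) := by
  rw [harmOp, harmOp, conjAct_sum]
  refine Finset.sum_congr rfl fun k _ => ?_
  rw [conjAct_smul, conjAct_rotZ_basisOp, smul_smul, sphHarm_polarPoint, sphHarm_polarPoint]
  congr 1
  simp only [map_mul, Complex.conj_ofReal, ← Complex.exp_conj, Complex.conj_I, map_intCast]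
  rw [Complex.ofReal_zero, mul_zero, zero_mul, Complex.exp_zero, mul_one]
  congr 2
  push_cast
  ring

/-- Summation by parts on the ladder. No boundary terms appear, since ad J₊ kills the top and the
step at the bottom is zero. -/
theorem Jminus_commutator_sum (l : ℕ) (y : ℕ → ℝ) :
    (Jminus n - Jplus n) * (∑ k ∈ Finset.range (2 * l + 1), y k • coupledAux n l k) -
      (∑ k ∈ Finset.range (2 * l + 1), y k • coupledAux n l k) * (Jminus n - Jplus n) =
    ∑ k ∈ Finset.range (2 * l + 1), ((if k = 0 then 0 else step l (k - 1) * y (k - 1)) -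
      step l k * y (k + 1)) • coupledAux n l k := by
  have e1 : ∑ k ∈ Finset.range (2 * l + 1),
      (if k = 0 then 0 else step l (k - 1) * y (k - 1)) • coupledAux n l k =
      ∑ k ∈ Finset.range (2 * l + 1), y k •
        (Jminus n * coupledAux n l k - coupledAux n l k * Jminus n) := by
    rw [Finset.sum_range_succ', if_pos rfl, zero_smul, add_zero, Finset.sum_range_succ,
      Jminus_commutator, step_eq_zero le_rfl, zero_smul, smul_zero, add_zero]
    refine Finset.sum_congr rfl fun k _ => ?_
    rw [if_neg (by omega), Nat.add_sub_cancel, Jminus_commutator, smul_smul, mul_comm]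
  have e2 : ∑ k ∈ Finset.range (2 * l + 1), (step l k * y (k + 1)) • coupledAux n l k =
      ∑ k ∈ Finset.range (2 * l + 1), y k •
        (Jplus n * coupledAux n l k - coupledAux n l k * Jplus n) := by
    rw [Finset.sum_range_succ, step_eq_zero le_rfl, zero_mul, zero_smul, add_zero,
      Finset.sum_range_succ', Jplus_commutator_zero, smul_zero, add_zero]
    refine Finset.sum_congr rfl fun k _ => ?_
    rw [Jplus_commutator_succ, smul_smul, mul_comm]
  simp only [sub_smul, Finset.sum_sub_distrib]
  rw [e1, e2, Matrix.mul_sum, Matrix.sum_mul, ← Finset.sum_sub_distrib, ← Finset.sum_sub_distrib]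
  refine Finset.sum_congr rfl fun k _ => ?_
  rw [Matrix.mul_smul, Matrix.smul_mul, ← smul_sub, ← smul_sub]
  congr 1
  noncomm_ring

/-- With m = l - k the coefficients in `hasDerivAt_harmMeridian` are the step factors of
`Jminus_commutator_sum`. The factor 2 from the doubled angle cancels the division by 2 there. -/
theorem hasDerivAt_harmOpMeridian (l : ℕ) (t : ℝ) (a b : Fin (n + 1)) :
    HasDerivAt (fun s => harmOpMeridian n l (2 * s) a b)
      (((Jminus n - Jplus n) * harmOpMeridian n l (2 * t) -
        harmOpMeridian n l (2 * t) * (Jminus n - Jplus n)) a b) t := by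
  rw [harmOpMeridian, Jminus_commutator_sum l fun k => harmMeridian l ((l : ℤ) - k) (2 * t)]
  simp only [harmOpMeridian, Matrix.sum_apply, Matrix.smul_apply, smul_eq_mul]
  refine HasDerivAt.fun_sum fun k hk => HasDerivAt.mul_const ?_ _
  have hk := Finset.mem_range.1 hk
  have h1 := (hasDerivAt_harmMeridian (l := l) (m := (l : ℤ) - k)
    (by rw [abs_le]; omega) (2 * t)).comp t ((hasDerivAt_id t).const_mul 2)
  refine h1.congr_deriv ?_
  push_cast
  have e1 : Real.sqrt (((l : ℝ) - (l - k)) * (l + (l - k) + 1)) *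
      harmMeridian l ((l : ℤ) - k + 1) (2 * t) =
      if k = 0 then 0 else step l (k - 1) * harmMeridian l ((l : ℤ) - (k - 1 : ℕ)) (2 * t) := by
    split_ifs with h
    · subst h; simp
    · rw [step, Nat.cast_sub (by omega), Nat.cast_sub (by omega)]
      push_cast
      rw [show (l : ℤ) - (k - 1) = l - k + 1 by ring]
      congr 2
      ring
  have e2 : Real.sqrt (((l : ℝ) + (l - k)) * (l - (l - k) + 1)) *
      harmMeridian l ((l : ℤ) - k - 1) (2 * t) =
      step l k * harmMeridian l ((l : ℤ) - (k + 1)) (2 * t) := by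
    rw [step, show (l : ℤ) - (k + 1) = l - k - 1 by ring]
    congr 2
    ring
  rw [e1, e2]
  ring

/-- Both sides solve M' = [J₋ - J₊, M] with the same initial value. Conjugating the left side back
by the representation gives entries with zero derivative, hence constants. -/
theorem harmOp_meridian_eq (l : ℕ) (t : ℝ) : harmOp n l (polarPoint (2 * t) 0) =
    conjAct n (rotY t) (harmOp n l northPole) := by
  have hF : ∀ s, HasMatDerivAt (fun s => harmOp n l (polarPoint (2 * s) 0))
      (genY n * harmOp n l (polarPoint (2 * s) 0) -
        harmOp n l (polarPoint (2 * s) 0) * genY n) s := by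
    intro s a b
    simp only [harmOp_polarPoint_zero, Matrix.map_apply]
    have := (hasDerivAt_harmOpMeridian (n := n) l s a b).ofReal_comp
    refine this.congr_deriv ?_
    rw [genY, ← map_ofReal_mul, ← map_ofReal_mul, Matrix.sub_apply, Matrix.sub_apply,
      Complex.ofReal_sub]
    rfl
  have hG : ∀ s, HasMatDerivAt (fun s => spinRep n (rotY s)⁻¹ *
      harmOp n l (polarPoint (2 * s) 0) * spinRep n (rotY s)) 0 s := by
    intro s
    have := ((hasMatDerivAt_spinRep_rotY_inv (n := n) s).mul (hF s)).mul
      (hasMatDerivAt_spinRep_rotY s)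
    convert this using 1
    noncomm_ring
  have hconst : spinRep n (rotY t)⁻¹ * harmOp n l (polarPoint (2 * t) 0) * spinRep n (rotY t) =
      harmOp n l northPole := by
    have e0 : polarPoint (2 * 0) 0 = northPole := by
      have h := rotates_rotY 0
      rw [rotY_zero] at h
      refine h.unique ?_
      rw [rotates_iff]
      simp
    have e1 : spinRep n (rotY 0)⁻¹ * harmOp n l (polarPoint (2 * 0) 0) * spinRep n (rotY 0) =
        harmOp n l northPole := by
      rw [e0, rotY_zero, inv_one, spinRep_one, one_mul, mul_one]
    rw [← e1]
    ext a b
    exact is_const_of_deriv_eq_zero (fun s => (hG s a b).differentiableAt)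
      (fun s => (hG s a b).deriv) t 0
  rw [← hconst, conjAct]
  simp only [← mul_assoc]
  rw [spinRep_mul_inv, one_mul, mul_assoc, spinRep_mul_inv, mul_one]

theorem basisOp_self_eq_diagonal (l : ℕ) :
    basisOp n l l = Matrix.diagonal fun a => basisOp n l l a a := by
  ext a b
  by_cases h : a = b
  · subst h; simp
  · rw [Matrix.diagonal_apply_ne _ h, basisOp_apply, coupledAux_apply_of_ne]
    · simp
    · intro e
      exact h (Fin.ext (by omega))

/-- A product of a rotation about the second axis and one about the third reaches any point. Any
other g with the same image gives the same operator, because the value at the pole is diagonal. -/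
theorem harmOp_of_rotates_northPole {g : SU2} {x : S2} (h : Rotates g northPole x) (l : ℕ) :
    harmOp n l x = conjAct n g (harmOp n l northPole) := by
  obtain ⟨θ, φ, rfl⟩ := exists_polarPoint x
  have h1 := (rotates_rotY (θ / 2)).mul (rotates_rotZ (φ / 2) (2 * (θ / 2)) 0)
  rw [show 2 * (θ / 2) = θ by ring, show 0 + 2 * (φ / 2) = φ by ring] at h1
  have h2 := harmOp_meridian_eq (n := n) l (θ / 2)
  rw [show 2 * (θ / 2) = θ by ring] at h2
  rw [harmOp_polarPoint, h2, ← conjAct_mul, harmOp_northPole, conjAct_smul, conjAct_smul,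
    basisOp_self_eq_diagonal, conjAct_diagonal_eq h1 h]

theorem harmOp_of_rotates {g : SU2} {x y : S2} (h : Rotates g x y) (l : ℕ) :
    harmOp n l y = conjAct n g (harmOp n l x) := by
  obtain ⟨g₀, h₀⟩ := exists_rotates x
  rw [harmOp_of_rotates_northPole (h₀.mul h), harmOp_of_rotates_northPole h₀, conjAct_mul]

theorem conjAct_basisOp_mid {g : SU2} {x : S2} (h : Rotates g northPole x) (l : ℕ) :
    conjAct n g (basisOp n l l) = ((Real.sqrt (2 * l + 1))⁻¹ : ℂ) • harmOp n l x := by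
  have h0 : (Real.sqrt (2 * l + 1) : ℂ) ≠ 0 := by
    exact_mod_cast (Real.sqrt_pos.2 (by positivity)).ne'
  rw [harmOp_of_rotates_northPole h, harmOp_northPole, conjAct_smul, smul_smul,
    inv_mul_cancel₀ h0, one_smul]

theorem transpose_basisOp {l k : ℕ} (hl : l ≤ n) (hk : k ≤ 2 * l) :
    (basisOp n l k).transpose = ((-1 : ℂ) ^ l * (-1) ^ k) • basisOp n l (2 * l - k) := by
  have h := transpose_coupledAux (n := n) hl (show 2 * l - k ≤ 2 * l by omega)
  rw [show 2 * l - (2 * l - k) = k by omega] at h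
  rw [basisOp, ← Matrix.transpose_map, h]
  ext a b
  have e : (-1 : ℝ) ^ (2 * l - k) = (-1) ^ k := by
    have : (-1 : ℝ) ^ (2 * l - k) * (-1) ^ k = 1 := by
      rw [← pow_add, show 2 * l - k + k = 2 * l by omega, pow_mul]; simp
    have h2 : (-1 : ℝ) ^ k * (-1) ^ k = 1 := by rw [← mul_pow]; simp
    linear_combination (-1) ^ k * this - (-1) ^ (2 * l - k) * h2
  rw [Matrix.map_apply, Matrix.smul_apply, Matrix.smul_apply, basisOp_apply, e]
  simp

/-- Under m ↦ -m, the sign relating conj(Y_l^{-m}) to Y_l^m and the sign from transposing e(l,m) are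
equal and cancel. Having both expansions makes F_l Hermitian and lets traces produce Y_l^m as well
as its conjugate. -/
theorem harmOp_eq_transpose {l : ℕ} (hl : l ≤ n) (x : S2) : harmOp n l x =
    ∑ k ∈ Finset.range (2 * l + 1),
      sphHarm l ((l : ℤ) - k) x • (basisOp n l k).transpose := by
  rw [harmOp, ← Finset.sum_range_reflect]
  refine Finset.sum_congr rfl fun k hk => ?_
  have hk := Finset.mem_range.1 hk
  rw [transpose_basisOp hl (by omega), smul_smul, show 2 * l + 1 - 1 - k = 2 * l - k by omega,
    Nat.cast_sub (by omega)]
  congr 1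
  rw [show (l : ℤ) - ((2 * l : ℕ) - k) = -((l : ℤ) - k) by push_cast; ring, sphHarm_neg,
    mul_comm]
  congr 1
  rw [← pow_add]
  rcases le_total l k with h | h
  · rw [show l + k = 2 * l + ((l : ℤ) - k).natAbs by omega, pow_add, pow_mul]
    simp
  · rw [show l + k = 2 * k + ((l : ℤ) - k).natAbs by omega, pow_add, pow_mul]
    simp

theorem conjTranspose_harmOp {l : ℕ} (hl : l ≤ n) (x : S2) :
    (harmOp n l x).conjTranspose = harmOp n l x := by
  conv_rhs => rw [harmOp_eq_transpose hl]
  rw [harmOp, Matrix.conjTranspose_sum]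
  refine Finset.sum_congr rfl fun k _ => ?_
  ext a b
  simp [Matrix.conjTranspose_apply, basisOp_apply]

/-! ### The addition theorem -/

theorem SU2_entries (g : SU2) :
    (g : Matrix (Fin 2) (Fin 2) ℂ) 0 1 = -conj ((g : Matrix (Fin 2) (Fin 2) ℂ) 1 0) ∧
    (g : Matrix (Fin 2) (Fin 2) ℂ) 1 1 = conj ((g : Matrix (Fin 2) (Fin 2) ℂ) 0 0) ∧
    (g : Matrix (Fin 2) (Fin 2) ℂ) 0 0 * conj ((g : Matrix (Fin 2) (Fin 2) ℂ) 0 0) +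
      (g : Matrix (Fin 2) (Fin 2) ℂ) 1 0 * conj ((g : Matrix (Fin 2) (Fin 2) ℂ) 1 0) = 1 := by
  have hdet := (Matrix.mem_specialUnitaryGroup_iff.1 g.2).2
  rw [Matrix.det_fin_two] at hdet
  have hu := coe_inv_mul_coe g
  rw [coe_inv_SU2] at hu
  have h00 := congrFun (congrFun hu 0) 0
  have h01 := congrFun (congrFun hu 0) 1
  simp only [Matrix.mul_apply, Fin.sum_univ_two, Matrix.star_apply, RCLike.star_def,
    Matrix.one_apply_eq, Matrix.one_apply_ne (zero_ne_one)] at h00 h01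
  set a := (g : Matrix (Fin 2) (Fin 2) ℂ) 0 0
  set b := (g : Matrix (Fin 2) (Fin 2) ℂ) 0 1
  set c := (g : Matrix (Fin 2) (Fin 2) ℂ) 1 0
  set d := (g : Matrix (Fin 2) (Fin 2) ℂ) 1 1
  refine ⟨?_, ?_, ?_⟩
  · linear_combination -b * h00 + a * h01 - conj c * hdet
  · linear_combination -d * h00 + c * h01 + conj a * hdet
  · linear_combination h00

/-- The image is the Hopf point of the first column (a, c) of g: x + iy = 2c conj(a) and z = |a|² -
|c|². -/
theorem exists_rotates_northPole (g : SU2) : ∃ y, Rotates g northPole y := by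
  obtain ⟨hb, hd, hn⟩ := SU2_entries g
  obtain ⟨a0, a1, a2⟩ := coord_northPole
  set a := (g : Matrix (Fin 2) (Fin 2) ℂ) 0 0 with ha
  set c := (g : Matrix (Fin 2) (Fin 2) ℂ) 1 0 with hc
  have hnr : Complex.normSq a + Complex.normSq c = 1 := by
    rw [Complex.mul_conj, Complex.mul_conj] at hn
    exact_mod_cast hn
  have hsq : (2 * (c * conj a).re) ^ 2 + (2 * (c * conj a).im) ^ 2 +
      (Complex.normSq a - Complex.normSq c) ^ 2 = 1 := by
    have : (c * conj a).re ^ 2 + (c * conj a).im ^ 2 = Complex.normSq c * Complex.normSq a := by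
      rw [← Complex.normSq_conj a, ← Complex.normSq_mul, Complex.normSq_apply]
      ring
    linear_combination 4 * this + (Complex.normSq a + Complex.normSq c + 1) * hnr
  refine ⟨spherePoint _ _ _ hsq, ?_⟩
  obtain ⟨c0, c1, c2⟩ := coord_spherePoint _ _ _ hsq
  have e1 : ((2 * (c * conj a).re : ℝ) : ℂ) + Complex.I * ((2 * (c * conj a).im : ℝ) : ℂ) =
      2 * (c * conj a) := by
    conv_rhs => rw [← Complex.re_add_im (c * conj a)]
    push_cast
    ring
  have e2 : ((2 * (c * conj a).re : ℝ) : ℂ) - Complex.I * ((2 * (c * conj a).im : ℝ) : ℂ) =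
      2 * (conj c * a) := by
    have := congrArg conj e1
    simp only [map_add, map_mul, Complex.conj_ofReal, Complex.conj_I, Complex.conj_conj,
      map_ofNat] at this
    linear_combination this
  have e3 : ((Complex.normSq a - Complex.normSq c : ℝ) : ℂ) = a * conj a - c * conj c := by
    rw [Complex.mul_conj, Complex.mul_conj]
    push_cast
    ring
  rw [rotates_iff]
  ext i j
  fin_cases i <;> fin_cases j <;>
    simp only [Matrix.mul_apply, Fin.sum_univ_two, pauli, a0, a1, a2, c0, c1, c2, e1, e2, e3,
      Matrix.of_apply, Matrix.cons_val', Matrix.cons_val_zero, Matrix.cons_val_one,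
      Matrix.cons_val_fin_one, Fin.zero_eta, Fin.mk_one, hb, hd, ← ha, ← hc,
      Complex.ofReal_zero, Complex.ofReal_one]
  · linear_combination -a * hn
  · linear_combination -conj c * hn
  · linear_combination -c * hn
  · linear_combination conj a * hn

theorem exists_rotates_of (g : SU2) (x : S2) : ∃ y, Rotates g x y := by
  obtain ⟨h, hh⟩ := exists_rotates x
  obtain ⟨y, hy⟩ := exists_rotates_northPole (g * h)
  refine ⟨y, ?_⟩
  have := hh.inv.mul hy
  rwa [mul_inv_cancel_right] at this

theorem dot_eq (x y : S2) :
    dot x y = coord x 0 * coord y 0 + coord x 1 * coord y 1 + coord x 2 * coord y 2 := by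
  rw [dot, PiLp.inner_apply, Fin.sum_univ_three]
  simp only [RCLike.inner_apply, conj_trivial, coord]
  ring

theorem trace_pauli_mul (x y : S2) : Matrix.trace (pauli x * pauli y) = 2 * (dot x y : ℂ) := by
  rw [dot_eq, Matrix.trace_fin_two, Matrix.mul_apply, Matrix.mul_apply, Fin.sum_univ_two,
    Fin.sum_univ_two]
  simp only [pauli, Matrix.of_apply, Matrix.cons_val', Matrix.cons_val_zero, Matrix.cons_val_one,
    Matrix.cons_val_fin_one]
  push_cast
  linear_combination (-2 * (coord x 1 : ℂ) * coord y 1) * Complex.I_sq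

theorem dot_of_rotates {g : SU2} {x y x' y' : S2} (hx : Rotates g x x') (hy : Rotates g y y') :
    dot x' y' = dot x y := by
  have h : (2 * (dot x' y' : ℂ)) = 2 * (dot x y : ℂ) := by
    rw [← trace_pauli_mul, ← trace_pauli_mul, ← show _ = pauli x' from hx,
      ← show _ = pauli y' from hy]
    have e : (g : Matrix (Fin 2) (Fin 2) ℂ) * pauli x * ((g⁻¹ : SU2) : Matrix (Fin 2) (Fin 2) ℂ) *
        (g * pauli y * ((g⁻¹ : SU2) : Matrix (Fin 2) (Fin 2) ℂ)) =
        g * (pauli x * ((((g⁻¹ : SU2) : Matrix (Fin 2) (Fin 2) ℂ) * g) * pauli y) *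
          ((g⁻¹ : SU2) : Matrix (Fin 2) (Fin 2) ℂ)) := by
      simp only [mul_assoc]
    rw [e, coe_inv_mul_coe, one_mul, Matrix.trace_mul_comm, mul_assoc, coe_inv_mul_coe, mul_one]
  have h2 : (2 : ℂ) ≠ 0 := two_ne_zero
  exact_mod_cast mul_left_cancel₀ h2 h

theorem trace_harmOp_mul {l : ℕ} (hl : l ≤ n) (x y : S2) :
    Matrix.trace (harmOp n l x * harmOp n l y) = ∑ k ∈ Finset.range (2 * l + 1),
      sphHarm l ((l : ℤ) - k) x * conj (sphHarm l ((l : ℤ) - k) y) := by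
  rw [harmOp_eq_transpose hl x, harmOp, Matrix.sum_mul, Matrix.trace_sum]
  refine Finset.sum_congr rfl fun k hk => ?_
  have hk := Finset.mem_range.1 hk
  rw [Matrix.mul_sum, Matrix.trace_sum, Finset.sum_eq_single k]
  · rw [Matrix.smul_mul, Matrix.mul_smul, Matrix.trace_smul, Matrix.trace_smul,
      trace_basisOp_transpose_mul hl (by omega) (by omega), if_pos ⟨rfl, rfl⟩]
    simp
  · intro k' hk' hne
    have hk' := Finset.mem_range.1 hk'
    rw [Matrix.smul_mul, Matrix.mul_smul, Matrix.trace_smul, Matrix.trace_smul,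
      trace_basisOp_transpose_mul hl (by omega) (by omega), if_neg (fun h => hne h.2.symm)]
    simp
  · intro h
    exact absurd (Finset.mem_range.2 hk) h

/-- The sum is tr(F_l(x) F_l(y)), taken with `n = l`, which is invariant under simultaneous
rotation. Rotating y to the pole leaves only the term m = 0. -/
theorem addition_theorem (l : ℕ) (x y : S2) : ∑ k ∈ Finset.range (2 * l + 1),
    sphHarm l ((l : ℤ) - k) x * conj (sphHarm l ((l : ℤ) - k) y) =
      (((2 * l + 1) * (legendre l).eval (dot x y) : ℝ) : ℂ) := by
  obtain ⟨g, hg⟩ := exists_rotates y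
  obtain ⟨x', hx'⟩ := exists_rotates_of g⁻¹ x
  have hx : Rotates g x' x := by simpa using hx'.inv
  rw [← trace_harmOp_mul (n := l) le_rfl, harmOp_of_rotates hx, harmOp_of_rotates hg,
    ← conjAct_mul_right, trace_conjAct, trace_harmOp_mul le_rfl, dot_of_rotates hx hg]
  obtain ⟨a0, a1, a2⟩ := coord_northPole
  have hd : dot x' northPole = coord x' 2 := by rw [dot_eq, a0, a1, a2]; ring
  rw [Finset.sum_eq_single l]
  · rw [sub_self, sphHarm_northPole, if_pos rfl, Complex.conj_ofReal, sphHarm_zero_right, hd,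
      ← Complex.ofReal_mul]
    congr 1
    have := Real.mul_self_sqrt (by positivity : (0 : ℝ) ≤ 2 * l + 1)
    linear_combination (Polynomial.eval (coord x' 2) (legendre l)) * this
  · intro k _ hk
    rw [sphHarm_northPole, if_neg (by omega)]
    simp
  · intro h
    exact absurd (Finset.mem_range.2 (by omega)) h

/-! ### The rotation invariant measure -/

instance : IsFiniteMeasure area := by unfold area; infer_instance

theorem area_real_univ : area.real Set.univ = 4 * Real.pi := by
  rw [area, Measure.toSphere_real_apply_univ, Measure.real, EuclideanSpace.volume_ball_fin_three]
  simp only [ENNReal.ofReal_one, one_pow, one_mul, finrank_euclideanSpace, Fintype.card_fin]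
  rw [ENNReal.toReal_ofReal (by positivity)]
  push_cast
  ring

open scoped Pointwise in
theorem area_apply {s : Set S2} (hs : MeasurableSet s) :
    area s = 3 * volume (Set.Ioo (0 : ℝ) 1 •
      (Subtype.val '' s : Set (EuclideanSpace ℝ (Fin 3)))) := by
  rw [area, Measure.toSphere_apply' _ hs]
  simp

/-- Surface measure is three times the volume of the cone over a set, and a linear isometry maps
cones to cones preserving volume. -/
theorem measurePreserving_of_isometry (L : EuclideanSpace ℝ (Fin 3) ≃ₗᵢ[ℝ] EuclideanSpace ℝ (Fin 3))
    (r : S2 → S2) (h : ∀ x, (r x : EuclideanSpace ℝ (Fin 3)) = L x) :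
    MeasurePreserving r area area := by
  have hr : Continuous r := by
    rw [continuous_induced_rng]
    exact (L.continuous.comp continuous_subtype_val).congr fun x => (h x).symm
  refine ⟨hr.measurable, ?_⟩
  ext s hs
  rw [Measure.map_apply hr.measurable hs, area_apply (hr.measurable hs), area_apply hs]
  congr 1
  conv_rhs => rw [← L.measurePreserving.measure_preimage_emb L.toHomeomorph.measurableEmbedding]
  congr 1
  ext v
  simp only [Set.mem_smul, Set.mem_image, Set.mem_preimage]
  constructor
  · rintro ⟨t, ht, _, ⟨x, hx, rfl⟩, rfl⟩
    refine ⟨t, ht, r x, ⟨r x, hx, rfl⟩, ?_⟩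
    rw [h]
    exact (L.map_smul t _).symm
  · rintro ⟨t, ht, _, ⟨x, hx, rfl⟩, hv⟩
    have hn : ‖L.symm (x : EuclideanSpace ℝ (Fin 3))‖ = 1 := by
      rw [LinearIsometryEquiv.norm_map]; simp
    have hrx : r ⟨L.symm x, mem_sphere_zero_iff_norm.2 hn⟩ = x := by
      apply Subtype.ext
      rw [h]
      simp
    refine ⟨t, ht, L.symm x, ⟨⟨L.symm x, mem_sphere_zero_iff_norm.2 hn⟩, ?_, rfl⟩, ?_⟩
    · rw [hrx]; exact hx
    · rw [← L.symm.map_smul, hv]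
      exact L.symm_apply_apply v

/-- The rotation of the sphere by an element of `SU(2)`. -/
def rotate (g : SU2) (x : S2) : S2 := (exists_rotates_of g x).choose

theorem rotates_rotate (g : SU2) (x : S2) : Rotates g x (rotate g x) :=
  (exists_rotates_of g x).choose_spec

/-- The standard unit vectors as points of the sphere. -/
def axisPoint (i : Fin 3) : S2 := ⟨EuclideanSpace.single i 1, by simp⟩

theorem dot_rotate (g : SU2) (x y : S2) : dot (rotate g x) (rotate g y) = dot x y :=
  dot_of_rotates (rotates_rotate g x) (rotates_rotate g y)

/-- A rotation preserves inner products, so it sends the coordinate axes to an orthonormal basis.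
The linear isometry with the same effect on the axes agrees with it at every point, as inner
products with that basis show. -/
theorem measurePreserving_rotate (g : SU2) : MeasurePreserving (rotate g) area area := by
  have hon : Orthonormal ℝ fun i => (rotate g (axisPoint i) : EuclideanSpace ℝ (Fin 3)) := by
    rw [orthonormal_iff_ite]
    intro i j
    have := dot_rotate g (axisPoint i) (axisPoint j)
    rw [dot, dot] at this
    rw [this]
    rw [axisPoint, axisPoint, EuclideanSpace.inner_single_left]
    simp
  have hspan := hon.linearIndependent.span_eq_top_of_card_eq_finrank (by simp)
  set b := OrthonormalBasis.mk hon hspan.ge with hb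
  have hbi : ∀ i, b i = (rotate g (axisPoint i) : EuclideanSpace ℝ (Fin 3)) := fun i => by
    rw [hb, OrthonormalBasis.coe_mk]
  set L := (EuclideanSpace.basisFun (Fin 3) ℝ).equiv b (Equiv.refl _) with hL
  have hLi : ∀ i, L (EuclideanSpace.single i 1) = b i := fun i => by
    have := OrthonormalBasis.equiv_apply_basis (EuclideanSpace.basisFun (Fin 3) ℝ) b
      (Equiv.refl _) i
    simpa using this
  refine measurePreserving_of_isometry L _ fun x => ?_
  refine InnerProductSpace.ext_inner_left_basis b.toBasis fun i => ?_
  rw [OrthonormalBasis.coe_toBasis]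
  rw [← hLi, LinearIsometryEquiv.inner_map_map, hLi, hbi]
  exact dot_rotate g (axisPoint i) x

theorem integral_rotate (g : SU2) {f : S2 → ℂ} (hf : Continuous f) :
    ∫ x, f (rotate g x) ∂area = ∫ x, f x ∂area := by
  have h := measurePreserving_rotate g
  have := integral_map (μ := area) h.measurable.aemeasurable (f := f)
    (by rw [h.map_eq]; exact hf.aestronglyMeasurable)
  rw [h.map_eq] at this
  exact this.symm

theorem Continuous.integrable_area {f : S2 → ℂ} (hf : Continuous f) : Integrable f area :=
  hf.integrable_of_hasCompactSupport (HasCompactSupport.of_compactSpace f)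

/-! ### Smoothness of the spherical harmonics -/

theorem contDiff_eval (p : Polynomial ℝ) : ContDiff ℝ ∞ fun z => p.eval z := by
  simpa using p.contDiff_aeval (𝕜 := ℝ) ∞

theorem contMDiff_sphHarmAux (l m : ℕ) : ContMDiff (𝓡 2) 𝓘(ℝ, ℂ) ∞ (sphHarmAux l m) := by
  have hp := contDiff_eval (Polynomial.derivative^[m] (legendre l))
  have h0 : ∀ i : Fin 3, ContDiff ℝ ∞ fun v : EuclideanSpace ℝ (Fin 3) => v i := fun i =>
    contDiff_piLp_apply 2
  have hc : ContDiff ℝ ∞ (fun r : ℝ => (r : ℂ)) := Complex.ofRealCLM.contDiff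
  have h : ContDiff ℝ ∞ fun v : EuclideanSpace ℝ (Fin 3) =>
      ((Real.sqrt (2 * l + 1) * Real.sqrt (((l - m).factorial : ℝ) / ((l + m).factorial : ℝ)) *
      ((-1) ^ m * (Polynomial.derivative^[m] (legendre l)).eval (v 2)) : ℝ) : ℂ) *
    ((v 0 : ℂ) + Complex.I * (v 1 : ℂ)) ^ m := by
    refine ContDiff.mul (hc.comp (contDiff_const.mul (contDiff_const.mul (hp.comp (h0 2))))) ?_
    exact ((hc.comp (h0 0)).add (contDiff_const.mul (hc.comp (h0 1)))).pow m
  have := Fact.mk (@finrank_euclideanSpace_fin ℝ _ (2 + 1))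
  exact h.contMDiff.comp (contMDiff_coe_sphere (E := EuclideanSpace ℝ (Fin (2 + 1))) (n := 2))

theorem contMDiff_conj_sphHarm (l : ℕ) (m : ℤ) :
    ContMDiff (𝓡 2) 𝓘(ℝ, ℂ) ∞ fun x => conj (sphHarm l m x) := by
  have hconj : ContMDiff 𝓘(ℝ, ℂ) 𝓘(ℝ, ℂ) ∞ (fun z : ℂ => conj z) :=
    Complex.conjCLE.contDiff.contMDiff
  have hmul : ContMDiff 𝓘(ℝ, ℂ) 𝓘(ℝ, ℂ) ∞ (fun z : ℂ => (-1) ^ (-m).toNat * z) :=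
    (contDiff_const.mul contDiff_id).contMDiff
  unfold sphHarm
  split_ifs
  · exact hconj.comp (contMDiff_sphHarmAux l _)
  · exact hconj.comp (hmul.comp (hconj.comp (contMDiff_sphHarmAux l _)))

theorem continuous_sphHarm (l : ℕ) (m : ℤ) : Continuous (sphHarm l m) := by
  have h := Complex.continuous_conj.comp (contMDiff_conj_sphHarm l m).continuous
  simpa [Function.comp_def] using h

theorem continuous_conj_sphHarm (l : ℕ) (m : ℤ) : Continuous fun x => conj (sphHarm l m x) :=
  (contMDiff_conj_sphHarm l m).continuous

/-! ### Orthonormality of the spherical harmonics -/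

/-- The Gram matrix of the spherical harmonics `Y_l^{l-k}` and `Y_{l'}^{l'-k'}`. -/
def gram (l l' k k' : ℕ) : ℂ :=
  ∫ x, sphHarm l ((l : ℤ) - k) x * conj (sphHarm l' ((l' : ℤ) - k') x) ∂area

theorem trace_harmOp_mul_eq {l : ℕ} (hl : l ≤ n) (x : S2) (P : Op n) :
    Matrix.trace (harmOp n l x * P) = ∑ k ∈ Finset.range (2 * l + 1),
      sphHarm l ((l : ℤ) - k) x * Matrix.trace ((basisOp n l k).transpose * P) := by
  rw [harmOp_eq_transpose hl, Matrix.sum_mul, Matrix.trace_sum]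
  simp

theorem trace_harmOp_mul_eq_conj (l : ℕ) (x : S2) (P : Op n) :
    Matrix.trace (harmOp n l x * P) = ∑ k ∈ Finset.range (2 * l + 1),
      conj (sphHarm l ((l : ℤ) - k) x) * Matrix.trace (basisOp n l k * P) := by
  rw [harmOp, Matrix.sum_mul, Matrix.trace_sum]
  simp

theorem continuous_trace_harmOp (l : ℕ) (P : Op n) :
    Continuous fun x => Matrix.trace (harmOp n l x * P) := by
  simp only [trace_harmOp_mul_eq_conj]
  exact continuous_finsetSum _ fun k _ => (continuous_conj_sphHarm _ _).mul continuous_const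

/-- The bilinear form `∫ tr(F_l(x) P) tr(F_{l'}(x) Q) dx` in terms of the Gram matrix. -/
def gramForm (n l l' : ℕ) (P Q : Op n) : ℂ :=
  ∑ k ∈ Finset.range (2 * l + 1), ∑ k' ∈ Finset.range (2 * l' + 1),
    gram l l' k k' * (Matrix.trace ((basisOp n l k).transpose * P) *
      Matrix.trace (basisOp n l' k' * Q))

theorem integral_trace_mul_trace {l l' : ℕ} (hl : l ≤ n) (P Q : Op n) :
    ∫ x, Matrix.trace (harmOp n l x * P) * Matrix.trace (harmOp n l' x * Q) ∂area =
      gramForm n l l' P Q := by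
  simp only [trace_harmOp_mul_eq hl, trace_harmOp_mul_eq_conj l', Finset.sum_mul_sum]
  rw [integral_finsetSum]
  · rw [gramForm]
    refine Finset.sum_congr rfl fun k _ => ?_
    rw [integral_finsetSum]
    · refine Finset.sum_congr rfl fun k' _ => ?_
      rw [gram, ← integral_mul_const]
      congr 1
      funext x
      ring
    · intro k' _
      exact Continuous.integrable_area (((continuous_sphHarm _ _).mul continuous_const).mul
        ((continuous_conj_sphHarm _ _).mul continuous_const))
  · intro k _
    exact Continuous.integrable_area (continuous_finsetSum _ fun k' _ =>
      ((continuous_sphHarm _ _).mul continuous_const).mul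
        ((continuous_conj_sphHarm _ _).mul continuous_const))

/-- Change variables by the rotation g in the integral and use the equivariance of F_l. -/
theorem gramForm_conjAct {l l' : ℕ} (hl : l ≤ n) (g : SU2) (P Q : Op n) :
    gramForm n l l' (conjAct n g P) (conjAct n g Q) = gramForm n l l' P Q := by
  rw [← integral_trace_mul_trace hl, ← integral_trace_mul_trace hl,
    ← integral_rotate g (f := fun x => Matrix.trace (harmOp n l x * conjAct n g P) *
      Matrix.trace (harmOp n l' x * conjAct n g Q))
      ((continuous_trace_harmOp l _).mul (continuous_trace_harmOp l' _))]
  congr 1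
  funext x
  rw [harmOp_of_rotates (rotates_rotate g x), harmOp_of_rotates (rotates_rotate g x),
    ← conjAct_mul_right, ← conjAct_mul_right, trace_conjAct, trace_conjAct]

theorem gramForm_basisOp {l l' k k' : ℕ} (hl : l ≤ n) (hl' : l' ≤ n) (hk : k ≤ 2 * l)
    (hk' : k' ≤ 2 * l') :
    gramForm n l l' (basisOp n l k) (basisOp n l' k').transpose = gram l l' k k' := by
  have h2 : ∀ j ≤ 2 * l', Matrix.trace (basisOp n l' j * (basisOp n l' k').transpose) =
      if j = k' then 1 else 0 := by
    intro j hj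
    rw [Matrix.trace_mul_comm, trace_basisOp_transpose_mul hl' hk' hj]
    simp [eq_comm]
  rw [gramForm, Finset.sum_eq_single k, Finset.sum_eq_single k']
  · rw [trace_basisOp_transpose_mul hl hk hk, h2 _ hk']
    simp
  · intro j hj hne
    rw [h2 j (by have := Finset.mem_range.1 hj; omega), if_neg hne]
    simp
  · intro h
    exact absurd (Finset.mem_range.2 (by omega)) h
  · intro j hj hne
    refine Finset.sum_eq_zero fun j' _ => ?_
    rw [trace_basisOp_transpose_mul hl (by have := Finset.mem_range.1 hj; omega) hk,
      if_neg (fun h => hne h.2)]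
    simp
  · intro h
    exact absurd (Finset.mem_range.2 (by omega)) h

theorem gramForm_smul_smul (l l' : ℕ) (r s : ℂ) (P Q : Op n) :
    gramForm n l l' (r • P) (s • Q) = r * s * gramForm n l l' P Q := by
  simp only [gramForm, Matrix.mul_smul, Matrix.trace_smul, smul_eq_mul, Finset.mul_sum]
  refine Finset.sum_congr rfl fun k _ => Finset.sum_congr rfl fun k' _ => ?_
  ring

theorem gram_of_weight_ne {l l' k k' : ℕ} (hk : k ≤ 2 * l) (hk' : k' ≤ 2 * l')
    (h : (l : ℤ) - k ≠ l' - k') : gram l l' k k' = 0 := by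
  obtain ⟨n, hl, hl'⟩ : ∃ n, l ≤ n ∧ l' ≤ n := ⟨max l l', le_max_left _ _, le_max_right _ _⟩
  set w : ℝ := ((l : ℝ) - k) - (l' - k') with hw
  have hw0 : w ≠ 0 := by
    intro e
    apply h
    have : (l : ℝ) - k = l' - k' := by linarith
    exact_mod_cast this
  -- The angle π/(2w) is chosen so that the two phases multiply to e^{-iπ} = -1; the entry then
  -- equals its own negative.
  have e := gramForm_conjAct (l' := l') hl (rotZ (Real.pi / (2 * w))) (basisOp n l k)
    (basisOp n l' k').transpose
  have e2 : conjAct n (rotZ (Real.pi / (2 * w))) (basisOp n l' k').transpose =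
      Complex.exp ((2 * ((l' : ℂ) - k') * (Real.pi / (2 * w) : ℝ)) * Complex.I) •
        (basisOp n l' k').transpose := by
    rw [transpose_basisOp hl' hk', conjAct_smul, conjAct_rotZ_basisOp, smul_comm,
      Nat.cast_sub hk']
    congr 3
    push_cast
    ring
  rw [conjAct_rotZ_basisOp, e2, gramForm_smul_smul, gramForm_basisOp hl hl' hk hk',
    ← Complex.exp_add] at e
  have e3 : -(2 * ((l : ℂ) - k) * ((Real.pi / (2 * w) : ℝ) : ℂ) * Complex.I) +
      2 * ((l' : ℂ) - k') * ((Real.pi / (2 * w) : ℝ) : ℂ) * Complex.I =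
      -(Real.pi * Complex.I) := by
    have : (w : ℂ) ≠ 0 := by exact_mod_cast hw0
    have hwc : (w : ℂ) = ((l : ℂ) - k) - (l' - k') := by rw [hw]; push_cast; ring
    push_cast
    field_simp
    rw [hwc]
    ring
  rw [e3, Complex.exp_neg, Complex.exp_pi_mul_I] at e
  have : (2 : ℂ) * gram l l' k k' = 0 := by
    have e4 : (-1 : ℂ)⁻¹ = -1 := by norm_num
    rw [e4] at e
    linear_combination -e
  simpa using this

theorem HasMatDerivAt.trace_const_mul {M : ℝ → Op n} {M' : Op n} {t : ℝ}
    (h : HasMatDerivAt M M' t) (B : Op n) :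
    HasDerivAt (fun s => Matrix.trace (B * M s)) (Matrix.trace (B * M')) t := by
  simp only [Matrix.trace, Matrix.diag_apply, Matrix.mul_apply]
  exact HasDerivAt.fun_sum fun a _ => HasDerivAt.fun_sum fun b _ => (h b a).const_mul _

theorem hasMatDerivAt_conjAct_rotY (P : Op n) :
    HasMatDerivAt (fun s => conjAct n (rotY s) P) (genY n * P - P * genY n) 0 := by
  have h := ((hasMatDerivAt_spinRep_rotY (n := n) 0).mul (hasMatDerivAt_const P 0)).mul
    (hasMatDerivAt_spinRep_rotY_inv 0)
  rw [rotY_zero, inv_one, spinRep_one] at h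
  have e : (genY n * 1 * P + 1 * 0) * 1 + 1 * P * (1 * -genY n) = genY n * P - P * genY n := by
    noncomm_ring
  rw [e] at h
  exact h

theorem gramForm_commutator {l l' : ℕ} (hl : l ≤ n) (P Q : Op n) :
    gramForm n l l' (genY n * P - P * genY n) Q + gramForm n l l' P (genY n * Q - Q * genY n) =
      0 := by
  have h : HasDerivAt (fun s => gramForm n l l' (conjAct n (rotY s) P) (conjAct n (rotY s) Q))
      (gramForm n l l' (genY n * P - P * genY n) Q +
        gramForm n l l' P (genY n * Q - Q * genY n)) 0 := by
    simp only [gramForm, ← Finset.sum_add_distrib, ← mul_add]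
    refine HasDerivAt.fun_sum fun k _ => HasDerivAt.fun_sum fun k' _ => HasDerivAt.const_mul _ ?_
    have := ((hasMatDerivAt_conjAct_rotY P).trace_const_mul (basisOp n l k).transpose).fun_mul
      ((hasMatDerivAt_conjAct_rotY Q).trace_const_mul (basisOp n l' k'))
    simpa only [rotY_zero, conjAct_one] using this
  simp only [gramForm_conjAct hl] at h
  exact h.unique (hasDerivAt_const _ _)

theorem genY_commutator (l k : ℕ) : genY n * basisOp n l k - basisOp n l k * genY n =
    (step l k : ℂ) • basisOp n l (k + 1) -
      (if k = 0 then 0 else (step l (k - 1) : ℂ) • basisOp n l (k - 1)) := by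
  have h : (Jminus n - Jplus n) * coupledAux n l k - coupledAux n l k * (Jminus n - Jplus n) =
      step l k • coupledAux n l (k + 1) -
        (if k = 0 then 0 else step l (k - 1) • coupledAux n l (k - 1)) := by
    rw [← Jminus_commutator]
    have e : (if k = 0 then 0 else step l (k - 1) • coupledAux n l (k - 1)) =
        Jplus n * coupledAux n l k - coupledAux n l k * Jplus n := by
      rcases Nat.eq_zero_or_pos k with h0 | h0
      · subst h0
        rw [if_pos rfl, Jplus_commutator_zero]
      · obtain ⟨j, rfl⟩ : ∃ j, k = j + 1 := ⟨k - 1, by omega⟩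
        rw [if_neg (by omega), Jplus_commutator_succ, Nat.add_sub_cancel]
    rw [e]
    noncomm_ring
  rw [genY, basisOp, ← map_ofReal_mul, ← map_ofReal_mul]
  ext a b
  have h2 := congrArg (fun M => ((M a b : ℝ) : ℂ)) h
  simp only [Matrix.sub_apply, Matrix.map_apply, Matrix.smul_apply, basisOp_apply] at h2 ⊢
  rw [← Complex.ofReal_sub, h2]
  split_ifs <;> simp [basisOp_apply]

theorem genY_commutator_transpose (P : Op n) :
    genY n * P.transpose - P.transpose * genY n = (genY n * P - P * genY n).transpose := by
  have h : (genY n).transpose = -genY n := by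
    ext a b
    simp [genY, Jplus]
  rw [Matrix.transpose_sub, Matrix.transpose_mul, Matrix.transpose_mul, h]
  noncomm_ring

/-- This is the vanishing derivative of the invariant form along `rotY`, read off on basis elements.
Indices beyond the ladder, where a Gram entry is no longer a value of the form, carry a step factor
zero. -/
theorem gram_recursion {l l' k k' : ℕ} (hk : k ≤ 2 * l) (hk' : k' ≤ 2 * l') :
    (step l k : ℂ) * gram l l' (k + 1) k' -
      (if k = 0 then 0 else (step l (k - 1) : ℂ) * gram l l' (k - 1) k') +
      ((step l' k' : ℂ) * gram l l' k (k' + 1) -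
      (if k' = 0 then 0 else (step l' (k' - 1) : ℂ) * gram l l' k (k' - 1))) = 0 := by
  obtain ⟨n, hl, hl'⟩ : ∃ n, l ≤ n ∧ l' ≤ n := ⟨max l l', le_max_left _ _, le_max_right _ _⟩
  have hadd : ∀ (r s : ℂ) (P P' Q : Op n), gramForm n l l' (r • P - s • P') Q =
      r * gramForm n l l' P Q - s * gramForm n l l' P' Q := by
    intro r s P P' Q
    simp only [gramForm, Matrix.mul_sub, Matrix.mul_smul, Matrix.trace_sub, Matrix.trace_smul,
      smul_eq_mul, Finset.mul_sum, ← Finset.sum_sub_distrib]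
    refine Finset.sum_congr rfl fun _ _ => Finset.sum_congr rfl fun _ _ => ?_
    ring
  have hadd' : ∀ (r s : ℂ) (P Q Q' : Op n), gramForm n l l' P (r • Q - s • Q') =
      r * gramForm n l l' P Q - s * gramForm n l l' P Q' := by
    intro r s P P' Q
    simp only [gramForm, Matrix.mul_sub, Matrix.mul_smul, Matrix.trace_sub, Matrix.trace_smul,
      smul_eq_mul, Finset.mul_sum, ← Finset.sum_sub_distrib]
    refine Finset.sum_congr rfl fun _ _ => Finset.sum_congr rfl fun _ _ => ?_
    ring
  have hcomm : ∀ (l k : ℕ), genY n * basisOp n l k - basisOp n l k * genY n =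
      (step l k : ℂ) • basisOp n l (k + 1) -
        (if k = 0 then 0 else (step l (k - 1) : ℂ)) • basisOp n l (k - 1) := by
    intro l k
    rw [genY_commutator]
    split_ifs <;> simp
  have hval : ∀ j j', (j ≤ 2 * l ∧ j' ≤ 2 * l') →
      gramForm n l l' (basisOp n l j) (basisOp n l' j').transpose = gram l l' j j' :=
    fun j j' h => gramForm_basisOp hl hl' h.1 h.2
  have h := gramForm_commutator (l' := l') hl (basisOp n l k) (basisOp n l' k').transpose
  rw [genY_commutator_transpose, hcomm, hcomm, Matrix.transpose_sub, Matrix.transpose_smul,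
    Matrix.transpose_smul, hadd, hadd', hval (k - 1) k' (by omega),
    hval k (k' - 1) (by omega)] at h
  have e1 : (step l k : ℂ) * gramForm n l l' (basisOp n l (k + 1)) (basisOp n l' k').transpose =
      step l k * gram l l' (k + 1) k' := by
    rcases lt_or_ge k (2 * l) with h1 | h1
    · rw [hval _ _ (by omega)]
    · rw [step_eq_zero h1]; simp
  have e2 : (step l' k' : ℂ) * gramForm n l l' (basisOp n l k) (basisOp n l' (k' + 1)).transpose =
      step l' k' * gram l l' k (k' + 1) := by
    rcases lt_or_ge k' (2 * l') with h1 | h1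
    · rw [hval _ _ (by omega)]
    · rw [step_eq_zero h1]; simp
  rw [e1, e2] at h
  simpa only [ite_mul, zero_mul] using h

/-- Same scheme as `hsInner_of_lt`, although only the generator J₋ - J₊ is available. The weight
rule removes two of the four terms of the recursion, which separates the effects of J₋ and J₊. -/
theorem gram_of_lt {l l' k k' : ℕ} (h : l < l') (hk : k ≤ 2 * l) (hk' : k' ≤ 2 * l') :
    gram l l' k k' = 0 := by
  by_cases hw : (l : ℤ) - k = l' - k'
  · obtain ⟨d, rfl⟩ : ∃ d, l' = l + (d + 1) := ⟨l' - l - 1, by omega⟩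
    obtain rfl : k' = k + (d + 1) := by push_cast at hw; omega
    clear hw
    induction k with
    | zero =>
      have e := gram_recursion (l := l) (l' := l + (d + 1)) (k := 0) (k' := d) (by omega)
        (by omega)
      have hs := step_pos (l := l + (d + 1)) (k := d) (by omega)
      have hs0 : (step (l + (d + 1)) d : ℂ) ≠ 0 := by exact_mod_cast hs.ne'
      have e1 : (step l 0 : ℂ) * gram l (l + (d + 1)) (0 + 1) d = 0 := by
        rcases Nat.eq_zero_or_pos l with h0 | h0
        · rw [step_eq_zero (by omega)]; simp
        · rw [gram_of_weight_ne (by omega) (by omega) (by push_cast; omega), mul_zero]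
      have e2 : (if d = 0 then 0 else
          (step (l + (d + 1)) (d - 1) : ℂ) * gram l (l + (d + 1)) 0 (d - 1)) = 0 := by
        split_ifs with h0
        · rfl
        · rw [gram_of_weight_ne (by omega) (by omega) (by push_cast; omega), mul_zero]
      rw [e1, e2, if_pos rfl, sub_zero, sub_zero, zero_add] at e
      rw [zero_add]
      exact (mul_eq_zero.1 e).resolve_left hs0
    | succ k ih =>
      have e := gram_recursion (l := l) (l' := l + (d + 1)) (k := k) (k' := k + 1 + (d + 1))
        (by omega) (by omega)
      have hs := step_pos (l := l) (k := k) (by omega)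
      have hs0 : (step l k : ℂ) ≠ 0 := by exact_mod_cast hs.ne'
      have ih := ih (by omega) (by omega)
      have e1 : (if k = 0 then 0 else
          (step l (k - 1) : ℂ) * gram l (l + (d + 1)) (k - 1) (k + 1 + (d + 1))) = 0 := by
        split_ifs with h0
        · rfl
        · rw [gram_of_weight_ne (by omega) (by omega) (by push_cast; omega), mul_zero]
      have e2 : (step (l + (d + 1)) (k + 1 + (d + 1)) : ℂ) *
          gram l (l + (d + 1)) k (k + 1 + (d + 1) + 1) = 0 := by
        rcases lt_or_ge (k + 1 + (d + 1)) (2 * (l + (d + 1))) with h0 | h0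
        · rw [gram_of_weight_ne (by omega) (by omega) (by push_cast; omega), mul_zero]
        · rw [step_eq_zero h0]; simp
      rw [e1, e2, if_neg (by omega), show k + 1 + (d + 1) - 1 = k + (d + 1) by omega, ih,
        mul_zero, sub_zero, sub_zero, add_zero] at e
      exact (mul_eq_zero.1 e).resolve_left hs0
  · exact gram_of_weight_ne hk hk' hw

theorem gram_symm (l l' k k' : ℕ) : gram l' l k' k = conj (gram l l' k k') := by
  rw [gram, gram, ← integral_conj]
  congr 1
  funext x
  simp [mul_comm]

theorem gram_self_succ {l k : ℕ} (hk : k + 1 ≤ 2 * l) :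
    gram l l (k + 1) (k + 1) = gram l l k k := by
  have e := gram_recursion (l := l) (l' := l) (k := k) (k' := k + 1) (by omega) (by omega)
  have hs0 : (step l k : ℂ) ≠ 0 := by exact_mod_cast (step_pos (l := l) (k := k) (by omega)).ne'
  have e1 : (if k = 0 then 0 else (step l (k - 1) : ℂ) * gram l l (k - 1) (k + 1)) = 0 := by
    split_ifs with h0
    · rfl
    · rw [gram_of_weight_ne (by omega) (by omega) (by push_cast; omega), mul_zero]
  have e2 : (step l (k + 1) : ℂ) * gram l l k (k + 1 + 1) = 0 := by
    rcases lt_or_ge (k + 1) (2 * l) with h0 | h0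
    · rw [gram_of_weight_ne (by omega) (by omega) (by push_cast; omega), mul_zero]
    · rw [step_eq_zero h0]; simp
  rw [e1, e2, if_neg (by omega), Nat.add_sub_cancel] at e
  refine mul_left_cancel₀ hs0 ?_
  linear_combination e

theorem dot_self (x : S2) : dot x x = 1 := by
  rw [dot_eq, ← coord_sq x]; ring

/-- The recursion makes the 2l + 1 diagonal entries equal. By the addition theorem at x = y and
P_l(1) = 1, their sum is the integral of the constant 2l + 1. -/
theorem gram_self {l k : ℕ} (hk : k ≤ 2 * l) : gram l l k k = 4 * Real.pi := by
  have hconst : ∀ k ≤ 2 * l, gram l l k k = gram l l 0 0 := by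
    intro k hk
    induction k with
    | zero => rfl
    | succ k ih => rw [gram_self_succ hk, ih (by omega)]
  have hsum : ∑ k ∈ Finset.range (2 * l + 1), gram l l k k = (2 * l + 1) * (4 * Real.pi) := by
    simp only [gram]
    rw [← integral_finsetSum]
    · simp only [addition_theorem, dot_self]
      have h1 := legendreD_zero_one l
      rw [legendreD, Function.iterate_zero_apply] at h1
      rw [h1, integral_const, area_real_univ]
      simp
      ring
    · intro j _
      exact Continuous.integrable_area
        ((continuous_sphHarm _ _).mul (continuous_conj_sphHarm _ _))
  rw [Finset.sum_congr rfl fun j hj => hconst j (by have := Finset.mem_range.1 hj; omega),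
    Finset.sum_const, Finset.card_range, nsmul_eq_mul] at hsum
  rw [hconst k hk]
  have : (2 * (l : ℂ) + 1) ≠ 0 := by exact_mod_cast (by omega : 2 * l + 1 ≠ 0)
  refine mul_left_cancel₀ this ?_
  rw [← hsum]
  push_cast
  ring

theorem gram_eq {l l' k k' : ℕ} (hk : k ≤ 2 * l) (hk' : k' ≤ 2 * l') :
    gram l l' k k' = if l = l' ∧ k = k' then (4 * Real.pi : ℂ) else 0 := by
  split_ifs with h
  · obtain ⟨rfl, rfl⟩ := h
    exact gram_self hk
  · rcases lt_trichotomy l l' with hl | hl | hl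
    · exact gram_of_lt hl hk hk'
    · subst hl
      exact gram_of_weight_ne hk hk' (by omega)
    · rw [gram_symm, gram_of_lt hl hk' hk, map_zero]

/-! ### Operator kernels -/

theorem sqrt_succ_ne_zero (n : ℕ) : (Real.sqrt (n + 1) : ℂ) ≠ 0 := by
  exact_mod_cast (Real.sqrt_pos.2 (by positivity)).ne'

theorem sqrt_succ_mul_self (n : ℕ) :
    (Real.sqrt (n + 1) : ℂ) * (Real.sqrt (n + 1) : ℂ) = (n : ℂ) + 1 := by
  exact_mod_cast Real.mul_self_sqrt (by positivity : (0 : ℝ) ≤ n + 1)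

theorem basisOp_zero (n : ℕ) : basisOp n 0 0 = (Real.sqrt (n + 1) : ℂ)⁻¹ • (1 : Op n) := by
  have h := mu_sq (n := n) (l := 0) (by omega)
  simp only [Nat.factorial_zero, Nat.cast_one, one_pow, one_mul, mul_zero, zero_add, add_zero,
    Nat.choose_one_right] at h
  have hm : mu n 0 = Real.sqrt (n + 1) := by
    rw [← Real.sqrt_sq (mu_pos (n := n) (Nat.zero_le _)).le, h]
    push_cast
    rfl
  ext a b
  rw [basisOp_apply, coupledAux, hm, pow_zero, pow_zero, Matrix.smul_apply, Matrix.smul_apply]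
  by_cases hab : a = b
  · subst hab; simp
  · simp [hab]

theorem harmOp_zero (n : ℕ) (x : S2) :
    harmOp n 0 x = (Real.sqrt (n + 1) : ℂ)⁻¹ • (1 : Op n) := by
  obtain ⟨g, hg⟩ := exists_rotates x
  rw [harmOp_of_rotates_northPole hg, harmOp_northPole, basisOp_zero, conjAct_smul, conjAct_smul,
    conjAct_one_right]
  simp

theorem coupled_zero (n l : ℕ) : coupled n l 0 = coupledAux n l l := by
  rw [← coupled_sub, sub_self]

theorem kernelAtPole_eq {c : ℕ → ℝ} (hc : c 0 = 1) : kernelAtPole n c =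
    ∑ l ∈ Finset.range (n + 1),
      ((c l * Real.sqrt ((2 * l + 1) / (n + 1)) : ℝ) : ℂ) • basisOp n l l := by
  rw [kernelAtPole, Finset.range_eq_Ico, Finset.sum_eq_sum_Ico_succ_bot (by omega)]
  congr 1
  · rw [hc, basisOp_zero, smul_smul]
    congr 1
    have h := sqrt_succ_ne_zero n
    have h2 := sqrt_succ_mul_self n
    rw [one_mul, Real.sqrt_div (by positivity)]
    simp only [Nat.cast_zero, mul_zero, zero_add, Real.sqrt_one]
    rw [← h2]
    push_cast
    field_simp

/-- The factor √(2l+1) in the kernel is the value of Y_l^0 at the pole, so √(2l+1) e(l,0) is F_l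
there and conjugation moves it to x. The condition c_0 = 1 lets the identity term count as l = 0. -/
theorem conjAct_kernelAtPole {c : ℕ → ℝ} (hc : c 0 = 1) {g : SU2} {x : S2}
    (hg : Rotates g northPole x) : conjAct n g (kernelAtPole n c) =
    ∑ l ∈ Finset.range (n + 1), ((c l / Real.sqrt (n + 1) : ℝ) : ℂ) • harmOp n l x := by
  rw [kernelAtPole_eq hc, conjAct_sum]
  refine Finset.sum_congr rfl fun l _ => ?_
  rw [conjAct_smul, conjAct_basisOp_mid hg, smul_smul, Real.sqrt_div (by positivity)]
  congr 1
  have h0 : (Real.sqrt (2 * l + 1) : ℂ) ≠ 0 := by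
    exact_mod_cast (Real.sqrt_pos.2 (by positivity)).ne'
  push_cast
  field_simp

theorem opKernel_eq {c : ℕ → ℝ} (hc : c 0 = 1) (x : S2) : opKernel n c x =
    ∑ l ∈ Finset.range (n + 1), ((c l / Real.sqrt (n + 1) : ℝ) : ℂ) • harmOp n l x :=
  conjAct_kernelAtPole hc (exists_rotates x).choose_spec

theorem symbolMap_apply (c : ℕ → ℝ) (P : Op n) (x : S2) :
    symbolMap n c P x = Matrix.trace (P * opKernel n c x) := rfl

theorem symbolMap_eq {c : ℕ → ℝ} (hc : c 0 = 1) (P : Op n) (x : S2) : symbolMap n c P x =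
    ∑ l ∈ Finset.range (n + 1),
      ((c l / Real.sqrt (n + 1) : ℝ) : ℂ) * Matrix.trace (harmOp n l x * P) := by
  rw [symbolMap_apply, opKernel_eq hc, Matrix.mul_sum, Matrix.trace_sum]
  refine Finset.sum_congr rfl fun l _ => ?_
  rw [Matrix.mul_smul, Matrix.trace_smul, smul_eq_mul, Matrix.trace_mul_comm]

theorem continuous_symbolMap {c : ℕ → ℝ} (hc : c 0 = 1) (P : Op n) :
    Continuous (symbolMap n c P) := by
  rw [show symbolMap n c P = fun x => _ from funext (symbolMap_eq hc P)]
  exact continuous_finsetSum _ fun l _ => continuous_const.mul (continuous_trace_harmOp l P)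

theorem integral_trace_harmOp {l l' : ℕ} (hl : l ≤ n) (P Q : Op n) :
    ∫ x, Matrix.trace (harmOp n l x * P) * Matrix.trace (harmOp n l' x * Q) ∂area =
      if l = l' then 4 * Real.pi * ∑ k ∈ Finset.range (2 * l + 1),
        Matrix.trace ((basisOp n l k).transpose * P) * Matrix.trace (basisOp n l k * Q)
      else 0 := by
  rw [integral_trace_mul_trace hl, gramForm]
  have e : ∀ k ∈ Finset.range (2 * l + 1), ∀ k' ∈ Finset.range (2 * l' + 1),
      gram l l' k k' = if l = l' ∧ k = k' then (4 * Real.pi : ℂ) else 0 := by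
    intro k hk k' hk'
    have := Finset.mem_range.1 hk
    have := Finset.mem_range.1 hk'
    exact gram_eq (by omega) (by omega)
  split_ifs with h
  · subst h
    rw [Finset.mul_sum]
    refine Finset.sum_congr rfl fun k hk => ?_
    rw [Finset.sum_eq_single_of_mem k hk]
    · rw [e k hk k hk, if_pos ⟨rfl, rfl⟩]
    · intro k' hk' hne
      rw [e k hk k' hk', if_neg (fun h => hne h.2.symm), zero_mul]
  · refine Finset.sum_eq_zero fun k hk => Finset.sum_eq_zero fun k' hk' => ?_
    rw [e k hk k' hk', if_neg (fun h' => h h'.1), zero_mul]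

theorem trace_mul_eq_sum (P Q : Op n) : Matrix.trace (P * Q) =
    ∑ l ∈ Finset.range (n + 1), ∑ k ∈ Finset.range (2 * l + 1),
      Matrix.trace ((basisOp n l k).transpose * P) * Matrix.trace (basisOp n l k * Q) := by
  conv_lhs => rw [eq_sum_basisOp P]
  simp only [Matrix.sum_mul, Matrix.trace_sum, Matrix.smul_mul, Matrix.trace_smul, smul_eq_mul]

/-- Pairing with F_l isolates the degree l part of a symbol. This one formula yields the duality,
the normalization and the reproducing property of Legendre kernels. -/
theorem integral_trace_harmOp_mul_symbolMap {c : ℕ → ℝ} (hc : c 0 = 1) {l : ℕ} (hl : l ≤ n)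
    (P Q : Op n) : ∫ x, Matrix.trace (harmOp n l x * P) * symbolMap n c Q x ∂area =
      ((c l / Real.sqrt (n + 1) : ℝ) : ℂ) * (4 * Real.pi * ∑ k ∈ Finset.range (2 * l + 1),
        Matrix.trace ((basisOp n l k).transpose * P) * Matrix.trace (basisOp n l k * Q)) := by
  simp only [symbolMap_eq hc, Finset.mul_sum (Finset.range (n + 1))]
  rw [integral_finsetSum]
  · rw [Finset.sum_eq_single_of_mem l (Finset.mem_range.2 (by omega))]
    · have e := integral_trace_harmOp (l' := l) hl P Q
      rw [if_pos rfl] at e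
      rw [← e, ← integral_const_mul]
      congr 1
      funext x
      ring
    · intro l' _ hne
      have e := integral_trace_harmOp (l' := l') hl P Q
      rw [if_neg (Ne.symm hne)] at e
      rw [← mul_zero ((c l' / Real.sqrt (n + 1) : ℝ) : ℂ), ← e, ← integral_const_mul]
      congr 1
      funext x
      ring
  · intro l' _
    exact Continuous.integrable_area ((continuous_trace_harmOp l P).mul
      (continuous_const.mul (continuous_trace_harmOp l' Q)))

/-- Operator kernels with inverse characteristic numbers are dual to each other. -/
theorem integral_symbolMap_mul_symbolMap {c c' : ℕ → ℝ} (hc : c 0 = 1) (hc' : c' 0 = 1)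
    (h : ∀ l ≤ n, c l * c' l = 1) (P Q : Op n) :
    ∫ x, symbolMap n c P x * symbolMap n c' Q x ∂area =
      4 * Real.pi / (n + 1) * Matrix.trace (P * Q) := by
  simp only [symbolMap_eq hc, Finset.sum_mul]
  rw [integral_finsetSum, trace_mul_eq_sum, Finset.mul_sum]
  · refine Finset.sum_congr rfl fun l hl => ?_
    have hl : l ≤ n := by have := Finset.mem_range.1 hl; omega
    simp only [mul_assoc]
    rw [integral_const_mul, integral_trace_harmOp_mul_symbolMap hc' hl]
    have h1 : (c l : ℂ) * c' l = 1 := by exact_mod_cast h l hl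
    have h2 := sqrt_succ_ne_zero n
    rw [← sqrt_succ_mul_self]
    push_cast
    field_simp
    linear_combination (∑ k ∈ Finset.range (2 * l + 1),
        Matrix.trace ((basisOp n l k).transpose * P) * Matrix.trace (basisOp n l k * Q)) * h1
  · intro l _
    exact Continuous.integrable_area ((continuous_const.mul (continuous_trace_harmOp l P)).mul
      (continuous_symbolMap hc' Q))

/-! ### Classification of symbol correspondences -/

theorem IsCharString.inv {c : ℕ → ℝ} (hc : IsCharString n c) :
    IsCharString n fun l => (c l)⁻¹ :=
  ⟨by simp [hc.1], fun l h1 h2 => inv_ne_zero (hc.2 l h1 h2)⟩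

theorem IsCharString.ne_zero {c : ℕ → ℝ} (hc : IsCharString n c) {l : ℕ} (hl : l ≤ n) :
    c l ≠ 0 := by
  rcases Nat.eq_zero_or_pos l with h | h
  · rw [h, hc.1]; exact one_ne_zero
  · exact hc.2 l h hl

theorem opKernel_of_rotates {c : ℕ → ℝ} (hc : c 0 = 1) {g : SU2} {x y : S2}
    (h : Rotates g x y) : opKernel n c y = conjAct n g (opKernel n c x) := by
  rw [opKernel_eq hc, opKernel_eq hc, conjAct_sum]
  refine Finset.sum_congr rfl fun l _ => ?_
  rw [conjAct_smul, harmOp_of_rotates h]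

theorem conjTranspose_opKernel {c : ℕ → ℝ} (hc : c 0 = 1) (x : S2) :
    (opKernel n c x).conjTranspose = opKernel n c x := by
  rw [opKernel_eq hc, Matrix.conjTranspose_sum]
  refine Finset.sum_congr rfl fun l hl => ?_
  rw [Matrix.conjTranspose_smul, conjTranspose_harmOp (by have := Finset.mem_range.1 hl; omega)]
  congr 1
  exact Complex.conj_ofReal _

theorem contMDiff_symbolMap {c : ℕ → ℝ} (hc : c 0 = 1) (P : Op n) :
    ContMDiff (𝓡 2) 𝓘(ℝ, ℂ) ∞ (symbolMap n c P) := by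
  have hmul : ∀ r : ℂ, ContMDiff 𝓘(ℝ, ℂ) 𝓘(ℝ, ℂ) ∞ (fun z : ℂ => z * r) := fun r =>
    (contDiff_id.mul contDiff_const).contMDiff
  have hmul' : ∀ r : ℂ, ContMDiff 𝓘(ℝ, ℂ) 𝓘(ℝ, ℂ) ∞ (fun z : ℂ => r * z) := fun r =>
    (contDiff_const.mul contDiff_id).contMDiff
  rw [show symbolMap n c P = fun x => _ from funext (symbolMap_eq hc P)]
  simp only [trace_harmOp_mul_eq_conj]
  refine contMDiff_finsetSum fun l _ => (hmul' _).comp (contMDiff_finsetSum fun k _ => ?_)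
  exact (hmul _).comp (contMDiff_conj_sphHarm _ _)

/-- If W_c(P) = 0, then duality with the inverse characteristic numbers gives tr(PQ) = 0 for every
Q. -/
theorem injective_symbolMap {c : ℕ → ℝ} (hc : IsCharString n c) :
    Function.Injective (symbolMap n c) := by
  rw [injective_iff_map_eq_zero]
  intro P hP
  refine Matrix.ext_iff_trace_mul_right.2 fun Q => ?_
  have h := integral_symbolMap_mul_symbolMap hc.1 hc.inv.1
    (fun l hl => mul_inv_cancel₀ (hc.ne_zero hl)) P Q
  rw [hP] at h
  simp only [Pi.zero_apply, zero_mul, integral_zero] at h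
  have h0 : (4 * Real.pi / (n + 1) : ℂ) ≠ 0 := by
    have : (4 * Real.pi / (n + 1) : ℝ) ≠ 0 := by positivity
    exact_mod_cast this
  rw [zero_mul, Matrix.trace_zero]
  exact (mul_eq_zero.1 h.symm).resolve_left h0

/-- F_0 is a constant multiple of the identity, so this is the degree zero case of the pairing with
F_l. -/
theorem integral_symbolMap {c : ℕ → ℝ} (hc : c 0 = 1) (P : Op n) :
    ∫ x, symbolMap n c P x ∂area = 4 * Real.pi / (n + 1) * Matrix.trace P := by
  have h0 := sqrt_succ_ne_zero n
  have h := integral_trace_harmOp_mul_symbolMap hc (Nat.zero_le n) 1 P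
  simp only [harmOp_zero, Matrix.mul_one, Matrix.trace_smul, Matrix.trace_one, hc, mul_zero,
    zero_add, Finset.range_one, Finset.sum_singleton, basisOp_zero, Matrix.transpose_smul,
    Matrix.transpose_one, Matrix.smul_mul, Matrix.one_mul, smul_eq_mul, Fintype.card_fin] at h
  rw [integral_const_mul] at h
  push_cast at h
  rw [← sqrt_succ_mul_self] at h ⊢
  have h2 : (Real.sqrt (n + 1) : ℂ)⁻¹ * (Real.sqrt (n + 1) * Real.sqrt (n + 1)) ≠ 0 := by
    simp [h0]
  refine mul_left_cancel₀ h2 ?_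
  rw [h]
  field_simp

theorem isSymbolCorrespondence_symbolMap {c : ℕ → ℝ} (hc : IsCharString n c) :
    IsSymbolCorrespondence n (symbolMap n c) where
  smooth := contMDiff_symbolMap hc.1
  injective := injective_symbolMap hc
  equivariant g x y h P := by
    rw [symbolMap_apply, symbolMap_apply, opKernel_of_rotates hc.1 h, ← conjAct_mul_right,
      trace_conjAct]
  real P x := by
    rw [symbolMap_apply, symbolMap_apply, ← conjTranspose_opKernel hc.1,
      ← Matrix.conjTranspose_mul, Matrix.trace_conjTranspose, Matrix.trace_mul_comm,
      conjTranspose_opKernel hc.1]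
    rfl
  normalized P := by
    rw [integral_symbolMap hc.1]
    have : (Real.pi : ℂ) ≠ 0 := by exact_mod_cast Real.pi_ne_zero
    field_simp

theorem exists_trace_representation (φ : Op n →ₗ[ℂ] ℂ) :
    ∃ K : Op n, ∀ P, φ P = Matrix.trace (P * K) := by
  refine ⟨Matrix.of fun b a => φ (Matrix.single a b 1), fun P => ?_⟩
  conv_lhs => rw [Matrix.matrix_eq_sum_single P]
  simp only [map_sum, Matrix.trace, Matrix.diag_apply, Matrix.mul_apply, Matrix.of_apply]
  refine Finset.sum_congr rfl fun a _ => Finset.sum_congr rfl fun b _ => ?_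
  rw [show Matrix.single a b (P a b) = P a b • Matrix.single a b (1 : ℂ) by simp, map_smul,
    smul_eq_mul]

theorem rotates_rotZ_northPole (t : ℝ) : Rotates (rotZ t) northPole northPole := by
  obtain ⟨a0, a1, a2⟩ := coord_northPole
  rw [rotates_iff]
  ext i j
  fin_cases i <;> fin_cases j <;>
    simp [Matrix.mul_apply, Fin.sum_univ_two, pauli, rotZ, a0, a1, a2]

theorem conjAct_rotZ_transpose_basisOp (t : ℝ) {l k : ℕ} (hl : l ≤ n) (hk : k ≤ 2 * l) :
    conjAct n (rotZ t) (basisOp n l k).transpose =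
      Complex.exp ((2 * ((l : ℂ) - k) * t) * Complex.I) • (basisOp n l k).transpose := by
  rw [transpose_basisOp hl hk, conjAct_smul, conjAct_rotZ_basisOp, smul_comm, Nat.cast_sub hk]
  congr 3
  push_cast
  ring

/-- Torus invariance removes every component of nonzero weight, leaving a combination of the e(l,0).
Reality makes its coefficients real, and unit trace fixes the one at l = 0. -/
theorem eq_kernelAtPole {K : Op n} (htorus : ∀ t, conjAct n (rotZ t)⁻¹ K = K)
    (hreal : ∀ l ≤ n, conj (Matrix.trace (basisOp n l l * K)) = Matrix.trace (basisOp n l l * K))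
    (htrace : Matrix.trace K = 1) :
    ∃ c : ℕ → ℝ, c 0 = 1 ∧ K = kernelAtPole n c ∧
      ∀ l ≤ n, c l = 0 → Matrix.trace (basisOp n l l * K) = 0 := by
  have hsym : ∀ l, (basisOp n l l).transpose = basisOp n l l := fun l => by
    rw [basisOp_self_eq_diagonal, Matrix.diagonal_transpose]
  have hpos : ∀ l : ℕ, 0 < Real.sqrt ((2 * l + 1) / (n + 1)) := fun l =>
    Real.sqrt_pos.2 (by positivity)
  have hoff : ∀ l ≤ n, ∀ k ≤ 2 * l, k ≠ l →
      Matrix.trace ((basisOp n l k).transpose * K) = 0 := by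
    intro l hl k hk hne
    -- For a weight w ≠ 0 the torus element of angle π/(2w) acts by e^{iπ} = -1, so the invariant
    -- component is zero.
    set w : ℝ := (l : ℝ) - k with hw
    have hw0 : w ≠ 0 := by
      rw [hw, sub_ne_zero]
      exact_mod_cast Ne.symm hne
    have e : Matrix.trace ((basisOp n l k).transpose * K) =
        Matrix.trace ((basisOp n l k).transpose *
          conjAct n (rotZ (Real.pi / (2 * w)))⁻¹ K) := by rw [htorus]
    rw [trace_mul_conjAct, inv_inv, conjAct_rotZ_transpose_basisOp _ hl hk, Matrix.smul_mul,
      Matrix.trace_smul] at e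
    have e3 : 2 * ((l : ℂ) - k) * ((Real.pi / (2 * w) : ℝ) : ℂ) * Complex.I =
        Real.pi * Complex.I := by
      have : (w : ℂ) ≠ 0 := by exact_mod_cast hw0
      have hwc : (w : ℂ) = (l : ℂ) - k := by rw [hw]; push_cast; ring
      rw [← hwc]
      push_cast
      field_simp
    rw [e3, Complex.exp_pi_mul_I, smul_eq_mul] at e
    have h2 : (2 : ℂ) * Matrix.trace ((basisOp n l k).transpose * K) = 0 := by
      linear_combination e
    simpa using h2
  have hK : K = ∑ l ∈ Finset.range (n + 1), Matrix.trace (basisOp n l l * K) • basisOp n l l := by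
    conv_lhs => rw [eq_sum_basisOp K]
    refine Finset.sum_congr rfl fun l hl => ?_
    have hl := Finset.mem_range.1 hl
    rw [Finset.sum_eq_single_of_mem l (Finset.mem_range.2 (by omega)), hsym]
    intro k hk hne
    have hk := Finset.mem_range.1 hk
    rw [hoff l (by omega) k (by omega) hne, zero_smul]
  set c : ℕ → ℝ := fun l => (Matrix.trace (basisOp n l l * K)).re /
    Real.sqrt ((2 * l + 1) / (n + 1)) with hcdef
  have hval : ∀ l ≤ n, Matrix.trace (basisOp n l l * K) =
      ((c l * Real.sqrt ((2 * l + 1) / (n + 1)) : ℝ) : ℂ) := by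
    intro l hl
    rw [hcdef]
    simp only
    rw [div_mul_cancel₀ _ (hpos l).ne']
    exact (Complex.conj_eq_iff_re.1 (hreal l hl)).symm
  have hc0 : c 0 = 1 := by
    rw [hcdef]
    simp only
    rw [basisOp_zero, Matrix.smul_mul, Matrix.one_mul, Matrix.trace_smul, htrace,
      Real.sqrt_div (by positivity)]
    simp only [smul_eq_mul, mul_one, Nat.cast_zero, mul_zero, zero_add, Real.sqrt_one]
    rw [← Complex.ofReal_inv, Complex.ofReal_re, one_div]
    exact div_self (by positivity)
  refine ⟨c, hc0, ?_, ?_⟩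
  · rw [kernelAtPole_eq hc0]
    conv_lhs => rw [hK]
    refine Finset.sum_congr rfl fun l hl => ?_
    rw [hval l (by have := Finset.mem_range.1 hl; omega)]
  · intro l hl h
    rw [hval l hl, h]
    simp

/-- By equivariance the functional at the pole, represented by K, determines W everywhere. The
stabilizer of the pole fixes K, and the axioms of a correspondence translate into the hypotheses of
`eq_kernelAtPole`. -/
theorem exists_eq_symbolMap {W : Op n →ₗ[ℂ] (S2 → ℂ)} (hW : IsSymbolCorrespondence n W) :
    ∃ c : ℕ → ℝ, IsCharString n c ∧ W = symbolMap n c := by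
  obtain ⟨K, hK⟩ := exists_trace_representation ((LinearMap.proj northPole).comp W)
  have hK : ∀ P, W P northPole = Matrix.trace (P * K) := hK
  have hWx : ∀ (g : SU2) (x : S2), Rotates g northPole x → ∀ P,
      W P x = Matrix.trace (P * conjAct n g K) := by
    intro g x h P
    rw [trace_mul_conjAct, ← hK, ← hW.equivariant g _ _ h, conjAct_conjAct_inv]
  have htorus : ∀ t, conjAct n (rotZ t)⁻¹ K = K := by
    intro t
    refine Matrix.ext_iff_trace_mul_left.2 fun P => ?_
    rw [← hWx _ _ (rotates_rotZ_northPole t).inv, hK]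
  have hreal : ∀ l ≤ n,
      conj (Matrix.trace (basisOp n l l * K)) = Matrix.trace (basisOp n l l * K) := by
    intro l _
    have e : (basisOp n l l).conjTranspose = basisOp n l l := by
      ext a b
      rw [Matrix.conjTranspose_apply, basisOp_apply, basisOp_apply]
      by_cases hab : a = b
      · subst hab; simp
      · have h1 : (a : ℕ) ≠ b := fun e => hab (Fin.ext e)
        rw [coupledAux_apply_of_ne (by omega), coupledAux_apply_of_ne (by omega)]
        simp
    rw [← hK, ← hW.real, e]
  have htrace : Matrix.trace K = 1 := by
    have h := hW.normalized 1
    have e : ∀ x, W 1 x = Matrix.trace K := by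
      intro x
      obtain ⟨g, hg⟩ := exists_rotates x
      rw [hWx g x hg, one_mul, trace_conjAct]
    simp only [e, integral_const, area_real_univ, Matrix.trace_one, Fintype.card_fin] at h
    have hpi : (Real.pi : ℂ) ≠ 0 := by exact_mod_cast Real.pi_ne_zero
    have hn : (n : ℂ) + 1 ≠ 0 := by exact_mod_cast Nat.succ_ne_zero n
    rw [Complex.real_smul] at h
    push_cast at h
    field_simp at h
    exact h
  obtain ⟨c, hc0, hKc, hcz⟩ := eq_kernelAtPole htorus hreal htrace
  have hWc : W = symbolMap n c := by
    refine LinearMap.ext fun P => funext fun x => ?_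
    rw [hWx _ x (exists_rotates x).choose_spec, hKc]
    rfl
  refine ⟨c, ⟨hc0, fun l _ hl hcl => ?_⟩, hWc⟩
  -- If c_l = 0, then e(l,0) would have zero symbol. Injectivity would make it zero, although its
  -- norm is one.
  have hzero : W (basisOp n l l) = 0 := by
    funext x
    rw [hWc, symbolMap_eq hc0]
    refine Finset.sum_eq_zero fun l' hl' => ?_
    by_cases h : l' = l
    · rw [h, hcl]; simp
    · rw [trace_harmOp_mul_eq_conj, Finset.sum_eq_zero, mul_zero]
      intro k hk
      have hk := Finset.mem_range.1 hk
      rw [Matrix.trace_mul_comm, basisOp_self_eq_diagonal, ← Matrix.diagonal_transpose,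
        ← basisOp_self_eq_diagonal, trace_basisOp_transpose_mul hl (by omega) (by omega),
        if_neg (fun e => h e.1.symm), mul_zero]
  have h0 : basisOp n l l = 0 := hW.injective (by rw [hzero, map_zero])
  have h1 := trace_basisOp_transpose_mul (n := n) (l := l) (l' := l) (k := l) (k' := l) hl
    (by omega) (by omega)
  rw [h0] at h1
  simp at h1

/-! ### The trikernel in spherical harmonics -/

theorem sum_Icc_neg_eq_sum_range {M : Type*} [AddCommMonoid M] (l : ℕ) (f : ℤ → M) :
    ∑ m ∈ Finset.Icc (-(l : ℤ)) l, f m = ∑ k ∈ Finset.range (2 * l + 1), f ((l : ℤ) - k) := by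
  symm
  refine Finset.sum_nbij' (fun k => (l : ℤ) - k) (fun m => ((l : ℤ) - m).toNat) ?_ ?_ ?_ ?_ ?_
  · intro k hk
    have := Finset.mem_range.1 hk
    exact Finset.mem_Icc.2 ⟨by omega, by omega⟩
  · intro m hm
    have := Finset.mem_Icc.1 hm
    exact Finset.mem_range.2 (by omega)
  · intro k hk
    simp
  · intro m hm
    have := Finset.mem_Icc.1 hm
    omega
  · intro k _
    rfl

theorem trace_sum_smul_mul_sum_smul_mul_sum_smul {ι : Type*} (s t u : Finset ι) (a b c : ι → ℂ)
    (A B C : ι → Op n) :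
    Matrix.trace ((∑ i ∈ s, a i • A i) * (∑ i ∈ t, b i • B i) * ∑ i ∈ u, c i • C i) =
      ∑ i ∈ s, ∑ j ∈ t, ∑ k ∈ u, a i * b j * c k * Matrix.trace (A i * B j * C k) := by
  rw [Finset.sum_mul, Finset.sum_mul, Matrix.trace_sum]
  refine Finset.sum_congr rfl fun i _ => ?_
  rw [Finset.mul_sum t, Finset.sum_mul, Matrix.trace_sum]
  refine Finset.sum_congr rfl fun j _ => ?_
  rw [Finset.mul_sum, Matrix.trace_sum]
  refine Finset.sum_congr rfl fun k _ => ?_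
  simp only [Matrix.smul_mul, Matrix.mul_smul, Matrix.trace_smul, smul_eq_mul]
  ring

/-- The common source of all the expansions. The constant is ((n+1)/4π)² times (n+1)^{-3/2}, one
factor (n+1)^{-1/2} for each kernel. -/
theorem trikernel_eq_sum_trace_harmOp {c : ℕ → ℝ} (hc : c 0 = 1) (x₁ x₂ x₃ : S2) :
    trikernel n c x₁ x₂ x₃ = ((Real.sqrt (n + 1) / (4 * Real.pi) ^ 2 : ℝ) : ℂ) *
      ∑ l₁ ∈ Finset.range (n + 1), ∑ l₂ ∈ Finset.range (n + 1), ∑ l₃ ∈ Finset.range (n + 1),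
        ((c l₃ / (c l₁ * c l₂) : ℝ) : ℂ) *
          Matrix.trace (harmOp n l₁ x₁ * harmOp n l₂ x₂ * harmOp n l₃ x₃) := by
  have hc' : (fun l => (c l)⁻¹) 0 = 1 := by simp [hc]
  rw [trikernel, opKernel_eq hc, opKernel_eq hc', opKernel_eq hc']
  rw [trace_sum_smul_mul_sum_smul_mul_sum_smul]
  simp only [Finset.mul_sum]
  refine Finset.sum_congr rfl fun l₁ _ => ?_
  refine Finset.sum_congr rfl fun l₂ _ => Finset.sum_congr rfl fun l₃ _ => ?_
  have h0 := sqrt_succ_ne_zero n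
  have hpi : (Real.pi : ℂ) ≠ 0 := by exact_mod_cast Real.pi_ne_zero
  push_cast
  rw [← sqrt_succ_mul_self]
  field_simp

theorem trace_harmOp_mul_mul (l₁ l₂ l₃ : ℕ) (x₁ x₂ x₃ : S2) :
    Matrix.trace (harmOp n l₁ x₁ * harmOp n l₂ x₂ * harmOp n l₃ x₃) =
      ∑ k₁ ∈ Finset.range (2 * l₁ + 1), ∑ k₂ ∈ Finset.range (2 * l₂ + 1),
        ∑ k₃ ∈ Finset.range (2 * l₃ + 1),
          ((Matrix.trace (coupledAux n l₁ k₁ * coupledAux n l₂ k₂ * coupledAux n l₃ k₃) : ℝ) : ℂ) *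
            conj (sphHarm l₁ (l₁ - k₁) x₁) * conj (sphHarm l₂ (l₂ - k₂) x₂) *
            conj (sphHarm l₃ (l₃ - k₃) x₃) := by
  simp only [harmOp]
  rw [trace_sum_smul_mul_sum_smul_mul_sum_smul]
  refine Finset.sum_congr rfl fun k₁ _ => ?_
  refine Finset.sum_congr rfl fun k₂ _ => Finset.sum_congr rfl fun k₃ _ => ?_
  rw [basisOp, basisOp, basisOp, ← map_ofReal_mul, ← map_ofReal_mul, trace_map_ofReal]
  ring

/-- The restricted sum is in fact complete, because the terms that violate the triangle or weight
condition have zero trace. -/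
theorem trace_harmOp_mul_mul_eq_wignerProduct {l₁ l₂ l₃ : ℕ} (hl : l₃ ≤ n) (x₁ x₂ x₃ : S2) :
    Matrix.trace (harmOp n l₁ x₁ * harmOp n l₂ x₂ * harmOp n l₃ x₃) = (-1) ^ n *
      ∑ m₁ ∈ Finset.Icc (-(l₁ : ℤ)) l₁, ∑ m₂ ∈ Finset.Icc (-(l₂ : ℤ)) l₂,
        ∑ m₃ ∈ Finset.Icc (-(l₃ : ℤ)) l₃,
          if |(l₁ : ℤ) - l₂| ≤ l₃ ∧ l₃ ≤ l₁ + l₂ ∧ m₁ + m₂ + m₃ = 0 then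
            (wignerProduct n l₁ l₂ l₃ m₁ m₂ m₃ : ℂ) * conj (sphHarm l₁ m₁ x₁) *
              conj (sphHarm l₂ m₂ x₂) * conj (sphHarm l₃ m₃ x₃)
          else 0 := by
  simp only [sum_Icc_neg_eq_sum_range, trace_harmOp_mul_mul, Finset.mul_sum]
  refine Finset.sum_congr rfl fun k₁ _ => Finset.sum_congr rfl fun k₂ _ =>
    Finset.sum_congr rfl fun k₃ hk₃ => ?_
  split_ifs with h
  · have hs : ((-1 : ℂ) ^ n) * (-1) ^ n = 1 := by rw [← mul_pow]; simp
    rw [wignerProduct_eq hl (by have := Finset.mem_range.1 hk₃; omega)]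
    push_cast
    simp only [← mul_assoc]
    rw [hs, one_mul]
  · rw [trace_triple_eq_zero]
    · simp
    · intro h'
      exact h ⟨h'.1, by have := h'.2.1; omega, h'.2.2⟩

theorem trikernel_eq_sum_sphHarm {c : ℕ → ℝ} (hc : c 0 = 1) (x₁ x₂ x₃ : S2) :
    trikernel n c x₁ x₂ x₃ =
      (((-1) ^ n * Real.sqrt (n + 1) / (4 * Real.pi) ^ 2 : ℝ) : ℂ) *
        ∑ l₁ ∈ Finset.range (n + 1), ∑ l₂ ∈ Finset.range (n + 1), ∑ l₃ ∈ Finset.range (n + 1),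
        ∑ m₁ ∈ Finset.Icc (-(l₁ : ℤ)) l₁, ∑ m₂ ∈ Finset.Icc (-(l₂ : ℤ)) l₂,
        ∑ m₃ ∈ Finset.Icc (-(l₃ : ℤ)) l₃,
          if |(l₁ : ℤ) - l₂| ≤ l₃ ∧ l₃ ≤ l₁ + l₂ ∧ m₁ + m₂ + m₃ = 0 then
            ((wignerProduct n l₁ l₂ l₃ m₁ m₂ m₃ * (c l₃ / (c l₁ * c l₂)) : ℝ) : ℂ) *
              conj (sphHarm l₁ m₁ x₁) * conj (sphHarm l₂ m₂ x₂) * conj (sphHarm l₃ m₃ x₃)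
          else 0 := by
  rw [trikernel_eq_sum_trace_harmOp hc, Finset.mul_sum, Finset.mul_sum]
  refine Finset.sum_congr rfl fun l₁ _ => ?_
  rw [Finset.mul_sum, Finset.mul_sum]
  refine Finset.sum_congr rfl fun l₂ _ => ?_
  rw [Finset.mul_sum, Finset.mul_sum]
  refine Finset.sum_congr rfl fun l₃ hl₃ => ?_
  rw [trace_harmOp_mul_mul_eq_wignerProduct (by have := Finset.mem_range.1 hl₃; omega)]
  simp only [Finset.mul_sum]
  refine Finset.sum_congr rfl fun m₁ _ => Finset.sum_congr rfl fun m₂ _ =>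
    Finset.sum_congr rfl fun m₃ _ => ?_
  split_ifs
  · push_cast
    ring
  · simp

/-! ### The Berezin projections -/

/-- The components of a spinor over the point `x`, the first column of an element of `SU(2)` which
rotates the north pole to `x`. -/
def spinor (x : S2) (i : Fin 2) : ℂ :=
  ((exists_rotates x).choose : Matrix (Fin 2) (Fin 2) ℂ) i 0

/-- These are the entries of ψψ* = (1 + x·σ)/2, obtained from g σ₃ = (x·σ) g and the unitarity of g.
-/
theorem spinor_mul_conj (x : S2) :
    spinor x 0 * conj (spinor x 0) = (1 + coord x 2) / 2 ∧
    spinor x 1 * conj (spinor x 1) = (1 - coord x 2) / 2 ∧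
    spinor x 1 * conj (spinor x 0) = (coord x 0 + Complex.I * coord x 1) / 2 ∧
    spinor x 0 * conj (spinor x 1) = (coord x 0 - Complex.I * coord x 1) / 2 := by
  have hr := (rotates_iff _ _ _).1 (exists_rotates x).choose_spec
  obtain ⟨h1, h2, h3⟩ := SU2_entries (exists_rotates x).choose
  obtain ⟨a0, a1, a2⟩ := coord_northPole
  have e00 := congrFun (congrFun hr 0) 0
  have e01 := congrFun (congrFun hr 0) 1
  have e10 := congrFun (congrFun hr 1) 0
  have e11 := congrFun (congrFun hr 1) 1
  simp only [Matrix.mul_apply, Fin.sum_univ_two, pauli, a0, a1, a2, h1, h2, Matrix.of_apply,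
    Matrix.cons_val_zero, Matrix.cons_val_one, Matrix.cons_val', Matrix.cons_val_fin_one,
    Complex.ofReal_zero, Complex.ofReal_one, mul_zero, mul_one, add_zero, sub_zero, zero_add,
    mul_neg] at e00 e01 e10 e11
  simp only [spinor]
  set a := ((exists_rotates x).choose : Matrix (Fin 2) (Fin 2) ℂ) 0 0
  set c := ((exists_rotates x).choose : Matrix (Fin 2) (Fin 2) ℂ) 1 0
  refine ⟨?_, ?_, ?_, ?_⟩
  · linear_combination (conj a * e00 - c * e01) / 2 + (1 + (coord x 2 : ℂ)) / 2 * h3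
  · linear_combination (conj c * e10 + a * e11) / 2 + (1 - (coord x 2 : ℂ)) / 2 * h3
  · linear_combination (conj a * e10 - c * e11) / 2 +
      ((coord x 0 : ℂ) + Complex.I * coord x 1) / 2 * h3
  · linear_combination (conj c * e00 + a * e01) / 2 +
      ((coord x 0 : ℂ) - Complex.I * coord x 1) / 2 * h3

theorem berezin_zero (n : ℕ) : berezin n 0 = 1 := by
  rw [berezin_eq (Nat.zero_le n), add_zero, Nat.sub_zero, Nat.factorial_succ, Nat.cast_mul,
    mul_assoc, Real.sqrt_mul (by positivity), Real.sqrt_mul_self (by positivity), Nat.cast_succ]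
  have : Real.sqrt ((n : ℝ) + 1) ≠ 0 := (Real.sqrt_pos.2 (by positivity)).ne'
  field_simp

/-- The b_l are scaled to be the coordinates of diag(1,0,…,0) in the coupled basis. Elements of
nonzero weight have no corner entry and do not contribute. -/
theorem kernelAtPole_berezin (n : ℕ) : kernelAtPole n (berezin n) = Matrix.single 0 0 1 := by
  rw [kernelAtPole_eq (berezin_zero n)]
  conv_rhs => rw [eq_sum_basisOp (Matrix.single 0 0 1)]
  refine Finset.sum_congr rfl fun l _ => ?_
  have htr : ∀ k, Matrix.trace ((basisOp n l k).transpose * Matrix.single 0 0 1) =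
      basisOp n l k 0 0 := by
    intro k
    rw [Matrix.trace_mul_single]
    simp
  rw [Finset.sum_eq_single_of_mem l (Finset.mem_range.2 (by omega)), htr]
  · congr 1
    have h1 : Real.sqrt ((n + 1) / (2 * l + 1)) * Real.sqrt ((2 * l + 1) / (n + 1)) = 1 := by
      rw [← Real.sqrt_mul (by positivity), div_mul_div_cancel₀ (by positivity),
        div_self (by positivity), Real.sqrt_one]
    rw [basisOp_apply, berezin, coupled_zero, mul_right_comm, h1, one_mul]
  · intro k _ hk
    rw [htr, basisOp_apply, coupledAux_apply_of_ne (by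
      rw [Fin.val_zero]
      omega)]
    simp

/-- The coherent state vector `√(n choose k) z₁^{n-k} z₂^k`. -/
def coherent (n : ℕ) (x : S2) (k : Fin (n + 1)) : ℂ :=
  (Real.sqrt (n.choose k) : ℂ) * (spinor x 0 ^ (n - (k : ℕ)) * spinor x 1 ^ (k : ℕ))

/-- Conjugating the corner matrix unit by g multiplies the first column of φ_j(g) by the first row
of φ_j(g⁻¹), which is its conjugate transpose. -/
theorem opKernel_berezin (n : ℕ) (x : S2) : opKernel n (berezin n) x =
    Matrix.vecMulVec (coherent n x) fun k => conj (coherent n x k) := by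
  ext k l
  rw [opKernel, kernelAtPole_berezin, conjAct, Matrix.mul_assoc, Matrix.mul_apply,
    Finset.sum_eq_single 0, Matrix.single_mul_apply_same, one_mul, spinRep_col_zero,
    spinRep_row_zero, Matrix.vecMulVec_apply]
  · simp only [coherent, spinor, map_mul, map_pow, Complex.conj_ofReal, coe_inv_SU2,
      Matrix.star_apply]
    rfl
  · intro b _ hb
    rw [Matrix.single_mul_apply_of_ne _ _ _ _ _ hb, mul_zero]
  · simp

theorem sum_conj_coherent_mul (x y : S2) : ∑ k, conj (coherent n x k) * coherent n y k =
    (conj (spinor x 0) * spinor y 0 + conj (spinor x 1) * spinor y 1) ^ n := by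
  rw [add_comm (conj (spinor x 0) * spinor y 0), add_pow, ← Fin.sum_univ_eq_sum_range (fun k => (conj (spinor x 1) * spinor y 1) ^ k *
    (conj (spinor x 0) * spinor y 0) ^ (n - k) * (n.choose k : ℂ))]
  refine Finset.sum_congr rfl fun k _ => ?_
  have h : (Real.sqrt (n.choose k) : ℂ) * Real.sqrt (n.choose k) = (n.choose k : ℂ) := by
    exact_mod_cast Real.mul_self_sqrt (Nat.cast_nonneg (n.choose k))
  simp only [coherent, map_mul, map_pow, Complex.conj_ofReal, mul_pow]
  rw [← h]
  ring

theorem trace_opKernel_berezin (x y z : S2) :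
    Matrix.trace (opKernel n (berezin n) x * opKernel n (berezin n) y * opKernel n (berezin n) z) =
      ((conj (spinor x 0) * spinor y 0 + conj (spinor x 1) * spinor y 1) *
        (conj (spinor y 0) * spinor z 0 + conj (spinor y 1) * spinor z 1) *
        (conj (spinor z 0) * spinor x 0 + conj (spinor z 1) * spinor x 1)) ^ n := by
  rw [mul_pow, mul_pow, ← sum_conj_coherent_mul, ← sum_conj_coherent_mul, ← sum_conj_coherent_mul]
  simp only [opKernel_berezin, Matrix.vecMulVec_mul_vecMulVec, Matrix.trace_vecMulVec,
    Matrix.vecMulVec_smul, Matrix.smul_mul, Matrix.trace_smul, dotProduct, smul_eq_mul]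
  simp only [mul_comm (coherent n x _)]
  ring

theorem det3_eq (x y z : S2) : det3 x y z =
    coord x 0 * coord y 1 * coord z 2 - coord x 0 * coord y 2 * coord z 1 -
      coord x 1 * coord y 0 * coord z 2 + coord x 1 * coord y 2 * coord z 0 +
      coord x 2 * coord y 0 * coord z 1 - coord x 2 * coord y 1 * coord z 0 :=
  Matrix.det_fin_three (Matrix.of ![coord x, coord y, coord z])

/-- Everything reduces to n = 1, where the trace of the product of (1 + x·σ)/2, (1 + y·σ)/2 and (1 +
z·σ)/2 equals (1 + X + i[x,y,z])/4. -/
theorem wildberger_eq (x y z : S2) : wildberger n x y z = 4 ^ n *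
    Matrix.trace (opKernel n (berezin n) x * opKernel n (berezin n) y *
      opKernel n (berezin n) z) := by
  rw [trace_opKernel_berezin, ← mul_pow, wildberger]
  congr 1
  obtain ⟨x00, x11, x10, x01⟩ := spinor_mul_conj x
  obtain ⟨y00, y11, y10, y01⟩ := spinor_mul_conj y
  obtain ⟨z00, z11, z10, z01⟩ := spinor_mul_conj z
  -- Regrouping by points leaves only the products ψ_a conj(ψ_b), which depend on the point and not
  -- on the chosen spinor.
  have e : (conj (spinor x 0) * spinor y 0 + conj (spinor x 1) * spinor y 1) *
        (conj (spinor y 0) * spinor z 0 + conj (spinor y 1) * spinor z 1) *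
        (conj (spinor z 0) * spinor x 0 + conj (spinor z 1) * spinor x 1) =
      spinor x 0 * conj (spinor x 0) * (spinor y 0 * conj (spinor y 0)) *
        (spinor z 0 * conj (spinor z 0)) +
      spinor x 0 * conj (spinor x 0) * (spinor y 0 * conj (spinor y 1)) *
        (spinor z 1 * conj (spinor z 0)) +
      spinor x 0 * conj (spinor x 1) * (spinor y 1 * conj (spinor y 0)) *
        (spinor z 0 * conj (spinor z 0)) +
      spinor x 0 * conj (spinor x 1) * (spinor y 1 * conj (spinor y 1)) *
        (spinor z 1 * conj (spinor z 0)) +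
      spinor x 1 * conj (spinor x 0) * (spinor y 0 * conj (spinor y 0)) *
        (spinor z 0 * conj (spinor z 1)) +
      spinor x 1 * conj (spinor x 0) * (spinor y 0 * conj (spinor y 1)) *
        (spinor z 1 * conj (spinor z 1)) +
      spinor x 1 * conj (spinor x 1) * (spinor y 1 * conj (spinor y 0)) *
        (spinor z 0 * conj (spinor z 1)) +
      spinor x 1 * conj (spinor x 1) * (spinor y 1 * conj (spinor y 1)) *
        (spinor z 1 * conj (spinor z 1)) := by ring
  rw [e, x00, x11, x10, x01, y00, y11, y10, y01, z00, z11, z10, z01, bigX, det3_eq, dot_eq,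
    dot_eq, dot_eq]
  push_cast
  ring_nf
  rw [Complex.I_sq]
  ring

/-! ### Wildberger integrals -/

theorem sum_trace_smul_harmOp {l : ℕ} (hl : l ≤ n) (x : S2) :
    ∑ k ∈ Finset.range (2 * l + 1),
      Matrix.trace ((basisOp n l k).transpose * harmOp n l x) • basisOp n l k = harmOp n l x := by
  conv_rhs => rw [harmOp]
  refine Finset.sum_congr rfl fun k hk => ?_
  have hk' := Finset.mem_range.1 hk
  congr 1
  rw [harmOp, Matrix.mul_sum, Matrix.trace_sum, Finset.sum_eq_single_of_mem k hk,
    Matrix.mul_smul, Matrix.trace_smul, trace_basisOp_transpose_mul hl (by omega) (by omega)]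
  · simp
  · intro k' h1 h2
    have h1 := Finset.mem_range.1 h1
    rw [Matrix.mul_smul, Matrix.trace_smul, trace_basisOp_transpose_mul hl (by omega) (by omega),
      if_neg (fun h => h2 h.2.symm), smul_zero]

/-- By the addition theorem the Legendre factor is tr(F_l(x) F_l(y)), the reproducing kernel of
degree l up to 4π. Integration replaces K_c(y) by its degree l component at x. -/
theorem integral_legendre_mul_symbolMap {c : ℕ → ℝ} (hc : c 0 = 1) {l : ℕ} (hl : l ≤ n) (x : S2)
    (P : Op n) :
    ∫ y, (((2 * l + 1) * (legendre l).eval (dot x y) : ℝ) : ℂ) *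
      Matrix.trace (P * opKernel n c y) ∂area =
      ((4 * Real.pi * (c l / Real.sqrt (n + 1)) : ℝ) : ℂ) * Matrix.trace (P * harmOp n l x) := by
  have e := integral_trace_harmOp_mul_symbolMap hc hl (harmOp n l x) P
  simp only [symbolMap_apply] at e
  simp only [← addition_theorem, ← trace_harmOp_mul hl]
  simp only [Matrix.trace_mul_comm (harmOp n l x)]
  rw [e]
  conv_rhs => rw [Matrix.trace_mul_comm, ← sum_trace_smul_harmOp hl x]
  simp only [Matrix.sum_mul, Matrix.trace_sum, Matrix.smul_mul, Matrix.trace_smul, smul_eq_mul]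
  push_cast
  ring

/-- Write Wildberger's function as a trace of three Berezin kernels and apply the reproducing
property to each variable, innermost first, using cyclicity to bring the integrated kernel to the
end. The factors 4π cancel the prefactor. -/
theorem wildInt_eq {l₁ l₂ l₃ : ℕ} (h₁ : l₁ ≤ n) (h₂ : l₂ ≤ n) (h₃ : l₃ ≤ n) (x₁ x₂ x₃ : S2) :
    wildInt n l₁ l₂ l₃ x₁ x₂ x₃ =
      ((4 ^ n * (berezin n l₁ * berezin n l₂ * berezin n l₃) / Real.sqrt (n + 1) ^ 3 : ℝ) : ℂ) *
        Matrix.trace (harmOp n l₁ x₁ * harmOp n l₂ x₂ * harmOp n l₃ x₃) := by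
  have i₃ : ∀ y₁ y₂, ∫ y₃, (((2 * l₁ + 1) * (legendre l₁).eval (dot x₁ y₁) *
        ((2 * l₂ + 1) * (legendre l₂).eval (dot x₂ y₂)) *
        ((2 * l₃ + 1) * (legendre l₃).eval (dot x₃ y₃)) : ℝ) : ℂ) *
      wildberger n y₁ y₂ y₃ ∂area =
      (4 ^ n * (((2 * l₁ + 1) * (legendre l₁).eval (dot x₁ y₁) : ℝ) : ℂ) *
        ((4 * Real.pi * (berezin n l₃ / Real.sqrt (n + 1)) : ℝ) : ℂ)) *
        ((((2 * l₂ + 1) * (legendre l₂).eval (dot x₂ y₂) : ℝ) : ℂ) *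
          Matrix.trace (harmOp n l₃ x₃ * opKernel n (berezin n) y₁ *
            opKernel n (berezin n) y₂)) := by
    intro y₁ y₂
    rw [Matrix.mul_assoc, Matrix.trace_mul_comm]
    have e := integral_legendre_mul_symbolMap (berezin_zero n) h₃ x₃
      (opKernel n (berezin n) y₁ * opKernel n (berezin n) y₂)
    calc _ = ∫ y₃, (4 ^ n * (((2 * l₁ + 1) * (legendre l₁).eval (dot x₁ y₁) : ℝ) : ℂ) *
          (((2 * l₂ + 1) * (legendre l₂).eval (dot x₂ y₂) : ℝ) : ℂ)) *
          ((((2 * l₃ + 1) * (legendre l₃).eval (dot x₃ y₃) : ℝ) : ℂ) *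
            Matrix.trace (opKernel n (berezin n) y₁ * opKernel n (berezin n) y₂ *
              opKernel n (berezin n) y₃)) ∂area := by
          congr 1
          funext y₃
          rw [wildberger_eq]
          push_cast
          ring
      _ = _ := by
          rw [integral_const_mul, e]
          ring
  have i₂ : ∀ y₁, ∫ y₂, ∫ y₃, (((2 * l₁ + 1) * (legendre l₁).eval (dot x₁ y₁) *
        ((2 * l₂ + 1) * (legendre l₂).eval (dot x₂ y₂)) *
        ((2 * l₃ + 1) * (legendre l₃).eval (dot x₃ y₃)) : ℝ) : ℂ) *
      wildberger n y₁ y₂ y₃ ∂area ∂area =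
      (4 ^ n * ((4 * Real.pi * (berezin n l₂ / Real.sqrt (n + 1)) : ℝ) : ℂ) *
        ((4 * Real.pi * (berezin n l₃ / Real.sqrt (n + 1)) : ℝ) : ℂ)) *
        ((((2 * l₁ + 1) * (legendre l₁).eval (dot x₁ y₁) : ℝ) : ℂ) *
          Matrix.trace (harmOp n l₂ x₂ * harmOp n l₃ x₃ * opKernel n (berezin n) y₁)) := by
    intro y₁
    simp only [i₃]
    rw [integral_const_mul, integral_legendre_mul_symbolMap (berezin_zero n) h₂,
      Matrix.mul_assoc (harmOp n l₂ x₂), Matrix.trace_mul_comm (harmOp n l₂ x₂)]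
    ring
  rw [wildInt]
  simp only [i₂]
  rw [integral_const_mul, integral_legendre_mul_symbolMap (berezin_zero n) h₁,
    Matrix.mul_assoc (harmOp n l₁ x₁), Matrix.trace_mul_comm (harmOp n l₁ x₁)]
  have hpi : (Real.pi : ℂ) ≠ 0 := by exact_mod_cast Real.pi_ne_zero
  have h0 := sqrt_succ_ne_zero n
  push_cast
  field_simp

/-- Solve `wildInt_eq` for the trace of the three F_l, which is possible because no b_l with l ≤ n
vanishes, and insert it into `trikernel_eq_sum_trace_harmOp`. -/
theorem trikernel_eq_sum_wildInt {c : ℕ → ℝ} (hc : c 0 = 1) (x₁ x₂ x₃ : S2) :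
    trikernel n c x₁ x₂ x₃ = (((n + 1) / (2 ^ n * (4 * Real.pi)) : ℝ) : ℂ) ^ 2 *
      ∑ l₁ ∈ Finset.range (n + 1), ∑ l₂ ∈ Finset.range (n + 1), ∑ l₃ ∈ Finset.range (n + 1),
        ((c l₃ / (c l₁ * c l₂) *
          (1 / (berezin n l₁ * berezin n l₂ * berezin n l₃)) : ℝ) : ℂ) *
            wildInt n l₁ l₂ l₃ x₁ x₂ x₃ := by
  rw [trikernel_eq_sum_trace_harmOp hc]
  simp only [Finset.mul_sum]
  refine Finset.sum_congr rfl fun l₁ h₁ => Finset.sum_congr rfl fun l₂ h₂ =>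
    Finset.sum_congr rfl fun l₃ h₃ => ?_
  have h₁ : l₁ ≤ n := Nat.lt_succ_iff.1 (Finset.mem_range.1 h₁)
  have h₂ : l₂ ≤ n := Nat.lt_succ_iff.1 (Finset.mem_range.1 h₂)
  have h₃ : l₃ ≤ n := Nat.lt_succ_iff.1 (Finset.mem_range.1 h₃)
  rw [wildInt_eq h₁ h₂ h₃]
  have b₁ : (berezin n l₁ : ℂ) ≠ 0 := by exact_mod_cast berezin_ne_zero h₁
  have b₂ : (berezin n l₂ : ℂ) ≠ 0 := by exact_mod_cast berezin_ne_zero h₂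
  have b₃ : (berezin n l₃ : ℂ) ≠ 0 := by exact_mod_cast berezin_ne_zero h₃
  have hpi : (Real.pi : ℂ) ≠ 0 := by exact_mod_cast Real.pi_ne_zero
  have h0 := sqrt_succ_ne_zero n
  have h4 : (4 : ℂ) ^ n = 2 ^ n * 2 ^ n := by rw [← mul_pow]; norm_num
  push_cast
  rw [← sqrt_succ_mul_self, h4]
  field_simp

theorem trikernel_eq_sum_factorial_wildInt {c : ℕ → ℝ} (hc : c 0 = 1) (x₁ x₂ x₃ : S2) :
    trikernel n c x₁ x₂ x₃ =
      ((Real.sqrt (n + 1) / ((n.factorial : ℝ) ^ 3 * 4 ^ n * (4 * Real.pi) ^ 2) : ℝ) : ℂ) *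
      ∑ l₁ ∈ Finset.range (n + 1), ∑ l₂ ∈ Finset.range (n + 1), ∑ l₃ ∈ Finset.range (n + 1),
        ((c l₃ / (c l₁ * c l₂) *
          (Real.sqrt ((n + l₁ + 1).factorial * (n - l₁).factorial) *
           Real.sqrt ((n + l₂ + 1).factorial * (n - l₂).factorial) *
           Real.sqrt ((n + l₃ + 1).factorial * (n - l₃).factorial)) : ℝ) : ℂ) *
            wildInt n l₁ l₂ l₃ x₁ x₂ x₃ := by
  rw [trikernel_eq_sum_wildInt hc]
  simp only [Finset.mul_sum]
  refine Finset.sum_congr rfl fun l₁ h₁ => Finset.sum_congr rfl fun l₂ h₂ =>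
    Finset.sum_congr rfl fun l₃ h₃ => ?_
  have h₁ : l₁ ≤ n := Nat.lt_succ_iff.1 (Finset.mem_range.1 h₁)
  have h₂ : l₂ ≤ n := Nat.lt_succ_iff.1 (Finset.mem_range.1 h₂)
  have h₃ : l₃ ≤ n := Nat.lt_succ_iff.1 (Finset.mem_range.1 h₃)
  rw [berezin_eq h₁, berezin_eq h₂, berezin_eq h₃]
  have hs : ∀ l : ℕ, (Real.sqrt ((n + l + 1).factorial * (n - l).factorial) : ℂ) ≠ 0 := fun l => by
    exact_mod_cast (Real.sqrt_pos.2 (by positivity)).ne'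
  have s₁ := hs l₁
  have s₂ := hs l₂
  have s₃ := hs l₃
  have hf : (n.factorial : ℂ) ≠ 0 := by exact_mod_cast n.factorial_ne_zero
  have hpi : (Real.pi : ℂ) ≠ 0 := by exact_mod_cast Real.pi_ne_zero
  have h0 := sqrt_succ_ne_zero n
  have h4 : (4 : ℂ) ^ n = 2 ^ n * 2 ^ n := by rw [← mul_pow]; norm_num
  push_cast
  rw [← sqrt_succ_mul_self, h4]
  field_simp

/-! ### Polynomial functions on the sphere are symbols -/

/-- The functions `z₁^{n-k} z₂^k conj(z₁)^{n-l} conj(z₂)^l` on the sphere. -/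
def spinMonomial (n k l : ℕ) (x : S2) : ℂ :=
  spinor x 0 ^ (n - k) * spinor x 1 ^ k *
    (conj (spinor x 0) ^ (n - l) * conj (spinor x 1) ^ l)

/-- The span of the functions `spinMonomial n k l`. -/
def spinSpan (n : ℕ) : Submodule ℂ (S2 → ℂ) :=
  Submodule.span ℂ {f | ∃ k ≤ n, ∃ l ≤ n, f = spinMonomial n k l}

theorem spinMonomial_mem {k l : ℕ} (hk : k ≤ n) (hl : l ≤ n) : spinMonomial n k l ∈ spinSpan n :=
  Submodule.subset_span ⟨k, hk, l, hl, rfl⟩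

theorem mul_mem_spinSpan {m : ℕ} {f g : S2 → ℂ} (hf : f ∈ spinSpan m) (hg : g ∈ spinSpan n) :
    f * g ∈ spinSpan (m + n) := by
  have h := Submodule.mul_mem_mul hf hg
  rw [spinSpan, spinSpan, Submodule.span_mul_span] at h
  refine Submodule.span_le.2 ?_ h
  rintro _ ⟨_, ⟨k, hk, l, hl, rfl⟩, _, ⟨k', hk', l', hl', rfl⟩, rfl⟩
  have e : spinMonomial m k l * spinMonomial n k' l' = spinMonomial (m + n) (k + k') (l + l') := by
    funext x
    simp only [Pi.mul_apply, spinMonomial]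
    rw [show m + n - (k + k') = (m - k) + (n - k') by omega,
      show m + n - (l + l') = (m - l) + (n - l') by omega]
    ring
  change spinMonomial m k l * spinMonomial n k' l' ∈ spinSpan (m + n)
  rw [e]
  exact spinMonomial_mem (by omega) (by omega)

theorem one_mem_spinSpan_zero : (1 : S2 → ℂ) ∈ spinSpan 0 := by
  have e : spinMonomial 0 0 0 = 1 := by funext x; simp [spinMonomial]
  rw [← e]
  exact spinMonomial_mem le_rfl le_rfl

theorem one_mem_spinSpan_one : (1 : S2 → ℂ) ∈ spinSpan 1 := by
  have e : spinMonomial 1 0 0 + spinMonomial 1 1 1 = 1 := by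
    funext x
    obtain ⟨h00, h11, -, -⟩ := spinor_mul_conj x
    simp only [spinMonomial, Pi.add_apply, Pi.one_apply, Nat.sub_zero, Nat.sub_self, pow_one,
      pow_zero, mul_one, one_mul]
    rw [h00, h11]
    ring
  rw [← e]
  exact Submodule.add_mem _ (spinMonomial_mem (by simp) (by simp))
    (spinMonomial_mem le_rfl le_rfl)

/-- The relation 1 = |ψ₀|² + |ψ₁|² lets any monomial be rewritten with bidegree raised by one. -/
theorem spinSpan_mono : Monotone spinSpan := by
  refine monotone_nat_of_le_succ fun n f hf => ?_
  simpa using mul_mem_spinSpan hf one_mem_spinSpan_one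

theorem coord_mem_spinSpan (i : Fin 3) : (fun x => (coord x i : ℂ)) ∈ spinSpan 1 := by
  have m00 : spinMonomial 1 0 0 ∈ spinSpan 1 := spinMonomial_mem (by simp) (by simp)
  have m01 : spinMonomial 1 0 1 ∈ spinSpan 1 := spinMonomial_mem (by simp) (by simp)
  have m10 : spinMonomial 1 1 0 ∈ spinSpan 1 := spinMonomial_mem (by simp) (by simp)
  have m11 : spinMonomial 1 1 1 ∈ spinSpan 1 := spinMonomial_mem (by simp) (by simp)
  fin_cases i
  · have e : (fun x => (coord x 0 : ℂ)) = spinMonomial 1 0 1 + spinMonomial 1 1 0 := by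
      funext x
      obtain ⟨-, -, h10, h01⟩ := spinor_mul_conj x
      simp only [spinMonomial, Pi.add_apply, Nat.sub_zero, Nat.sub_self, pow_one,
        pow_zero, mul_one, one_mul]
      rw [h10, h01]
      ring
    exact e ▸ Submodule.add_mem _ m01 m10
  · have e : (fun x => (coord x 1 : ℂ)) =
        Complex.I • (spinMonomial 1 0 1 - spinMonomial 1 1 0) := by
      funext x
      obtain ⟨-, -, h10, h01⟩ := spinor_mul_conj x
      simp only [spinMonomial, Pi.smul_apply, Pi.sub_apply, Nat.sub_zero, Nat.sub_self, pow_one,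
        pow_zero, mul_one, one_mul, smul_eq_mul]
      rw [h10, h01]
      linear_combination (coord x 1 : ℂ) * Complex.I_sq
    exact e ▸ Submodule.smul_mem _ _ (Submodule.sub_mem _ m01 m10)
  · have e : (fun x => (coord x 2 : ℂ)) = spinMonomial 1 0 0 - spinMonomial 1 1 1 := by
      funext x
      obtain ⟨h00, h11, -, -⟩ := spinor_mul_conj x
      simp only [spinMonomial, Pi.sub_apply, Nat.sub_zero, Nat.sub_self, pow_one,
        pow_zero, mul_one, one_mul]
      rw [h00, h11]
      ring
    exact e ▸ Submodule.sub_mem _ m00 m11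

theorem pow_mem_spinSpan {f : S2 → ℂ} (hf : f ∈ spinSpan 1) (d : ℕ) : f ^ d ∈ spinSpan d := by
  induction d with
  | zero => simpa using one_mem_spinSpan_zero
  | succ d ih => rw [pow_succ]; exact mul_mem_spinSpan ih hf

theorem mem_spinSpan_of_mem_polySphere {f : S2 → ℂ} (hf : f ∈ PolySphere n) : f ∈ spinSpan n := by
  obtain ⟨p, hp, hfp⟩ := hf
  have e : f = ∑ d ∈ p.support, p.coeff d • ((fun x => (coord x 0 : ℂ)) ^ d 0 *
      (fun x => (coord x 1 : ℂ)) ^ d 1 * (fun x => (coord x 2 : ℂ)) ^ d 2) := by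
    funext x
    rw [hfp, MvPolynomial.eval_eq', Finset.sum_apply]
    refine Finset.sum_congr rfl fun d _ => ?_
    simp only [Fin.prod_univ_three, Pi.smul_apply, Pi.mul_apply, Pi.pow_apply, smul_eq_mul]
  rw [e]
  refine Submodule.sum_mem _ fun d hd => Submodule.smul_mem _ _ ?_
  have hdeg : d 0 + d 1 + d 2 ≤ n := by
    have h := (MvPolynomial.le_totalDegree hd).trans hp
    rw [Finsupp.sum_fintype _ _ (fun _ => rfl), Fin.sum_univ_three] at h
    exact h
  exact spinSpan_mono hdeg (mul_mem_spinSpan (mul_mem_spinSpan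
    (pow_mem_spinSpan (coord_mem_spinSpan 0) _) (pow_mem_spinSpan (coord_mem_spinSpan 1) _))
    (pow_mem_spinSpan (coord_mem_spinSpan 2) _))

/-- The entries of the Berezin kernel are nonzero multiples of these monomials, and matrix units
extract single entries. -/
theorem spinSpan_le_range : spinSpan n ≤ LinearMap.range (symbolMap n (berezin n)) := by
  refine Submodule.span_le.2 ?_
  rintro _ ⟨k, hk, l, hl, rfl⟩
  have hpos : ∀ {k : ℕ}, k ≤ n → (Real.sqrt (n.choose k) : ℂ) ≠ 0 := fun h => by
    exact_mod_cast (Real.sqrt_pos.2 (Nat.cast_pos.2 (Nat.choose_pos h))).ne'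
  have h1 := hpos hk
  have h2 := hpos hl
  refine ⟨((Real.sqrt (n.choose k) : ℂ) * Real.sqrt (n.choose l))⁻¹ •
    Matrix.single (⟨l, by omega⟩ : Fin (n + 1)) ⟨k, by omega⟩ 1, ?_⟩
  funext x
  rw [map_smul, Pi.smul_apply, symbolMap_apply, opKernel_berezin, Matrix.trace_single_mul,
    Matrix.vecMulVec_apply, one_smul, smul_eq_mul]
  simp only [coherent, spinMonomial, map_mul, map_pow, Complex.conj_ofReal]
  field_simp

theorem trace_harmOp_mem_range {c : ℕ → ℝ} (hc : IsCharString n c) {l : ℕ} (hl : l ≤ n)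
    (P : Op n) : (fun x => Matrix.trace (harmOp n l x * P)) ∈ LinearMap.range (symbolMap n c) := by
  have hcl : (c l : ℂ) ≠ 0 := by exact_mod_cast hc.ne_zero hl
  have h0 := sqrt_succ_ne_zero n
  -- The witness is the projection of P to the span of the e(l,m), rescaled to undo the factor
  -- c_l/√(n+1). Hence the range is the same for every characteristic string.
  refine ⟨((Real.sqrt (n + 1) : ℂ) / c l) • ∑ k ∈ Finset.range (2 * l + 1),
    Matrix.trace (basisOp n l k * P) • (basisOp n l k).transpose, ?_⟩
  have e : ∀ l' x, Matrix.trace (harmOp n l' x * ∑ k ∈ Finset.range (2 * l + 1),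
      Matrix.trace (basisOp n l k * P) • (basisOp n l k).transpose) =
      if l' = l then Matrix.trace (harmOp n l x * P) else 0 := by
    intro l' x
    have hterm : ∀ k ∈ Finset.range (2 * l + 1), ∀ k' ∈ Finset.range (2 * l' + 1),
        Matrix.trace (basisOp n l' k' * (basisOp n l k).transpose) =
          if l = l' ∧ k = k' then 1 else 0 := by
      intro k hk k' hk'
      have hk := Finset.mem_range.1 hk
      have hk' := Finset.mem_range.1 hk'
      rw [Matrix.trace_mul_comm, trace_basisOp_transpose_mul hl (by omega) (by omega)]
    rw [Matrix.mul_sum, Matrix.trace_sum]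
    simp only [Matrix.mul_smul, Matrix.trace_smul, trace_harmOp_mul_eq_conj, smul_eq_mul]
    split_ifs with h
    · subst h
      refine Finset.sum_congr rfl fun k hk => ?_
      rw [Finset.sum_eq_single_of_mem k hk, hterm k hk k hk, if_pos ⟨rfl, rfl⟩]
      · ring
      · intro k' hk' hne
        rw [hterm k hk k' hk', if_neg (fun h => hne h.2.symm), mul_zero]
    · refine Finset.sum_eq_zero fun k hk => ?_
      rw [Finset.sum_eq_zero, mul_zero]
      intro k' hk'
      rw [hterm k hk k' hk', if_neg (fun h' => h h'.1.symm), mul_zero]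
  funext x
  rw [map_smul, Pi.smul_apply, symbolMap_eq hc.1]
  simp only [e, mul_ite, mul_zero]
  rw [Finset.sum_ite_eq' , if_pos (Finset.mem_range.2 (by omega)), smul_eq_mul]
  push_cast
  field_simp

/-- Polynomials are first seen to be Berezin symbols; the degree components of a Berezin symbol lie
in the range of every W_c. -/
theorem polySphere_subset_range {c : ℕ → ℝ} (hc : IsCharString n c) {f : S2 → ℂ}
    (hf : f ∈ PolySphere n) : ∃ P, symbolMap n c P = f := by
  obtain ⟨P, rfl⟩ := spinSpan_le_range (mem_spinSpan_of_mem_polySphere hf)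
  have e : symbolMap n (berezin n) P = ∑ l ∈ Finset.range (n + 1),
      ((berezin n l / Real.sqrt (n + 1) : ℝ) : ℂ) •
        (fun x => Matrix.trace (harmOp n l x * P)) := by
    funext x
    rw [symbolMap_eq (berezin_zero n), Finset.sum_apply]
    rfl
  rw [e]
  exact Submodule.sum_mem (LinearMap.range (symbolMap n c)) fun l hl =>
    Submodule.smul_mem _ _ (trace_harmOp_mem_range hc (Nat.lt_succ_iff.1 (Finset.mem_range.1 hl)) P)

/-! ### Integral form of twisted products -/

theorem twistedProduct_symbolMap {c : ℕ → ℝ} (hc : IsCharString n c) (P Q : Op n) :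
    twistedProduct (symbolMap n c) (symbolMap n c P) (symbolMap n c Q) =
      symbolMap n c (P * Q) := by
  rw [twistedProduct, Function.leftInverse_invFun (injective_symbolMap hc),
    Function.leftInverse_invFun (injective_symbolMap hc)]

/-- By cyclicity the trace is the symbol W_{1/c} of K_c(x) K_{1/c}(x₁) at x₂. Duality in x₂ replaces
this by W_{1/c}(Q K_c(x)) at x₁, and duality in x₁ gives tr(PQ K_c(x)). Each use contributes
4π/(n+1), cancelling the squared prefactor. -/
theorem integral_symbolMap_mul_trikernel {c : ℕ → ℝ} (hc : IsCharString n c) (P Q : Op n)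
    (x : S2) : ∫ x₁, ∫ x₂, symbolMap n c P x₁ * symbolMap n c Q x₂ *
      trikernel n c x₁ x₂ x ∂area ∂area = symbolMap n c (P * Q) x := by
  set c' : ℕ → ℝ := fun l => (c l)⁻¹ with hc'
  have hdual := integral_symbolMap_mul_symbolMap hc.1 hc.inv.1
    (fun l hl => mul_inv_cancel₀ (hc.ne_zero hl))
  set κ : ℂ := ((((n : ℝ) + 1) / (4 * Real.pi) : ℝ) : ℂ) with hκ
  have hκ0 : 4 * (Real.pi : ℂ) / (n + 1) = κ⁻¹ := by rw [hκ]; push_cast; rw [inv_div]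
  have hκ1 : κ ≠ 0 := by
    have : ((n : ℝ) + 1) / (4 * Real.pi) ≠ 0 := by positivity
    exact Complex.ofReal_ne_zero.2 this
  rw [hκ0] at hdual
  have inner : ∀ x₁, ∫ x₂, symbolMap n c P x₁ * symbolMap n c Q x₂ *
      trikernel n c x₁ x₂ x ∂area =
      κ * (symbolMap n c P x₁ * symbolMap n c' (Q * opKernel n c x) x₁) := by
    intro x₁
    calc _ = ∫ x₂, κ ^ 2 * symbolMap n c P x₁ * (symbolMap n c Q x₂ *
          symbolMap n c' (opKernel n c x * opKernel n c' x₁) x₂) ∂area := by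
          congr 1
          funext x₂
          rw [trikernel, Matrix.trace_mul_comm, symbolMap_apply c', Matrix.mul_assoc]
          ring
      _ = _ := by
          rw [integral_const_mul, hdual, ← Matrix.mul_assoc, symbolMap_apply c']
          field_simp
  simp only [inner]
  rw [integral_const_mul, hdual, ← Matrix.mul_assoc, mul_inv_cancel_left₀ hκ1]
  rfl

end SpinTrikernel
end

/-! ### The main theorem -/

theorem theorem7p2p1 (n : ℕ) :
    -- symbol correspondences are the maps `symbolMap n c`, `c` a string of characteristic numbers
    (∀ W : Op n →ₗ[ℂ] (S2 → ℂ), IsSymbolCorrespondence n W ↔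
      ∃ c : ℕ → ℝ, IsCharString n c ∧ W = symbolMap n c) ∧
    ∀ c : ℕ → ℝ, IsCharString n c →
      -- the twisted product in integral form
      (∀ f ∈ PolySphere n, ∀ g ∈ PolySphere n, ∀ x : S2,
        twistedProduct (symbolMap n c) f g x =
          ∫ x₁, ∫ x₂, f x₁ * g x₂ * trikernel n c x₁ x₂ x ∂area ∂area) ∧
      -- the expansion in spherical harmonics
      (∀ x₁ x₂ x₃ : S2,
        trikernel n c x₁ x₂ x₃ =
          (((-1) ^ n * Real.sqrt (n + 1) / (4 * Real.pi) ^ 2 : ℝ) : ℂ) *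
            ∑ l₁ ∈ Finset.range (n + 1), ∑ l₂ ∈ Finset.range (n + 1),
            ∑ l₃ ∈ Finset.range (n + 1),
            ∑ m₁ ∈ Finset.Icc (-(l₁ : ℤ)) l₁, ∑ m₂ ∈ Finset.Icc (-(l₂ : ℤ)) l₂,
            ∑ m₃ ∈ Finset.Icc (-(l₃ : ℤ)) l₃,
              if |(l₁ : ℤ) - l₂| ≤ l₃ ∧ l₃ ≤ l₁ + l₂ ∧ m₁ + m₂ + m₃ = 0 then
                ((wignerProduct n l₁ l₂ l₃ m₁ m₂ m₃ * (c l₃ / (c l₁ * c l₂)) : ℝ) : ℂ) *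
                  starRingEnd ℂ (sphHarm l₁ m₁ x₁) * starRingEnd ℂ (sphHarm l₂ m₂ x₂) *
                  starRingEnd ℂ (sphHarm l₃ m₃ x₃)
              else 0) ∧
      -- the trikernel from Wildberger's function, with the Berezin characteristic numbers
      (∀ x₁ x₂ x₃ : S2,
        trikernel n c x₁ x₂ x₃ =
          (((n + 1) / (2 ^ n * (4 * Real.pi)) : ℝ) : ℂ) ^ 2 *
            ∑ l₁ ∈ Finset.range (n + 1), ∑ l₂ ∈ Finset.range (n + 1),
            ∑ l₃ ∈ Finset.range (n + 1),
              ((c l₃ / (c l₁ * c l₂) *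
                (1 / (berezin n l₁ * berezin n l₂ * berezin n l₃)) : ℝ) : ℂ) *
                wildInt n l₁ l₂ l₃ x₁ x₂ x₃) ∧
      -- the same with explicit coefficients
      (∀ x₁ x₂ x₃ : S2,
        trikernel n c x₁ x₂ x₃ =
          ((Real.sqrt (n + 1) / ((n.factorial : ℝ) ^ 3 * 4 ^ n * (4 * Real.pi) ^ 2) : ℝ) : ℂ) *
            ∑ l₁ ∈ Finset.range (n + 1), ∑ l₂ ∈ Finset.range (n + 1),
            ∑ l₃ ∈ Finset.range (n + 1),
              ((c l₃ / (c l₁ * c l₂) *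
                (Real.sqrt ((n + l₁ + 1).factorial * (n - l₁).factorial) *
                 Real.sqrt ((n + l₂ + 1).factorial * (n - l₂).factorial) *
                 Real.sqrt ((n + l₃ + 1).factorial * (n - l₃).factorial)) : ℝ) : ℂ) *
                wildInt n l₁ l₂ l₃ x₁ x₂ x₃) := by
  refine ⟨fun W => ⟨exists_eq_symbolMap, ?_⟩, fun c hc => ⟨?_, trikernel_eq_sum_sphHarm hc.1,
    trikernel_eq_sum_wildInt hc.1, trikernel_eq_sum_factorial_wildInt hc.1⟩⟩
  · rintro ⟨c, hc, rfl⟩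
    exact isSymbolCorrespondence_symbolMap hc
  · intro f hf g hg x
    -- The twisted product is defined through `Function.invFun`, so both polynomials must first be
    -- exhibited as symbols.
    obtain ⟨P, rfl⟩ := polySphere_subset_range hc hf
    obtain ⟨Q, rfl⟩ := polySphere_subset_range hc hg
    rw [twistedProduct_symbolMap hc, integral_symbolMap_mul_trikernel hc]
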